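/- **Theorem B (Rauch III).** Let $M, M_0$ be smooth Riemannian manifolds (not necessarily of the same dimension) with $\dim M_0\ge 2$, let $l>0$, and let $\gamma:[0,l]\to M$, $\gamma_0:[0,l]\to M_0$ be normal (i.e. unit speed) geodesics. Assume that for every $t\in[0,l]$ the sectional curvatures satisfy $$K(\gamma'(t),X)\le K(\gamma_0'(t),X_0)$$ for all $X\in T_{\gamma(t)}M$ and $X_0\in T_{\gamma_0(t)}M_0$ such that $\gamma'(t),X$ and $\gamma_0'(t),X_0$ are linearly independent. Let $V,V_0$ be Jacobi fields along $\gamma,\gamma_0$ with $$\|V(0)\|\ge\|V_0(0)\|>0,\quad \langle\gamma'(0),V(0)\rangle=\langle\gamma_0'(0),V_0(0)\rangle,\quad \langle\gamma'(0),V'(0)\rangle=\langle\gamma_0'(0),V_0'(0)\rangle,$$ where $'$ denotes covariant differentiation along the curve. For a vector field $W$ along $\gamma$ write $\widehat W=W-\langle W,\gamma'\rangle\gamma'$, and similarly along $\gamma_0$. Suppose that there are symmetric linear transformations $B$ of $\gamma'(0)^\perp$ and $B_0$ of $\gamma_0'(0)^\perp$, such that every eigenvalue of $B$ is at least every eigenvalue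 of $B_0$ (i.e. $\min\operatorname{eig}B\ge\max\operatorname{eig}B_0$), with $$\widehat{V'}(0)=B(\widehat V(0)),\qquad \widehat{V_0'}(0)=B_0(\widehat{V_0}(0)).$$ Suppose moreover that there is no focal point of $\gamma_0(0)$ with respect to $B_0$ on $\gamma_0$: there are no $\tau\in(0,l]$ and no Jacobi field $J$ along $\gamma_0$ with $0\ne J(0)\in\gamma_0'(0)^\perp$, $J'(0)=B_0(J(0))$ and $J(\tau)=0$. Then $$\|V(t)\|\ge\|V_0(t)\|\qquad\text{for all }t\in[0,l].$$ Moreover, if $\|V(t_0)\|=\|V_0(t_0)\|$ for some $t_0\in(0,l]$, then $\|\widehat V\|=\|\widehat{V_0}\|$ and $\|V\|=\|V_0\|$ on $[0,t_0]$; and if in addition $\widehat V(0)\ne0$, then on $[0,t_0]$ the normal parts $\widehat V,\widehat{V_0}$ do not vanish, $K(\gamma',V)=K(\gamma_0',V_0)$, and $\widehat V/\|\widehat V\|$ and $\widehat{V_0}/\|\widehat V\|$ are parallel vector fields along $\gamma$ and $\gamma_0$. -/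

import Mathlib

open Set Bundle
open scoped Manifold ContDiff Topology InnerProductSpace

namespace RauchComparison

noncomputable section

/-! Throughout, `M` is a smooth manifold without boundary, charted on a finite-dimensional real
vector space `E`, and its tangent spaces carry inner products that depend smoothly on the point
(a Riemannian manifold). In Mathlib `TangentSpace 𝓘(ℝ, E) p` is a copy of `E`: a tangent vector
at `p` is represented by its coordinates in the preferred chart at `p`. -/

section LeviCivita

variable {E : Type*} [NormedAddCommGroup E] [NormedSpace ℝ E]
  {M : Type*} [TopologicalSpace M] [ChartedSpace E M] [IsManifold 𝓘(ℝ, E) ∞ M]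
  [RiemannianBundle (fun x : M ↦ TangentSpace 𝓘(ℝ, E) x)]

/-- The Riemannian metric read in the preferred chart at `p`: for `y` in the image of the chart,
`metricInChart p y a b = g(a, b)`, where `a, b` are coordinate vectors at `y`. -/
def metricInChart (p : M) (y : E) : E →L[ℝ] E →L[ℝ] ℝ :=
  (innerSL ℝ (E := TangentSpace 𝓘(ℝ, E) ((extChartAt 𝓘(ℝ, E) p).symm y))).bilinearComp
    ((trivializationAt E (TangentSpace 𝓘(ℝ, E) : M → Type _) p).symmL ℝ
      ((extChartAt 𝓘(ℝ, E) p).symm y))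
    ((trivializationAt E (TangentSpace 𝓘(ℝ, E) : M → Type _) p).symmL ℝ
      ((extChartAt 𝓘(ℝ, E) p).symm y))

/-- The linear form `c ↦ (∂_a g (b, c) + ∂_b g (a, c) - ∂_c g (a, b)) / 2` (Christoffel symbols
of the first kind) at the point `y` of the chart at `p`. -/
def christoffelFirst (p : M) (y a b : E) : E →L[ℝ] ℝ :=
  (1 / 2 : ℝ) • (fderiv ℝ (metricInChart p) y a b + fderiv ℝ (metricInChart p) y b a
    - ((fderiv ℝ (metricInChart p) y).flip a).flip b)

/-- The Christoffel symbols of the Levi-Civita connection in the chart at `p`: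
`christoffel p y a b` is the vector `Γ(a, b)` with
`g(Γ(a, b), c) = (∂_a g (b, c) + ∂_b g (a, c) - ∂_c g (a, b)) / 2` for all `c`. -/
def christoffel (p : M) (y a b : E) : E :=
  (metricInChart p y).inverse (christoffelFirst p y a b)

/-- The Riemann curvature tensor in the coordinates of the chart at `p`, at the point `y`:
`R(a, b) c = ∂_a Γ(b, c) - ∂_b Γ(a, c) + Γ(a, Γ(b, c)) - Γ(b, Γ(a, c))`. -/
def curvatureInChart (p : M) (y a b c : E) : E :=
  fderiv ℝ (fun z ↦ christoffel p z b c) y a - fderiv ℝ (fun z ↦ christoffel p z a c) y b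
    + christoffel p y a (christoffel p y b c) - christoffel p y b (christoffel p y a c)

/-- The Riemann curvature tensor `R(u, v) w = ∇_u ∇_v w - ∇_v ∇_u w - ∇_[u, v] w` at `p`,
computed in the chart at `p`. -/
def curvature (p : M) (u v w : TangentSpace 𝓘(ℝ, E) p) : TangentSpace 𝓘(ℝ, E) p :=
  curvatureInChart (E := E) p (extChartAt 𝓘(ℝ, E) p p) u v w

/-- The sectional curvature `K(u, v)` of the plane spanned by linearly independent `u, v`. -/
def sectionalCurvature (p : M) (u v : TangentSpace 𝓘(ℝ, E) p) : ℝ :=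
  ⟪curvature p u v v, u⟫_ℝ / (‖u‖ ^ 2 * ‖v‖ ^ 2 - ⟪u, v⟫_ℝ ^ 2)

end LeviCivita

section Curves

variable {E : Type*} [NormedAddCommGroup E] [NormedSpace ℝ E]
  {M : Type*} [TopologicalSpace M] [ChartedSpace E M]

/-- The velocity `γ'(t)` of a curve defined on `s` (one-sided at the end points of an interval). -/
def velocity (γ : ℝ → M) (s : Set ℝ) (t : ℝ) : TangentSpace 𝓘(ℝ, E) (γ t) :=
  mfderivWithin 𝓘(ℝ, ℝ) 𝓘(ℝ, E) γ s t (1 : ℝ)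

variable [IsManifold 𝓘(ℝ, E) ∞ M]

/-- `V` is a smooth vector field along `γ` on `s`. -/
def IsSmoothAlong (γ : ℝ → M) (s : Set ℝ) (V : ∀ t, TangentSpace 𝓘(ℝ, E) (γ t)) : Prop :=
  ContMDiffOn 𝓘(ℝ, ℝ) 𝓘(ℝ, E).tangent ∞
    (fun t ↦ (⟨γ t, V t⟩ : TangentBundle 𝓘(ℝ, E) M)) s

variable [RiemannianBundle (fun x : M ↦ TangentSpace 𝓘(ℝ, E) x)]

/-- The Levi-Civita covariant derivative in the coordinates of the chart at `p`, at a time `t` with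
`γ t` in the domain of the chart: if `c` and `v` are the coordinates of `γ` and of the vector field
`V` along `γ`, this is `v'(t) + Γ(c'(t), v(t))`. -/
def covDerivInChart (p : M) (γ : ℝ → M) (s : Set ℝ) (V : ∀ t, TangentSpace 𝓘(ℝ, E) (γ t))
    (t : ℝ) : E :=
  letI c : ℝ → E := fun τ ↦ extChartAt 𝓘(ℝ, E) p (γ τ)
  letI v : ℝ → E := fun τ ↦
    (trivializationAt E (TangentSpace 𝓘(ℝ, E) : M → Type _) p ⟨γ τ, V τ⟩).2
  derivWithin v s t + christoffel p (c t) (derivWithin c s t) (v t)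

/-- The Levi-Civita covariant derivative `V'(t)` of a vector field along `γ`, computed in the chart
at `γ t` (one-sided at the end points of an interval `s`). -/
def covDeriv (γ : ℝ → M) (s : Set ℝ) (V : ∀ t, TangentSpace 𝓘(ℝ, E) (γ t)) (t : ℝ) :
    TangentSpace 𝓘(ℝ, E) (γ t) :=
  covDerivInChart (E := E) (γ t) γ s V t

/-- `V` is a (smooth) parallel vector field along `γ` on `s`. -/
def IsParallel (γ : ℝ → M) (s : Set ℝ) (V : ∀ t, TangentSpace 𝓘(ℝ, E) (γ t)) : Prop :=
  IsSmoothAlong γ s V ∧ ∀ t ∈ s, covDeriv γ s V t = 0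

/-- `γ` is a normal (that is, unit speed) geodesic on `s`. -/
structure IsNormalGeodesic (γ : ℝ → M) (s : Set ℝ) : Prop where
  smooth : ContMDiffOn 𝓘(ℝ, ℝ) 𝓘(ℝ, E) ∞ γ s
  geodesic : ∀ t ∈ s, covDeriv (E := E) γ s (velocity γ s) t = 0
  unit_speed : ∀ t ∈ s, ‖(velocity γ s t : TangentSpace 𝓘(ℝ, E) (γ t))‖ = 1

/-- `V` is a Jacobi field along `γ` on `s`: it is smooth and `V'' + R(V, γ')γ' = 0`. -/
def IsJacobiField (γ : ℝ → M) (s : Set ℝ) (V : ∀ t, TangentSpace 𝓘(ℝ, E) (γ t)) : Prop :=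
  IsSmoothAlong γ s V ∧
    ∀ t ∈ s, covDeriv γ s (covDeriv γ s V) t
      + curvature (γ t) (V t) (velocity γ s t) (velocity γ s t) = 0

/-- The normal part `V̂ = V - ⟨V, γ'⟩ γ'` of a vector field along a unit speed curve. -/
def normalPart (γ : ℝ → M) (s : Set ℝ) (V : ∀ t, TangentSpace 𝓘(ℝ, E) (γ t)) (t : ℝ) :
    TangentSpace 𝓘(ℝ, E) (γ t) :=
  V t - ⟪V t, velocity γ s t⟫_ℝ • velocity γ s t

/-- The orthogonal complement `γ'(t)^⊥` in the tangent space at `γ t`. -/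
abbrev normalSpace (γ : ℝ → M) (s : Set ℝ) (t : ℝ) : Submodule ℝ (TangentSpace 𝓘(ℝ, E) (γ t)) :=
  (ℝ ∙ (velocity γ s t : TangentSpace 𝓘(ℝ, E) (γ t)))ᗮ

theorem IsNormalGeodesic.normalPart_mem {γ : ℝ → M} {s : Set ℝ}
    (hγ : IsNormalGeodesic (E := E) γ s) (V : ∀ t, TangentSpace 𝓘(ℝ, E) (γ t))
    {t : ℝ} (ht : t ∈ s) : normalPart γ s V t ∈ normalSpace (E := E) γ s t := by
  rw [Submodule.mem_orthogonal_singleton_iff_inner_left, normalPart, inner_sub_left,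
    real_inner_smul_left, real_inner_self_eq_norm_sq, hγ.unit_speed t ht]
  simp

/-- `γ τ`, with `0 < τ ≤ l`, is a focal point of `γ 0` with respect to `B` on `γ|[0,l]`, where
`B` is a linear transformation of `γ'(0)^⊥`: there is a Jacobi field `J` along `γ` with
`0 ≠ J(0) ∈ γ'(0)^⊥`, `J'(0) = B(J(0))` and `J(τ) = 0`. -/
def IsFocalPoint (γ : ℝ → M) (l : ℝ) (B : Module.End ℝ (normalSpace (E := E) γ (Icc 0 l) 0))
    (τ : ℝ) : Prop :=
  0 < τ ∧ τ ≤ l ∧ ∃ J : ∀ t, TangentSpace 𝓘(ℝ, E) (γ t), IsJacobiField γ (Icc 0 l) J ∧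
    (∃ v : normalSpace (E := E) γ (Icc 0 l) 0,
      v ≠ 0 ∧ J 0 = v ∧ covDeriv γ (Icc 0 l) J 0 = B v) ∧
    J τ = 0

end Curves

end

end RauchComparison

/-!
The proof reduces the theorem to a comparison for linear second order systems on `γ'(0)^⊥` and
`γ₀'(0)^⊥`, and proves that comparison with the Riccati equation.

*Reduction.* The tangential component of a Jacobi field is an affine function of time
(`IsJacobiField.inner_velocity`), and the hypotheses make those of `V` and `V₀` equal, so that only
the normal parts have to be compared. Parallel transport `P t` along a unit speed geodesic maps
`γ'(0)^⊥` isometrically onto `γ'(t)^⊥` (`IsNormalGeodesic.exists_isNormalTransport`), and the normal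
part of `V t` is `P t (v t)`, where `v` solves `v'' + R v = 0` with the symmetric operators
`R t = (P t)⁻¹ ∘ R(·, γ') γ' ∘ P t` (`transportedJacobiOperator`). Moreover
`K(γ', V) = ⟨R v, v⟩ / ‖v‖²`, and conversely solutions of `u'' + R u = 0` give normal Jacobi fields.

*Comparison.* Since there are no focal points, the matrix solution `U` of `U'' + R₀ U = 0`,
`U(0) = 1`, `U'(0) = B₀` is invertible on `[0, l]`, so that `A = U' U⁻¹` is a symmetric solution of
the Riccati equation `A' + A² + R₀ = 0` (`exists_isRiccatiSolution`), and `v₀' = A v₀`. For a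
*constant* unit vector `e` the function `α = ⟨A e, e⟩` satisfies `α' ≤ -α² - ⟨R₀ e, e⟩`, while
`β = ⟨v', v⟩ / ‖v‖²`, the logarithmic derivative of `‖v‖`, satisfies
`β' ≥ -β² - ⟨R v, v⟩ / ‖v‖²`; both are instances of the Cauchy–Schwarz inequality. The hypothesis on
the curvatures and that on the eigenvalues of `B` and `B₀` (compared through Rayleigh quotients)
then give `α ≤ β`. As `e` is arbitrary, `⟨A x, x⟩ ≤ β ‖x‖²` for all `x`, in particular for `x = v₀`,
so `‖v₀‖ / ‖v‖` is nonincreasing. In the case of equality all these inequalities are equalities,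
which forces `v = ‖v‖ ê` and `v₀ = ‖v‖ e` with constant `ê` and `e`
(`RiccatiComparison.norm_le`).

Mathlib has no Levi-Civita connection, so the facts about it that are needed (symmetries of the
curvature tensor, independence of the chart, compatibility of the covariant derivative along a curve
with the metric, existence of parallel fields) are proved here in coordinates. A change of chart is
a local isometry between the coordinate expressions of the metric, and everything reduces to the
naturality of the Christoffel symbols under local isometries
(`IsLocalIsometryOn.fderiv_christoffelForm`).
-/

namespace RauchComparison

/-! ### Linear differential equations -/

section LinearODE

variable {F : Type*} [NormedAddCommGroup F] [NormedSpace ℝ F]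

/-- Global existence for a linear differential equation with bounded coefficients, by Picard
iteration: the solution is `∑ n, x n`, where `x (n + 1) t = ∫ s in t₀..t, A s (x n s)`. -/
theorem exists_linearODE_of_continuous [CompleteSpace F] {A : ℝ → F →L[ℝ] F} (hA : Continuous A)
    {C : ℝ} (hC : ∀ t, ‖A t‖ ≤ C) (t₀ : ℝ) (x₀ : F) :
    ∃ x : ℝ → F, x t₀ = x₀ ∧ ∀ t, HasDerivAt x (A t (x t)) t := by
  have hC0 : 0 ≤ C := (norm_nonneg _).trans (hC 0)
  let x : ℕ → ℝ → F := fun n ↦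
    Nat.rec (fun _ ↦ x₀) (fun _ y t ↦ ∫ s in t₀..t, A s (y s)) n
  have hx0 : ∀ t, x 0 t = x₀ := fun _ ↦ rfl
  have hxs : ∀ n t, x (n + 1) t = ∫ s in t₀..t, A s (x n s) := fun _ _ ↦ rfl
  have hder : ∀ n, Continuous (x n) → ∀ t, HasDerivAt (x (n + 1)) (A t (x n t)) t := by
    intro n hn t
    have hc : Continuous fun s ↦ A s (x n s) := hA.clm_apply hn
    exact intervalIntegral.integral_hasDerivAt_right (hc.intervalIntegrable _ _)
      (hc.stronglyMeasurableAtFilter _ _) hc.continuousAt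
  have hcont : ∀ n, Continuous (x n) := by
    intro n
    induction n with
    | zero => exact continuous_const
    | succ n ih =>
      exact continuous_iff_continuousAt.2 fun t ↦ (hder n ih t).continuousAt
  -- the factorial makes the series and its termwise derivative converge on every bounded interval
  have hbound : ∀ n t, ‖x n t‖ ≤ ‖x₀‖ * C ^ n / n.factorial * |t - t₀| ^ n := by
    intro n
    induction n with
    | zero => intro t; simp [hx0]
    | succ n ih =>
      intro t
      rw [hxs]
      refine intervalIntegral.norm_integral_le_integral_norm_uIoc.trans ?_
      have h1 : ∀ s, ‖A s (x n s)‖ ≤ C * (‖x₀‖ * C ^ n / n.factorial) * |s - t₀| ^ n := by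
        intro s
        refine ((A s).le_opNorm _).trans ?_
        rw [mul_assoc]
        exact mul_le_mul (hC s) (ih s) (norm_nonneg _) hC0
      have hi : ∀ f : ℝ → ℝ, Continuous f →
          MeasureTheory.IntegrableOn f (uIoc t₀ t) := fun f hf ↦
        intervalIntegrable_iff.1 (hf.intervalIntegrable _ _)
      refine (MeasureTheory.setIntegral_mono (hi _ (hA.clm_apply (hcont n)).norm)
        (hi _ (by fun_prop)) h1).trans ?_
      rw [MeasureTheory.integral_const_mul, integral_pow_abs_sub_uIoc]
      refine le_of_eq ?_
      rw [Nat.factorial_succ]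
      push_cast
      field_simp
      ring
  have hsum : ∀ R : ℝ, Summable fun n : ℕ ↦ C * (‖x₀‖ * C ^ n / n.factorial * R ^ n) := by
    intro R
    refine (((Real.summable_pow_div_factorial (C * R)).mul_left (C * ‖x₀‖))).congr fun n ↦ ?_
    rw [mul_pow]; ring
  have hx_t₀ : ∀ n, x (n + 1) t₀ = 0 := fun n ↦ by rw [hxs]; simp
  have hxsum : ∀ t, Summable fun n ↦ x n t := by
    intro t
    refine Summable.of_norm_bounded
      (g := fun n ↦ ‖x₀‖ * C ^ n / n.factorial * |t - t₀| ^ n) ?_ (fun n ↦ hbound n t)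
    refine ((Real.summable_pow_div_factorial (C * |t - t₀|)).mul_left ‖x₀‖).congr fun n ↦ ?_
    rw [mul_pow]; ring
  refine ⟨fun t ↦ x₀ + ∑' n, x (n + 1) t, by simp [hx_t₀], fun t ↦ ?_⟩
  set R : ℝ := |t - t₀| + 1 with hR
  have key := hasDerivAt_tsum_of_isPreconnected (g := fun n ↦ x (n + 1))
    (g' := fun n y ↦ A y (x n y)) (t := Metric.ball t₀ R) (y₀ := t₀) (y := t) (hsum R)
    Metric.isOpen_ball (convex_ball t₀ R).isPreconnected
    (fun n y _ ↦ hder n (hcont n) y) ?_ (Metric.mem_ball_self (by positivity))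
    (by simp only [hx_t₀]; exact summable_zero)
    (by rw [Metric.mem_ball, Real.dist_eq, hR]; linarith)
  · refine (key.const_add x₀).congr_deriv ?_
    rw [← (A t).map_tsum (hxsum t), (hxsum t).tsum_eq_zero_add, hx0]
  · intro n y hy
    rw [Metric.mem_ball, Real.dist_eq] at hy
    refine ((A y).le_opNorm _).trans (mul_le_mul (hC y) ((hbound n y).trans ?_)
      (norm_nonneg _) hC0)
    gcongr

/-- Global existence for linear differential equations on a compact interval. -/
theorem exists_linearODE [CompleteSpace F] {a b : ℝ} {A : ℝ → F →L[ℝ] F}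
    (hA : ContinuousOn A (Icc a b)) {t₀ : ℝ} (ht₀ : t₀ ∈ Icc a b) (x₀ : F) :
    ∃ x : ℝ → F, x t₀ = x₀ ∧ ∀ t ∈ Icc a b, HasDerivWithinAt x (A t (x t)) (Icc a b) t := by
  have hab : a ≤ b := ht₀.1.trans ht₀.2
  obtain ⟨C, hC⟩ := isCompact_Icc.exists_bound_of_continuousOn hA
  have hA' : Continuous (IccExtend hab ((Icc a b).domRestrict A)) := hA.domRestrict.Icc_extend'
  obtain ⟨x, hx, hx'⟩ := exists_linearODE_of_continuous hA' (C := C)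
    (fun t ↦ hC _ (projIcc a b hab t).2) t₀ x₀
  refine ⟨x, hx, fun t ht ↦ ?_⟩
  have := hx' t
  rw [IccExtend_of_mem hab _ ht] at this
  exact this.hasDerivWithinAt

/-- The time `t₀` at which the two solutions agree may be any point of the interval. -/
theorem linearODE_unique {a b : ℝ} {A : ℝ → F →L[ℝ] F}
    (hA : ContinuousOn A (Icc a b)) {x y : ℝ → F}
    (hx : ∀ t ∈ Icc a b, HasDerivWithinAt x (A t (x t)) (Icc a b) t)
    (hy : ∀ t ∈ Icc a b, HasDerivWithinAt y (A t (y t)) (Icc a b) t)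
    {t₀ : ℝ} (ht₀ : t₀ ∈ Icc a b) (h : x t₀ = y t₀) : EqOn x y (Icc a b) := by
  obtain ⟨C, hC⟩ := isCompact_Icc.exists_bound_of_continuousOn hA
  have hv : ∀ t ∈ Icc a b, LipschitzOnWith C.toNNReal (A t) univ := fun t ht ↦ by
    refine (((A t).lipschitz).weaken ?_).lipschitzOnWith
    rw [← NNReal.coe_le_coe]
    exact (hC t ht).trans (Real.le_coe_toNNReal C)
  have hxc : ContinuousOn x (Icc a b) := fun t ht ↦ (hx t ht).continuousWithinAt
  have hyc : ContinuousOn y (Icc a b) := fun t ht ↦ (hy t ht).continuousWithinAt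
  have hl : Icc a t₀ ⊆ Icc a b := Icc_subset_Icc_right ht₀.2
  have hr : Icc t₀ b ⊆ Icc a b := Icc_subset_Icc_left ht₀.1
  have hL : ∀ {z : ℝ → F}, (∀ t ∈ Icc a b, HasDerivWithinAt z (A t (z t)) (Icc a b) t) →
      ∀ t ∈ Ioc a t₀, HasDerivWithinAt z (A t (z t)) (Iic t) t := fun hz t ht ↦ by
    refine (hz t (hl (Ioc_subset_Icc_self ht))).mono_of_mem_nhdsWithin ?_
    exact Filter.mem_of_superset (Icc_mem_nhdsLE ht.1)
      (Icc_subset_Icc_right (ht.2.trans ht₀.2))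
  have hR : ∀ {z : ℝ → F}, (∀ t ∈ Icc a b, HasDerivWithinAt z (A t (z t)) (Icc a b) t) →
      ∀ t ∈ Ico t₀ b, HasDerivWithinAt z (A t (z t)) (Ici t) t := fun hz t ht ↦ by
    refine (hz t (hr (Ico_subset_Icc_self ht))).mono_of_mem_nhdsWithin ?_
    exact Filter.mem_of_superset (Icc_mem_nhdsGE ht.2)
      (Icc_subset_Icc_left (ht₀.1.trans ht.1))
  rw [← Icc_union_Icc_eq_Icc ht₀.1 ht₀.2]
  apply EqOn.union
  · exact ODE_solution_unique_of_mem_Icc_left (s := fun _ ↦ univ)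
      (fun t ht ↦ hv t (hl (Ioc_subset_Icc_self ht))) (hxc.mono hl) (hL hx)
      (fun _ _ ↦ mem_univ _) (hyc.mono hl) (hL hy) (fun _ _ ↦ mem_univ _) h
  · exact ODE_solution_unique_of_mem_Icc_right (s := fun _ ↦ univ)
      (fun t ht ↦ hv t (hr (Ico_subset_Icc_self ht))) (hxc.mono hr) (hR hx)
      (fun _ _ ↦ mem_univ _) (hyc.mono hr) (hR hy) (fun _ _ ↦ mem_univ _) h

theorem contDiffOn_of_linearODE {s : Set ℝ} (hs : UniqueDiffOn ℝ s) {A : ℝ → F →L[ℝ] F}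
    (hA : ContDiffOn ℝ ∞ A s) {x : ℝ → F}
    (hx : ∀ t ∈ s, HasDerivWithinAt x (A t (x t)) s t) : ContDiffOn ℝ ∞ x s := by
  rw [contDiffOn_infty]
  intro n
  induction n with
  | zero =>
    rw [Nat.cast_zero, contDiffOn_zero]
    exact fun t ht ↦ (hx t ht).continuousWithinAt
  | succ n ih =>
    rw [Nat.cast_succ, contDiffOn_succ_iff_derivWithin hs]
    refine ⟨fun t ht ↦ (hx t ht).differentiableWithinAt, fun h ↦ by simp at h, ?_⟩
    exact (((contDiffOn_infty.1 hA n).clm_apply ih)).congr fun t ht ↦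
      (hx t ht).derivWithin (hs t ht)

/-- The second order equation `x'' + R x = 0` as the first order system
`(x, y)' = (y, -R x)`. -/
noncomputable def secondOrderSystem (R : F →L[ℝ] F) : (F × F) →L[ℝ] (F × F) :=
  (ContinuousLinearMap.inl ℝ F F).comp (ContinuousLinearMap.snd ℝ F F) +
    -((ContinuousLinearMap.inr ℝ F F).comp (R.comp (ContinuousLinearMap.fst ℝ F F)))

theorem secondOrderSystem_apply (R : F →L[ℝ] F) (z : F × F) :
    secondOrderSystem R z = (z.2, -R z.1) := by
  simp [secondOrderSystem]

theorem continuousOn_secondOrderSystem {s : Set ℝ} {R : ℝ → F →L[ℝ] F} (hR : ContinuousOn R s) :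
    ContinuousOn (fun t ↦ secondOrderSystem (R t)) s :=
  continuousOn_const.add
    (continuousOn_const.clm_comp (hR.clm_comp continuousOn_const)).neg

/-- Existence for the second order equation `x'' + R x = 0`. -/
theorem exists_secondOrderODE [CompleteSpace F] {a b : ℝ} (hab : a ≤ b) {R : ℝ → F →L[ℝ] F}
    (hR : ContinuousOn R (Icc a b)) (x₀ y₀ : F) :
    ∃ x y : ℝ → F, x a = x₀ ∧ y a = y₀ ∧
      (∀ t ∈ Icc a b, HasDerivWithinAt x (y t) (Icc a b) t) ∧
      (∀ t ∈ Icc a b, HasDerivWithinAt y (-R t (x t)) (Icc a b) t) := by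
  obtain ⟨z, hz, hz'⟩ := exists_linearODE (continuousOn_secondOrderSystem hR)
    (left_mem_Icc.2 hab) (x₀, y₀)
  simp only [secondOrderSystem_apply] at hz'
  exact ⟨fun t ↦ (z t).1, fun t ↦ (z t).2, by simp [hz], by simp [hz],
    fun t ht ↦ (hz' t ht).fst, fun t ht ↦ (hz' t ht).snd⟩

theorem eq_zero_of_secondOrderODE {a b : ℝ} {R : ℝ → F →L[ℝ] F} (hR : ContinuousOn R (Icc a b))
    {x y : ℝ → F} (hx : ∀ t ∈ Icc a b, HasDerivWithinAt x (y t) (Icc a b) t)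
    (hy : ∀ t ∈ Icc a b, HasDerivWithinAt y (-R t (x t)) (Icc a b) t)
    (hxa : x a = 0) (hya : y a = 0) : ∀ t ∈ Icc a b, x t = 0 := by
  intro t ht
  have h := linearODE_unique (continuousOn_secondOrderSystem hR) (x := fun t ↦ (x t, y t))
    (y := fun _ ↦ 0) (fun t ht ↦ by
      rw [secondOrderSystem_apply]
      exact (hx t ht).prodMk (hy t ht))
    (fun t _ ↦ by rw [map_zero]; exact hasDerivWithinAt_const t (Icc a b) 0)
    (left_mem_Icc.2 (ht.1.trans ht.2)) (by simp [hxa, hya]) ht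
  exact congrArg Prod.fst h

theorem contDiffOn_of_secondOrderODE {s : Set ℝ} (hs : UniqueDiffOn ℝ s) {R : ℝ → F →L[ℝ] F}
    (hR : ContDiffOn ℝ ∞ R s) {x y : ℝ → F} (hx : ∀ t ∈ s, HasDerivWithinAt x (y t) s t)
    (hy : ∀ t ∈ s, HasDerivWithinAt y (-R t (x t)) s t) : ContDiffOn ℝ ∞ x s := by
  have hA : ContDiffOn ℝ ∞ (fun t ↦ secondOrderSystem (R t)) s :=
    contDiffOn_const.add (contDiffOn_const.clm_comp (hR.clm_comp contDiffOn_const)).neg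
  exact (contDiffOn_of_linearODE hs hA (x := fun t ↦ (x t, y t)) fun t ht ↦ by
    rw [secondOrderSystem_apply]
    exact (hx t ht).prodMk (hy t ht)).fst

end LinearODE

/-! ### A differential inequality -/

section DifferentialInequality

/-- Strong form of Grönwall's inequality for `δ' = -m δ + r` with `r ≥ 0`: a solution that starts
out nonnegative stays so, and it cannot vanish at the right end point unless `δ` and `r` vanish
identically. -/
theorem nonneg_of_linear_differential_inequality {a b : ℝ} (hab : a ≤ b) {δ m r : ℝ → ℝ}
    (hm : ContinuousOn m (Icc a b))
    (hδ : ∀ t ∈ Icc a b, HasDerivWithinAt δ (-m t * δ t + r t) (Icc a b) t)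
    (hr : ∀ t ∈ Icc a b, 0 ≤ r t) (ha : 0 ≤ δ a) :
    (∀ t ∈ Icc a b, 0 ≤ δ t) ∧
      (δ b = 0 → (∀ t ∈ Icc a b, δ t = 0) ∧ (a < b → ∀ t ∈ Icc a b, r t = 0)) := by
  let m' : ℝ → ℝ := IccExtend hab ((Icc a b).domRestrict m)
  have hm' : Continuous m' := hm.domRestrict.Icc_extend'
  -- `exp P` is an integrating factor: `(exp P • δ)' = exp P • r ≥ 0`
  let P : ℝ → ℝ := fun t ↦ ∫ s in a..t, m' s
  have hP : ∀ t, HasDerivAt P (m' t) t := fun t ↦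
    intervalIntegral.integral_hasDerivAt_right (hm'.intervalIntegrable _ _)
      (hm'.stronglyMeasurableAtFilter _ _) hm'.continuousAt
  let φ : ℝ → ℝ := fun t ↦ Real.exp (P t) * δ t
  have hφ : ∀ t ∈ Icc a b, HasDerivWithinAt φ (Real.exp (P t) * r t) (Icc a b) t := by
    intro t ht
    have h := ((hP t).exp.hasDerivWithinAt (s := Icc a b)).mul (hδ t ht)
    refine h.congr_deriv ?_
    have : m' t = m t := IccExtend_of_mem hab _ ht
    rw [this]; ring
  have hmono : MonotoneOn φ (Icc a b) := by
    refine monotoneOn_of_hasDerivWithinAt_nonneg (f' := fun t ↦ Real.exp (P t) * r t)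
      (convex_Icc a b)
      (fun t ht ↦ (hφ t ht).continuousWithinAt)
      (fun t ht ↦ (hφ t (interior_subset ht)).mono interior_subset) fun t ht ↦ ?_
    exact mul_nonneg (Real.exp_pos _).le (hr t (interior_subset ht))
  have hφa : 0 ≤ φ a := mul_nonneg (Real.exp_pos _).le ha
  have hpos : ∀ t ∈ Icc a b, 0 ≤ δ t := fun t ht ↦ by
    have : 0 ≤ φ t := hφa.trans (hmono (left_mem_Icc.2 hab) ht ht.1)
    exact nonneg_of_mul_nonneg_right this (Real.exp_pos _)
  refine ⟨hpos, fun hb ↦ ?_⟩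
  have hzero : ∀ t ∈ Icc a b, δ t = 0 := fun t ht ↦ by
    have h1 : φ t ≤ φ b := hmono ht (right_mem_Icc.2 hab) ht.2
    have h2 : φ b = 0 := by simp [φ, hb]
    have h3 : 0 ≤ φ t := mul_nonneg (Real.exp_pos _).le (hpos t ht)
    have h4 : φ t = 0 := le_antisymm (h2 ▸ h1) h3
    exact (mul_eq_zero.1 h4).resolve_left (Real.exp_pos _).ne'
  refine ⟨hzero, fun hlt t ht ↦ ?_⟩
  have h1 := hδ t ht
  rw [hzero t ht] at h1
  have h2 : HasDerivWithinAt δ 0 (Icc a b) t :=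
    (hasDerivWithinAt_const t (Icc a b) (0 : ℝ)).congr hzero (hzero t ht)
  have := (uniqueDiffOn_Icc hlt t ht).eq_deriv _ h1 h2
  simpa using this

end DifferentialInequality

/-! ### The Riccati equation -/

section Riccati

theorem hasDerivWithinAt_ringInverse {𝔸 : Type*} [NormedRing 𝔸] [NormedAlgebra ℝ 𝔸]
    [CompleteSpace 𝔸] {U : ℝ → 𝔸} {U' : 𝔸} {s : Set ℝ} {t : ℝ}
    (hU : HasDerivWithinAt U U' s t) (u : 𝔸ˣ) (hu : ↑u = U t) :
    HasDerivWithinAt (fun t ↦ Ring.inverse (U t)) (-(↑u⁻¹ * U' * ↑u⁻¹)) s t := by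
  have h := hasFDerivAt_ringInverse (𝕜 := ℝ) u
  rw [hu] at h
  exact h.comp_hasDerivWithinAt t hU

variable {N : Type*} [NormedAddCommGroup N] [InnerProductSpace ℝ N]

/-- `A` is a symmetric solution of the Riccati equation `A' + A² + R = 0` on `[0, l]`. -/
structure IsRiccatiSolution (l : ℝ) (R A : ℝ → N →L[ℝ] N) : Prop where
  deriv : ∀ t ∈ Icc 0 l, HasDerivWithinAt A (-(A t * A t) - R t) (Icc 0 l) t
  symm : ∀ t ∈ Icc 0 l, ∀ x y, ⟪A t x, y⟫_ℝ = ⟪x, A t y⟫_ℝ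

theorem IsRiccatiSolution.continuousOn {l : ℝ} {R A : ℝ → N →L[ℝ] N}
    (h : IsRiccatiSolution l R A) : ContinuousOn A (Icc 0 l) :=
  fun t ht ↦ (h.deriv t ht).continuousWithinAt

/-- If no nontrivial solution of `u'' + R u = 0`, `u'(0) = B (u(0))` vanishes on `(0, l]`, then the
Riccati equation has a solution on the whole of `[0, l]` with initial value `B`, namely
`A = U' U⁻¹` where `U'' + R U = 0`, `U(0) = 1`, `U'(0) = B`. -/
theorem exists_isRiccatiSolution [FiniteDimensional ℝ N] {l : ℝ} (hl : 0 < l)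
    {R : ℝ → N →L[ℝ] N} (hR : ContinuousOn R (Icc 0 l))
    (hRs : ∀ t ∈ Icc 0 l, ∀ x y, ⟪R t x, y⟫_ℝ = ⟪x, R t y⟫_ℝ)
    (B : N →L[ℝ] N) (hB : ∀ x y, ⟪B x, y⟫_ℝ = ⟪x, B y⟫_ℝ)
    (hfoc : ∀ u u' : ℝ → N, (∀ t ∈ Icc 0 l, HasDerivWithinAt u (u' t) (Icc 0 l) t) →
      (∀ t ∈ Icc 0 l, HasDerivWithinAt u' (-R t (u t)) (Icc 0 l) t) →
      u 0 ≠ 0 → u' 0 = B (u 0) → ∀ t ∈ Ioc 0 l, u t ≠ 0) :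
    ∃ A, IsRiccatiSolution l R A ∧ A 0 = B := by
  let R' : ℝ → (N →L[ℝ] N) →L[ℝ] (N →L[ℝ] N) := fun t ↦
    ContinuousLinearMap.compL ℝ N N N (R t)
  have hR' : ContinuousOn R' (Icc 0 l) :=
    (ContinuousLinearMap.compL ℝ N N N).continuous.comp_continuousOn hR
  obtain ⟨U, W, hU0, hW0, hU, hW⟩ := exists_secondOrderODE hl.le hR' 1 B
  have hW' : ∀ t ∈ Icc 0 l, HasDerivWithinAt W (-(R t * U t)) (Icc 0 l) t := hW
  have hUx : ∀ x, ∀ t ∈ Icc 0 l, HasDerivWithinAt (fun t ↦ U t x) (W t x) (Icc 0 l) t :=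
    fun x t ht ↦ by simpa using (hU t ht).clm_apply (hasDerivWithinAt_const t _ x)
  have hWx : ∀ x, ∀ t ∈ Icc 0 l,
      HasDerivWithinAt (fun t ↦ W t x) (-R t (U t x)) (Icc 0 l) t :=
    fun x t ht ↦ by simpa using (hW' t ht).clm_apply (hasDerivWithinAt_const t _ x)
  have hunit : ∀ t ∈ Icc 0 l, IsUnit (U t) := by
    intro t ht
    rcases ht.1.eq_or_lt with rfl | ht0
    · rw [hU0]; exact isUnit_one
    · have hinj : Function.Injective (U t).toLinearMap := by
        rw [injective_iff_map_eq_zero]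
        intro x hx
        by_contra hne
        exact hfoc (fun t ↦ U t x) (fun t ↦ W t x) (hUx x) (hWx x) (by simpa [hU0] using hne)
          (by simp [hU0, hW0]) t ⟨ht0, ht.2⟩ hx
      rw [ContinuousLinearMap.isUnit_iff_isUnit_toLinearMap, LinearMap.isUnit_iff_ker_eq_bot]
      exact LinearMap.ker_eq_bot.2 hinj
  -- conservation of the Wronskian
  have hwr : ∀ x y, ∀ t ∈ Icc 0 l, ⟪W t x, U t y⟫_ℝ = ⟪U t x, W t y⟫_ℝ := by
    intro x y t ht
    have hd : ∀ t ∈ Icc 0 l, HasDerivWithinAt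
        (fun t ↦ ⟪W t x, U t y⟫_ℝ - ⟪U t x, W t y⟫_ℝ) 0 (Icc 0 l) t := by
      intro t ht
      refine (((hWx x t ht).inner ℝ (hUx y t ht)).sub
        ((hUx x t ht).inner ℝ (hWx y t ht))).congr_deriv ?_
      simp only [inner_neg_left, inner_neg_right, hRs t ht]
      ring
    have := constant_of_derivWithin_zero (fun t ht ↦ (hd t ht).differentiableWithinAt)
      (fun t ht ↦ (hd t (Ico_subset_Icc_self ht)).derivWithin
        (uniqueDiffOn_Icc hl t (Ico_subset_Icc_self ht))) t ht
    simp only [hU0, hW0, one_apply_eq_self, hB, sub_self] at this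
    linarith
  refine ⟨fun t ↦ W t * Ring.inverse (U t), ⟨fun t ht ↦ ?_, fun t ht x y ↦ ?_⟩, by simp [hU0, hW0]⟩
  · obtain ⟨u, hu⟩ := hunit t ht
    have h1 : HasDerivWithinAt (fun t ↦ Ring.inverse (U t)) (-(↑u⁻¹ * W t * ↑u⁻¹)) (Icc 0 l) t :=
      hasDerivWithinAt_ringInverse (hU t ht) u hu
    refine ((hW' t ht).mul h1).congr_deriv ?_
    rw [← hu, Ring.inverse_unit]
    simp only [neg_mul, mul_neg, mul_assoc, Units.mul_inv, mul_one]
    abel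
  · obtain ⟨u, hu⟩ := hunit t ht
    have hi : ∀ z, U t (Ring.inverse (U t) z) = z := fun z ↦ by
      rw [← hu, Ring.inverse_unit, ← mul_apply_eq_comp, Units.mul_inv,
        one_apply_eq_self]
    have := hwr (Ring.inverse (U t) x) (Ring.inverse (U t) y) t ht
    rw [hi, hi] at this
    exact this

/-- A solution of `v'' + R v = 0` whose initial values satisfy `v'(0) = A(0) v(0)` is a solution of
`v' = A v`, if `A` solves the Riccati equation: the difference `z = v' - A v` solves `z' = -A z`. -/
theorem IsRiccatiSolution.eq_apply {l : ℝ} {R A : ℝ → N →L[ℝ] N}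
    (hA : IsRiccatiSolution l R A) {v v' : ℝ → N}
    (hv : ∀ t ∈ Icc 0 l, HasDerivWithinAt v (v' t) (Icc 0 l) t)
    (hv' : ∀ t ∈ Icc 0 l, HasDerivWithinAt v' (-R t (v t)) (Icc 0 l) t)
    (h0 : v' 0 = A 0 (v 0)) : ∀ t ∈ Icc 0 l, v' t = A t (v t) := by
  intro t ht
  have hz : ∀ t ∈ Icc 0 l, HasDerivWithinAt (fun t ↦ v' t - A t (v t))
      ((-A t) (v' t - A t (v t))) (Icc 0 l) t := by
    intro t ht
    refine ((hv' t ht).sub ((hA.deriv t ht).clm_apply (hv t ht))).congr_deriv ?_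
    simp only [map_sub, neg_apply, sub_apply,
      mul_apply_eq_comp]
    abel
  have := linearODE_unique (A := fun t ↦ -A t) hA.continuousOn.neg hz
    (y := fun _ ↦ 0) (fun t ht ↦ by simpa using hasDerivWithinAt_const t (Icc 0 l) (0 : N))
    (left_mem_Icc.2 (ht.1.trans ht.2)) (by simp [h0]) ht
  exact sub_eq_zero.1 this

end Riccati

/-! ### Comparison of solutions of second order systems -/

section Comparison

variable {N : Type*} [NormedAddCommGroup N] [InnerProductSpace ℝ N]
  {N₀ : Type*} [NormedAddCommGroup N₀] [InnerProductSpace ℝ N₀]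

theorem inner_sq_le_of_norm_one {e x : N} (he : ‖e‖ = 1) : ⟪x, e⟫_ℝ ^ 2 ≤ ‖x‖ ^ 2 := by
  have := abs_real_inner_le_norm x e
  rw [he, mul_one] at this
  exact sq_le_sq' (abs_le.1 this).1 (abs_le.1 this).2

theorem eq_smul_of_inner_sq_eq {e x : N} (he : ‖e‖ = 1) (h : ‖x‖ ^ 2 = ⟪x, e⟫_ℝ ^ 2) :
    x = ⟪x, e⟫_ℝ • e := by
  have : ‖x - ⟪x, e⟫_ℝ • e‖ ^ 2 = 0 := by
    rw [norm_sub_sq_real, real_inner_smul_right, norm_smul, he, mul_one, Real.norm_eq_abs, sq_abs,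
      h]
    ring
  exact sub_eq_zero.1 (norm_eq_zero.1 (pow_eq_zero_iff two_ne_zero |>.1 this))

/-- The hypotheses of the comparison: on `[0, l]`, a solution `v` of `v'' + R v = 0` and a symmetric
solution `A` of `A' + A² + R₀ = 0`, such that the curvature of `v` is at most that of any vector
`e` on the other side, and the logarithmic derivative of `‖v‖` at `0` is at least `⟨A(0) e, e⟩`. -/
structure RiccatiComparison (l : ℝ) (R : ℝ → N →L[ℝ] N) (v v' : ℝ → N)
    (R₀ A : ℝ → N₀ →L[ℝ] N₀) : Prop where
  riccati : IsRiccatiSolution l R₀ A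
  deriv : ∀ t ∈ Icc 0 l, HasDerivWithinAt v (v' t) (Icc 0 l) t
  deriv' : ∀ t ∈ Icc 0 l, HasDerivWithinAt v' (-R t (v t)) (Icc 0 l) t
  curv_le : ∀ t ∈ Icc 0 l, ∀ e : N₀, ‖e‖ = 1 → ⟪R t (v t), v t⟫_ℝ ≤ ⟪R₀ t e, e⟫_ℝ * ‖v t‖ ^ 2
  init_le : ∀ e : N₀, ‖e‖ = 1 → ⟪A 0 e, e⟫_ℝ * ‖v 0‖ ^ 2 ≤ ⟪v' 0, v 0⟫_ℝ
  init_ne : v 0 ≠ 0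

namespace RiccatiComparison

variable {l : ℝ} {R : ℝ → N →L[ℝ] N} {v v' : ℝ → N} {R₀ A : ℝ → N₀ →L[ℝ] N₀}

/-- As long as `v` has no zero, the logarithmic derivative `β = ⟨v', v⟩ / ‖v‖²` of `‖v‖` dominates
`α = ⟨A e, e⟩` for every fixed unit vector `e`: `β - α` satisfies a linear differential
inequality, since `α' = -‖A e‖² - ⟨R₀ e, e⟩ ≤ -α² - ⟨R₀ e, e⟩` and
`β' = ‖v'‖² / ‖v‖² - 2 β² - ⟨R v, v⟩ / ‖v‖² ≥ -β² - ⟨R v, v⟩ / ‖v‖²`. In the case of equality all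
these inequalities are equalities. -/
theorem inner_le_of_ne_zero (h : RiccatiComparison l R v v' R₀ A) {t₁ : ℝ} (ht₁ : t₁ ∈ Icc 0 l)
    (hne : ∀ t ∈ Icc 0 t₁, v t ≠ 0) {e : N₀} (he : ‖e‖ = 1) :
    ⟪A t₁ e, e⟫_ℝ * ‖v t₁‖ ^ 2 ≤ ⟪v' t₁, v t₁⟫_ℝ ∧
    (0 < t₁ → ⟪A t₁ e, e⟫_ℝ * ‖v t₁‖ ^ 2 = ⟪v' t₁, v t₁⟫_ℝ → ∀ t ∈ Icc 0 t₁,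
      A t e = (⟪v' t, v t⟫_ℝ / ‖v t‖ ^ 2) • e ∧ v' t = (⟪v' t, v t⟫_ℝ / ‖v t‖ ^ 2) • v t ∧
      ⟪R t (v t), v t⟫_ℝ = ⟪R₀ t e, e⟫_ℝ * ‖v t‖ ^ 2) := by
  have hsub : Icc 0 t₁ ⊆ Icc 0 l := Icc_subset_Icc_right ht₁.2
  have hfpos : ∀ t ∈ Icc 0 t₁, 0 < ‖v t‖ ^ 2 := fun t ht ↦ by
    have := norm_pos_iff.2 (hne t ht); positivity
  let α : ℝ → ℝ := fun t ↦ ⟪A t e, e⟫_ℝ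
  let β : ℝ → ℝ := fun t ↦ ⟪v' t, v t⟫_ℝ / ‖v t‖ ^ 2
  let r : ℝ → ℝ := fun t ↦ (‖v' t‖ ^ 2 / ‖v t‖ ^ 2 - β t ^ 2) + (‖A t e‖ ^ 2 - α t ^ 2)
    + (⟪R₀ t e, e⟫_ℝ - ⟪R t (v t), v t⟫_ℝ / ‖v t‖ ^ 2)
  have hα : ∀ t ∈ Icc 0 t₁, HasDerivWithinAt α (-‖A t e‖ ^ 2 - ⟪R₀ t e, e⟫_ℝ) (Icc 0 t₁) t := by
    intro t ht
    have h1 := (((h.riccati.deriv t (hsub ht)).mono hsub).clm_apply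
      (hasDerivWithinAt_const t _ e)).inner ℝ (hasDerivWithinAt_const t _ e)
    refine h1.congr_deriv ?_
    simp only [inner_zero_right, map_zero, add_zero, zero_add, sub_apply,
      neg_apply, mul_apply_eq_comp, inner_sub_left,
      inner_neg_left, h.riccati.symm t (hsub ht) (A t e), real_inner_self_eq_norm_sq]
  have hβ : ∀ t ∈ Icc 0 t₁, HasDerivWithinAt β
      (‖v' t‖ ^ 2 / ‖v t‖ ^ 2 - 2 * β t ^ 2 - ⟪R t (v t), v t⟫_ℝ / ‖v t‖ ^ 2) (Icc 0 t₁) t := by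
    intro t ht
    have h1 := ((h.deriv' t (hsub ht)).mono hsub).inner ℝ ((h.deriv t (hsub ht)).mono hsub)
    have h2 := ((h.deriv t (hsub ht)).mono hsub).norm_sq
    have hf := (hfpos t ht).ne'
    refine (h1.div h2 hf).congr_deriv ?_
    simp only [β, real_inner_self_eq_norm_sq, inner_neg_left, real_inner_comm (v' t) (v t)]
    field_simp
    ring
  have hCS : ∀ t ∈ Icc 0 t₁, β t ^ 2 ≤ ‖v' t‖ ^ 2 / ‖v t‖ ^ 2 := by
    intro t ht
    have := abs_real_inner_le_norm (v' t) (v t)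
    have h2 : ⟪v' t, v t⟫_ℝ ^ 2 ≤ ‖v' t‖ ^ 2 * ‖v t‖ ^ 2 := by
      rw [← mul_pow]; exact sq_le_sq' (abs_le.1 this).1 (abs_le.1 this).2
    have hf := hfpos t ht
    simp only [β]
    rw [div_pow, div_le_div_iff₀ (by positivity) hf]
    nlinarith
  have hr3 : ∀ t ∈ Icc 0 t₁, ⟪R t (v t), v t⟫_ℝ / ‖v t‖ ^ 2 ≤ ⟪R₀ t e, e⟫_ℝ := fun t ht ↦ by
    rw [div_le_iff₀ (hfpos t ht)]
    exact h.curv_le t (hsub ht) e he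
  have hαsq : ∀ t, α t ^ 2 ≤ ‖A t e‖ ^ 2 := fun t ↦ inner_sq_le_of_norm_one he
  have hαc : ContinuousOn α (Icc 0 t₁) := fun t ht ↦ (hα t ht).continuousWithinAt
  have hβc : ContinuousOn β (Icc 0 t₁) := fun t ht ↦ (hβ t ht).continuousWithinAt
  have h0mem : (0 : ℝ) ∈ Icc 0 t₁ := left_mem_Icc.2 ht₁.1
  have h1mem : t₁ ∈ Icc 0 t₁ := right_mem_Icc.2 ht₁.1
  obtain ⟨hnn, heq⟩ := nonneg_of_linear_differential_inequality ht₁.1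
    (δ := fun t ↦ β t - α t) (m := fun t ↦ α t + β t) (r := r) (hαc.add hβc)
    (fun t ht ↦ ((hβ t ht).sub (hα t ht)).congr_deriv (by simp only [r]; ring))
    (fun t ht ↦ by
      have h1 := hCS t ht
      have h2 := hαsq t
      have h3 := hr3 t ht
      simp only [r]; linarith)
    (by
      rw [sub_nonneg]
      simp only [α, β]
      rw [le_div_iff₀ (hfpos 0 h0mem)]
      exact h.init_le e he)
  refine ⟨?_, fun htpos hE t ht ↦ ?_⟩
  · have := sub_nonneg.1 (hnn t₁ h1mem)
    simp only [α, β] at this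
    rwa [le_div_iff₀ (hfpos t₁ h1mem)] at this
  · have hE' : β t₁ - α t₁ = 0 := by
      simp only [α, β]
      rw [sub_eq_zero, div_eq_iff (hfpos t₁ h1mem).ne']
      exact hE.symm
    obtain ⟨hz, hrz⟩ := heq hE'
    have h1 := hCS t ht
    have h2 := hαsq t
    have h3 := hr3 t ht
    have h4 := hrz htpos t ht
    have h5 : α t = β t := by linarith [hz t ht]
    simp only [r] at h4
    have hf : ‖v t‖ ≠ 0 := norm_ne_zero_iff.2 (hne t ht)
    refine ⟨?_, ?_, ?_⟩
    · have : A t e = α t • e := eq_smul_of_inner_sq_eq he (by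
        have : ‖A t e‖ ^ 2 = α t ^ 2 := by linarith
        exact this)
      rw [this, h5]
    · have h6 : β t ^ 2 = ‖v' t‖ ^ 2 / ‖v t‖ ^ 2 := by linarith
      have h7 : ‖v' t - β t • v t‖ ^ 2 = 0 := by
        rw [norm_sub_sq_real, real_inner_smul_right, norm_smul, mul_pow, Real.norm_eq_abs, sq_abs]
        have h8 : ⟪v' t, v t⟫_ℝ = β t * ‖v t‖ ^ 2 := by simp only [β]; field_simp
        have h9 : ‖v' t‖ ^ 2 = β t ^ 2 * ‖v t‖ ^ 2 := by rw [h6]; field_simp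
        rw [h8, h9]; ring
      exact sub_eq_zero.1 (norm_eq_zero.1 (pow_eq_zero_iff two_ne_zero |>.1 h7))
    · have : ⟪R t (v t), v t⟫_ℝ / ‖v t‖ ^ 2 = ⟪R₀ t e, e⟫_ℝ := by linarith
      rw [← this]; field_simp

/-- `v` has no zero: up to its first zero `t₁` the logarithmic derivative of `‖v‖` is bounded below
by `⟨A e, e⟩`, hence by a constant, so that `‖v‖` cannot reach `0` at `t₁`. -/
theorem ne_zero [Nontrivial N₀] (h : RiccatiComparison l R v v' R₀ A) :
    ∀ t ∈ Icc 0 l, v t ≠ 0 := by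
  by_contra! hcon
  obtain ⟨τ, hτ, hvτ⟩ := hcon
  have hvc : ContinuousOn v (Icc 0 l) := fun t ht ↦ (h.deriv t ht).continuousWithinAt
  have hcl : IsCompact (Icc 0 l ∩ v ⁻¹' {0}) :=
    isCompact_Icc.of_isClosed_subset
      (hvc.preimage_isClosed_of_isClosed isClosed_Icc isClosed_singleton) inter_subset_left
  -- `t₁` is the first zero
  obtain ⟨t₁, ⟨ht₁, hv₁⟩, hmin⟩ := hcl.exists_isLeast ⟨τ, hτ, hvτ⟩
  obtain ⟨e, he⟩ := exists_norm_eq N₀ zero_le_one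
  obtain ⟨C, hC⟩ := isCompact_Icc.exists_bound_of_continuousOn h.riccati.continuousOn
  have hsub : Icc 0 t₁ ⊆ Icc 0 l := Icc_subset_Icc_right ht₁.2
  have hlow : ∀ t ∈ Icc 0 t₁, 0 ≤ 2 * ⟪v' t, v t⟫_ℝ + 2 * C * ‖v t‖ ^ 2 := by
    intro t ht
    rcases ht.2.eq_or_lt with rfl | hlt
    · have : v t = 0 := hv₁
      simp [this]
    · have h1 := (h.inner_le_of_ne_zero (hsub ht) (fun s hs hs0 ↦
        absurd (hmin ⟨hsub ⟨hs.1, hs.2.trans ht.2⟩, hs0⟩)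
          (not_le.2 (hs.2.trans_lt hlt))) he).1
      have h2 : |⟪A t e, e⟫_ℝ| ≤ C := by
        refine (abs_real_inner_le_norm _ _).trans ?_
        rw [he, mul_one]
        refine ((A t).le_opNorm e).trans ?_
        rw [he, mul_one]; exact hC t (hsub ht)
      nlinarith [(abs_le.1 h2).1, sq_nonneg ‖v t‖]
  obtain ⟨-, heq⟩ := nonneg_of_linear_differential_inequality ht₁.1
    (δ := fun t ↦ ‖v t‖ ^ 2) (m := fun _ ↦ 2 * C)
    (r := fun t ↦ 2 * ⟪v' t, v t⟫_ℝ + 2 * C * ‖v t‖ ^ 2) continuousOn_const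
    (fun t ht ↦ (((h.deriv t (hsub ht)).mono hsub).norm_sq).congr_deriv (by
      rw [real_inner_comm]; ring)) hlow (by positivity)
  have hz := (heq (by
    have : v t₁ = 0 := hv₁
    simp [this])).1 0 (left_mem_Icc.2 ht₁.1)
  exact h.init_ne (by simpa using hz)

/-- Rauch comparison for the linear equations: a nonzero solution `v₀` of `v₀' = A v₀` with
`‖v₀(0)‖ ≤ ‖v(0)‖` satisfies `‖v₀‖ ≤ ‖v‖` throughout, because `‖v‖² / ‖v₀‖²` is nondecreasing.
If equality holds at `t₀ > 0`, then up to time `t₀` both solutions are `‖v‖` times a constant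
vector. -/
theorem norm_le (h : RiccatiComparison l R v v' R₀ A) {v₀ : ℝ → N₀}
    (hv₀ : ∀ t ∈ Icc 0 l, HasDerivWithinAt v₀ (A t (v₀ t)) (Icc 0 l) t)
    (hv₀0 : v₀ 0 ≠ 0) (hle : ‖v₀ 0‖ ≤ ‖v 0‖) :
    (∀ t ∈ Icc 0 l, ‖v₀ t‖ ≤ ‖v t‖) ∧
    ∀ t₀ ∈ Ioc 0 l, ‖v t₀‖ = ‖v₀ t₀‖ → ∃ (ê : N) (e : N₀), ‖e‖ = 1 ∧
      ∀ t ∈ Icc 0 t₀, v t = ‖v t‖ • ê ∧ v₀ t = ‖v t‖ • e ∧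
        ⟪R t (v t), v t⟫_ℝ = ⟪R₀ t (v₀ t), v₀ t⟫_ℝ := by
  have : Nontrivial N₀ := ⟨v₀ 0, 0, hv₀0⟩
  have hne := h.ne_zero
  have hAc := h.riccati.continuousOn
  have hv₀ne : ∀ t ∈ Icc 0 l, v₀ t ≠ 0 := by
    intro t ht h0
    have := linearODE_unique hAc hv₀ (y := fun _ ↦ 0)
      (fun t _ ↦ by simpa using hasDerivWithinAt_const t (Icc 0 l) (0 : N₀)) ht h0
      (left_mem_Icc.2 (ht.1.trans ht.2))
    exact hv₀0 this
  have hinner : ∀ t ∈ Icc 0 l, 0 ≤ ⟪v' t, v t⟫_ℝ * ‖v₀ t‖ ^ 2 - ⟪A t (v₀ t), v₀ t⟫_ℝ * ‖v t‖ ^ 2 ∧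
      (0 < t → ⟪v' t, v t⟫_ℝ * ‖v₀ t‖ ^ 2 = ⟪A t (v₀ t), v₀ t⟫_ℝ * ‖v t‖ ^ 2 →
        ⟪A t (‖v₀ t‖⁻¹ • v₀ t), ‖v₀ t‖⁻¹ • v₀ t⟫_ℝ * ‖v t‖ ^ 2 = ⟪v' t, v t⟫_ℝ) := by
    intro t ht
    have hp : 0 < ‖v₀ t‖ := norm_pos_iff.2 (hv₀ne t ht)
    have hn : ‖‖v₀ t‖⁻¹ • v₀ t‖ = 1 := by
      rw [norm_smul, norm_inv, norm_norm, inv_mul_cancel₀ hp.ne']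
    have h1 := (h.inner_le_of_ne_zero ht
      (fun s hs ↦ hne s ⟨hs.1, hs.2.trans ht.2⟩) hn).1
    rw [map_smul, real_inner_smul_left, real_inner_smul_right] at h1 ⊢
    constructor
    · have h2 := mul_le_mul_of_nonneg_right h1 (sq_nonneg ‖v₀ t‖)
      have h3 : ‖v₀ t‖⁻¹ * (‖v₀ t‖⁻¹ * ⟪A t (v₀ t), v₀ t⟫_ℝ) * ‖v t‖ ^ 2 * ‖v₀ t‖ ^ 2
        = ⟪A t (v₀ t), v₀ t⟫_ℝ * ‖v t‖ ^ 2 := by field_simp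
      linarith
    · intro _ hE
      field_simp
      linarith
  have hquot : ∀ t ∈ Icc 0 l, HasDerivWithinAt (fun t ↦ ‖v t‖ ^ 2 / ‖v₀ t‖ ^ 2 - 1)
      (2 * (⟪v' t, v t⟫_ℝ * ‖v₀ t‖ ^ 2 - ⟪A t (v₀ t), v₀ t⟫_ℝ * ‖v t‖ ^ 2) / (‖v₀ t‖ ^ 2) ^ 2)
      (Icc 0 l) t := by
    intro t ht
    have hp : 0 < ‖v₀ t‖ := norm_pos_iff.2 (hv₀ne t ht)
    refine (((h.deriv t ht).norm_sq.div (hv₀ t ht).norm_sq (by positivity)).sub_const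
      1).congr_deriv ?_
    rw [real_inner_comm (v' t), real_inner_comm (A t (v₀ t))]
    ring
  have key : ∀ t₁ ∈ Icc 0 l, _ := fun t₁ (ht₁ : t₁ ∈ Icc 0 l) ↦
    nonneg_of_linear_differential_inequality ht₁.1 (m := fun _ ↦ 0) continuousOn_const
      (fun t ht ↦ ((hquot t (Icc_subset_Icc_right ht₁.2 ht)).mono
        (Icc_subset_Icc_right ht₁.2)).congr_deriv (by rw [neg_zero, zero_mul, zero_add]))
      (fun t ht ↦ div_nonneg (mul_nonneg zero_le_two
        (hinner t (Icc_subset_Icc_right ht₁.2 ht)).1) (by positivity))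
      (by
        have hp : 0 < ‖v₀ 0‖ := norm_pos_iff.2 hv₀0
        rw [sub_nonneg, le_div_iff₀ (by positivity), one_mul]
        gcongr)
  refine ⟨fun t ht ↦ ?_, fun t₀ ht₀ hE ↦ ?_⟩
  · have h1 := (key t ht).1 t (right_mem_Icc.2 ht.1)
    have hp : 0 < ‖v₀ t‖ := norm_pos_iff.2 (hv₀ne t ht)
    rw [sub_nonneg, le_div_iff₀ (by positivity), one_mul] at h1
    exact (sq_le_sq₀ hp.le (norm_nonneg _)).1 h1
  · have ht₀' : t₀ ∈ Icc 0 l := Ioc_subset_Icc_self ht₀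
    have hsub : Icc 0 t₀ ⊆ Icc 0 l := Icc_subset_Icc_right ht₀.2
    have hmem : t₀ ∈ Icc 0 t₀ := right_mem_Icc.2 ht₀.1.le
    have hp : 0 < ‖v₀ t₀‖ := norm_pos_iff.2 (hv₀ne t₀ ht₀')
    have h1 := ((key t₀ ht₀').2 (by rw [hE, div_self (by positivity), sub_self])).2 ht₀.1 t₀ hmem
    have h2 : ⟪v' t₀, v t₀⟫_ℝ * ‖v₀ t₀‖ ^ 2 = ⟪A t₀ (v₀ t₀), v₀ t₀⟫_ℝ * ‖v t₀‖ ^ 2 := by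
      rw [div_eq_zero_iff] at h1
      rcases h1 with h1 | h1
      · linarith
      · exact absurd h1 (by positivity)
    set e : N₀ := ‖v₀ t₀‖⁻¹ • v₀ t₀ with hedef
    have he : ‖e‖ = 1 := by
      rw [hedef, norm_smul, norm_inv, norm_norm, inv_mul_cancel₀ hp.ne']
    have hrig := (h.inner_le_of_ne_zero ht₀' (fun s hs ↦ hne s (hsub hs)) he).2 ht₀.1
      ((hinner t₀ ht₀').2 ht₀.1 h2)
    clear_value e
    have hnormd : ∀ t ∈ Icc 0 t₀, HasDerivWithinAt (fun t ↦ ‖v t‖)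
        (⟪v' t, v t⟫_ℝ / ‖v t‖ ^ 2 * ‖v t‖) (Icc 0 t₀) t := by
      intro t ht
      have hvp : 0 < ‖v t‖ := norm_pos_iff.2 (hne t (hsub ht))
      have h3 := (((h.deriv t (hsub ht)).mono hsub).norm_sq).sqrt (by positivity)
      simp only [Real.sqrt_sq (norm_nonneg _)] at h3
      refine h3.congr_deriv ?_
      rw [real_inner_comm (v' t)]
      field_simp
    -- both `v₀` and `‖v‖ e` solve the equation `u' = A u`
    have hv₀eq : EqOn v₀ (fun t ↦ ‖v t‖ • e) (Icc 0 t₀) := by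
      refine linearODE_unique (hAc.mono hsub) (fun t ht ↦ (hv₀ t (hsub ht)).mono hsub)
        (fun t ht ↦ ((hnormd t ht).smul_const e).congr_deriv ?_) hmem ?_
      · rw [map_smul, (hrig t ht).1, smul_smul, mul_comm]
      · simp only [hedef]
        rw [hE, smul_smul, mul_inv_cancel₀ hp.ne', one_smul]
    have hdir : ∀ t ∈ Icc 0 t₀, ‖v t‖⁻¹ • v t = ‖v 0‖⁻¹ • v 0 := by
      have hd : ∀ t ∈ Icc 0 t₀, HasDerivWithinAt (fun t ↦ ‖v t‖⁻¹ • v t) 0 (Icc 0 t₀) t := by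
        intro t ht
        have hvp : 0 < ‖v t‖ := norm_pos_iff.2 (hne t (hsub ht))
        refine (((hnormd t ht).inv hvp.ne').smul ((h.deriv t (hsub ht)).mono hsub)).congr_deriv ?_
        conv_lhs => enter [1]; rw [(hrig t ht).2.1]
        rw [smul_smul, ← add_smul]
        convert! zero_smul ℝ (v t) using 2
        simp only [Pi.inv_apply]
        field_simp
        ring
      exact constant_of_derivWithin_zero (fun t ht ↦ (hd t ht).differentiableWithinAt)
        (fun t ht ↦ (hd t (Ico_subset_Icc_self ht)).derivWithin
          (uniqueDiffOn_Icc ht₀.1 t (Ico_subset_Icc_self ht)))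
    refine ⟨‖v 0‖⁻¹ • v 0, e, he, fun t ht ↦ ⟨?_, hv₀eq ht, ?_⟩⟩
    · have hvp : 0 < ‖v t‖ := norm_pos_iff.2 (hne t (hsub ht))
      rw [← hdir t ht, smul_smul, mul_inv_cancel₀ hvp.ne', one_smul]
    · rw [(hrig t ht).2.2, hv₀eq ht]
      simp only [map_smul, real_inner_smul_left, real_inner_smul_right]
      ring

end RiccatiComparison

end Comparison

/-! ### Riemannian metrics on open subsets of a vector space -/

section CoordinateGeometry

-- the instances on iterated spaces of continuous linear maps are nested deeply
set_option maxSynthPendingDepth 3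

variable {E : Type*} [NormedAddCommGroup E] [NormedSpace ℝ E]

/-- A smooth Riemannian metric on the open subset `Ω` of a vector space. -/
structure IsMetricOn (g : E → E →L[ℝ] E →L[ℝ] ℝ) (Ω : Set E) : Prop where
  isOpen : IsOpen Ω
  contDiffOn : ContDiffOn ℝ ∞ g Ω
  symm : ∀ y ∈ Ω, ∀ a b, g y a b = g y b a
  pos : ∀ y ∈ Ω, ∀ a, a ≠ 0 → 0 < g y a a

/-- The Christoffel symbols of the first kind as a trilinear form, in terms of the derivative `D` of
the metric. -/
noncomputable def christoffelFirstForm (D : E →L[ℝ] E →L[ℝ] E →L[ℝ] ℝ) :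
    E →L[ℝ] E →L[ℝ] E →L[ℝ] ℝ :=
  (1 / 2 : ℝ) • (D + D.flip -
    ((ContinuousLinearMap.flipₗᵢ ℝ E E ℝ : (E →L[ℝ] E →L[ℝ] ℝ) →L[ℝ] _).comp D.flip))

/-- The Christoffel symbols of the metric `g` as a field of bilinear maps. -/
noncomputable def christoffelForm (g : E → E →L[ℝ] E →L[ℝ] ℝ) (y : E) : E →L[ℝ] E →L[ℝ] E :=
  (ContinuousLinearMap.compL ℝ E (E →L[ℝ] ℝ) E (g y).inverse).comp
    (christoffelFirstForm (fderiv ℝ g y))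

/-- The curvature tensor of the connection with Christoffel symbols `Γ`. -/
noncomputable def curvatureForm (Γ : E → E →L[ℝ] E →L[ℝ] E) (y a b c : E) : E :=
  fderiv ℝ Γ y a b c - fderiv ℝ Γ y b a c + Γ y a (Γ y b c) - Γ y b (Γ y a c)

theorem minSmoothness_two_le_infty : minSmoothness ℝ 2 ≤ ∞ := by
  rw [minSmoothness_of_isRCLikeNormedField]
  exact ENat.LEInfty.out

theorem christoffelFirstForm_apply (D : E →L[ℝ] E →L[ℝ] E →L[ℝ] ℝ) (a b c : E) :
    christoffelFirstForm D a b c = (D a b c + D b a c - D c a b) / 2 := by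
  simp [christoffelFirstForm]
  ring

namespace IsMetricOn

variable {g : E → E →L[ℝ] E →L[ℝ] ℝ} {Ω : Set E}

theorem contDiffAt (h : IsMetricOn g Ω) {y : E} (hy : y ∈ Ω) : ContDiffAt ℝ ∞ g y :=
  h.contDiffOn.contDiffAt (h.isOpen.mem_nhds hy)

theorem hasFDerivAt (h : IsMetricOn g Ω) {y : E} (hy : y ∈ Ω) :
    HasFDerivAt g (fderiv ℝ g y) y :=
  ((h.contDiffAt hy).differentiableAt (by simp)).hasFDerivAt

theorem fderiv_symm (h : IsMetricOn g Ω) {y : E} (hy : y ∈ Ω) (c a b : E) :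
    fderiv ℝ g y c a b = fderiv ℝ g y c b a := by
  have h1 := ((h.hasFDerivAt hy).clm_apply (hasFDerivAt_const a y)).clm_apply
    (hasFDerivAt_const b y)
  have h2 := ((h.hasFDerivAt hy).clm_apply (hasFDerivAt_const b y)).clm_apply
    (hasFDerivAt_const a y)
  have h3 : (fun z ↦ g z b a) =ᶠ[𝓝 y] fun z ↦ g z a b := by
    filter_upwards [h.isOpen.mem_nhds hy] with z hz using h.symm z hz b a
  have := DFunLike.congr_fun (h1.unique (h2.congr_of_eventuallyEq h3.symm)) c
  simpa using this

variable [FiniteDimensional ℝ E]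

theorem exists_equiv (h : IsMetricOn g Ω) {y : E} (hy : y ∈ Ω) :
    ∃ e : E ≃L[ℝ] (E →L[ℝ] ℝ), (e : E →L[ℝ] E →L[ℝ] ℝ) = g y := by
  have hinj : Function.Injective ((g y : E →ₗ[ℝ] (E →L[ℝ] ℝ))) := by
    rw [injective_iff_map_eq_zero]
    intro a ha
    by_contra hne
    have h1 := h.pos y hy a hne
    have h2 : g y a = 0 := ha
    simp [h2] at h1
  have hfr : Module.finrank ℝ E = Module.finrank ℝ (E →L[ℝ] ℝ) := by
    rw [← (LinearMap.toContinuousLinearMap : (E →ₗ[ℝ] ℝ) ≃ₗ[ℝ] (E →L[ℝ] ℝ)).finrank_eq]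
    exact (Subspace.dual_finrank_eq (K := ℝ) (V := E)).symm
  have : FiniteDimensional ℝ (E →L[ℝ] ℝ) :=
    (LinearMap.toContinuousLinearMap : (E →ₗ[ℝ] ℝ) ≃ₗ[ℝ] (E →L[ℝ] ℝ)).finiteDimensional
  refine ⟨(LinearEquiv.ofInjectiveOfFinrankEq _ hinj hfr).toContinuousLinearEquiv, ?_⟩
  ext a b
  rfl

theorem apply_inverse (h : IsMetricOn g Ω) {y : E} (hy : y ∈ Ω) (φ : E →L[ℝ] ℝ) :
    g y ((g y).inverse φ) = φ := by
  obtain ⟨e, he⟩ := h.exists_equiv hy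
  rw [← he, ContinuousLinearMap.inverse_equiv]
  exact e.apply_symm_apply φ

omit [FiniteDimensional ℝ E] in
theorem eq_of_apply_eq (h : IsMetricOn g Ω) {y : E} (hy : y ∈ Ω) {a b : E}
    (hab : ∀ c, g y a c = g y b c) : a = b := by
  by_contra hne
  have h1 := h.pos y hy (a - b) (sub_ne_zero.2 hne)
  simp [hab] at h1

theorem contDiffOn_christoffelForm (h : IsMetricOn g Ω) :
    ContDiffOn ℝ ∞ (christoffelForm g) Ω := by
  intro y hy
  apply ContDiffAt.contDiffWithinAt
  obtain ⟨e, he⟩ := h.exists_equiv hy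
  have hinv : ContDiffAt ℝ ∞ (fun z ↦ (g z).inverse) y := by
    have h1 : ContDiffAt ℝ ∞ ContinuousLinearMap.inverse (g y) := by
      rw [← he]; exact contDiffAt_map_inverse e
    exact h1.comp y (h.contDiffAt hy)
  have hD : ContDiffAt ℝ ∞ (fderiv ℝ g) y := (h.contDiffAt hy).fderiv_right (by simp)
  have hflip : ContDiffAt ℝ ∞ (fun z ↦ (fderiv ℝ g z).flip) y :=
    (ContinuousLinearMap.flipₗᵢ ℝ E E (E →L[ℝ] ℝ)).contDiff.contDiffAt.comp y hD
  have hK : ContDiffAt ℝ ∞ (fun z ↦ christoffelFirstForm (fderiv ℝ g z)) y := by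
    unfold christoffelFirstForm
    exact (contDiffAt_const (c := (1 / 2 : ℝ))).smul
      ((hD.add hflip).sub (contDiffAt_const.clm_comp hflip))
  exact (((ContinuousLinearMap.compL ℝ E (E →L[ℝ] ℝ) E).contDiff.contDiffAt.comp y
    hinv)).clm_comp hK

theorem hasFDerivAt_christoffelForm (h : IsMetricOn g Ω) {y : E} (hy : y ∈ Ω) :
    HasFDerivAt (christoffelForm g) (fderiv ℝ (christoffelForm g) y) y :=
  ((h.contDiffOn_christoffelForm.contDiffAt (h.isOpen.mem_nhds hy)).differentiableAt
    (by simp)).hasFDerivAt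

theorem apply_christoffelForm (h : IsMetricOn g Ω) {y : E} (hy : y ∈ Ω) (a b c : E) :
    g y (christoffelForm g y a b) c =
      (fderiv ℝ g y a b c + fderiv ℝ g y b a c - fderiv ℝ g y c a b) / 2 := by
  have : g y (christoffelForm g y a b) = christoffelFirstForm (fderiv ℝ g y) a b :=
    h.apply_inverse hy _
  rw [this, christoffelFirstForm_apply]

theorem christoffelForm_symm (h : IsMetricOn g Ω) {y : E} (hy : y ∈ Ω) (a b : E) :
    christoffelForm g y a b = christoffelForm g y b a := by
  refine h.eq_of_apply_eq hy fun c ↦ ?_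
  rw [h.apply_christoffelForm hy, h.apply_christoffelForm hy, h.fderiv_symm hy c a b]
  ring

/-- The Levi-Civita connection is metric. -/
theorem fderiv_eq (h : IsMetricOn g Ω) {y : E} (hy : y ∈ Ω) (c a b : E) :
    fderiv ℝ g y c a b = g y (christoffelForm g y c a) b + g y a (christoffelForm g y c b) := by
  rw [h.symm y hy a, h.apply_christoffelForm hy, h.apply_christoffelForm hy,
    h.fderiv_symm hy c b a, h.fderiv_symm hy a c b, h.fderiv_symm hy b c a]
  ring

theorem fderiv_christoffelForm_symm (h : IsMetricOn g Ω) {y : E} (hy : y ∈ Ω) (c a b : E) :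
    fderiv ℝ (christoffelForm g) y c a b = fderiv ℝ (christoffelForm g) y c b a := by
  have h1 := ((h.hasFDerivAt_christoffelForm hy).clm_apply
    (hasFDerivAt_const a y)).clm_apply (hasFDerivAt_const b y)
  have h2 := ((h.hasFDerivAt_christoffelForm hy).clm_apply
    (hasFDerivAt_const b y)).clm_apply (hasFDerivAt_const a y)
  have h3 : (fun z ↦ christoffelForm g z b a) =ᶠ[𝓝 y] fun z ↦ christoffelForm g z a b := by
    filter_upwards [h.isOpen.mem_nhds hy] with z hz using h.christoffelForm_symm hz b a
  have := DFunLike.congr_fun (h1.unique (h2.congr_of_eventuallyEq h3.symm)) c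
  simpa using this

theorem curvatureForm_bianchi (h : IsMetricOn g Ω) {y : E} (hy : y ∈ Ω) (a b c : E) :
    curvatureForm (christoffelForm g) y a b c + curvatureForm (christoffelForm g) y b c a +
      curvatureForm (christoffelForm g) y c a b = 0 := by
  simp only [curvatureForm]
  rw [h.christoffelForm_symm hy c b, h.christoffelForm_symm hy c a, h.christoffelForm_symm hy b a,
    h.fderiv_christoffelForm_symm hy a c b, h.fderiv_christoffelForm_symm hy b c a,
    h.fderiv_christoffelForm_symm hy c b a]
  abel

/-- `g(R(a, b) c, c) = 0`, from the symmetry of the second derivative of `g`. -/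
theorem apply_curvatureForm_self (h : IsMetricOn g Ω) {y : E} (hy : y ∈ Ω) (a b c : E) :
    g y (curvatureForm (christoffelForm g) y a b c) c = 0 := by
  set Γ := christoffelForm g with hΓ
  have hsym : IsSymmSndFDerivAt ℝ g y :=
    (h.contDiffAt hy).isSymmSndFDerivAt minSmoothness_two_le_infty
  have hD : HasFDerivAt (fderiv ℝ g) (fderiv ℝ (fderiv ℝ g) y) y :=
    (((h.contDiffAt hy).fderiv_right (m := ∞) (by simp)).differentiableAt (by simp)).hasFDerivAt
  have key : ∀ a b, fderiv ℝ (fderiv ℝ g) y a b c c =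
      2 * (fderiv ℝ g y a (Γ y b c) c + g y (fderiv ℝ Γ y a b c) c) := by
    intro a b
    have h1 := ((hD.clm_apply (hasFDerivAt_const b y)).clm_apply
      (hasFDerivAt_const c y)).clm_apply (hasFDerivAt_const c y)
    have h2 := ((((h.hasFDerivAt hy).clm_apply (((h.hasFDerivAt_christoffelForm hy).clm_apply
      (hasFDerivAt_const b y)).clm_apply (hasFDerivAt_const c y))).clm_apply
        (hasFDerivAt_const c y))).const_mul 2
    have h3 : (fun z ↦ fderiv ℝ g z b c c) =ᶠ[𝓝 y] fun z ↦ 2 * g z (Γ z b c) c := by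
      filter_upwards [h.isOpen.mem_nhds hy] with z hz
      rw [h.fderiv_eq hz, h.symm z hz c, two_mul]
    have := DFunLike.congr_fun (h1.unique (h2.congr_of_eventuallyEq h3)) a
    simp at this
    rw [this]; ring
  have h1 := key a b
  have h2 := key b a
  rw [hsym a b, h2] at h1
  rw [h.fderiv_eq hy, h.fderiv_eq hy, ← hΓ, h.symm y hy (Γ y b c) (Γ y a c)] at h1
  simp only [curvatureForm, map_sub, map_add, sub_apply, add_apply]
  linarith

omit [FiniteDimensional ℝ E] in
theorem _root_.RauchComparison.curvatureForm_swap (Γ : E → E →L[ℝ] E →L[ℝ] E) (y a b c : E) :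
    curvatureForm Γ y a b c = -curvatureForm Γ y b a c := by
  simp only [curvatureForm]; abel

theorem apply_curvatureForm_skew (h : IsMetricOn g Ω) {y : E} (hy : y ∈ Ω) (a b c d : E) :
    g y (curvatureForm (christoffelForm g) y a b c) d =
      -g y (curvatureForm (christoffelForm g) y a b d) c := by
  have h1 := h.apply_curvatureForm_self hy a b (c + d)
  have h2 := h.apply_curvatureForm_self hy a b c
  have h3 := h.apply_curvatureForm_self hy a b d
  have h4 : curvatureForm (christoffelForm g) y a b (c + d) =
      curvatureForm (christoffelForm g) y a b c + curvatureForm (christoffelForm g) y a b d := by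
    simp only [curvatureForm, map_add]; abel
  rw [h4] at h1
  simp only [map_add, add_apply] at h1
  linarith

/-- The Jacobi operator `u ↦ R(u, w) w` is symmetric. -/
theorem apply_curvatureForm_jacobi (h : IsMetricOn g Ω) {y : E} (hy : y ∈ Ω) (u w v : E) :
    g y (curvatureForm (christoffelForm g) y u w w) v =
      g y (curvatureForm (christoffelForm g) y v w w) u := by
  set S : E → E → E → E → ℝ := fun a b c d ↦
    g y (curvatureForm (christoffelForm g) y a b c) d with hS
  have h1 : ∀ a b c d, S a b c d = -S b a c d := fun a b c d ↦ by
    simp only [hS]; rw [curvatureForm_swap]; simp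
  have h2 : ∀ a b c d, S a b c d = -S a b d c := fun a b c d ↦ h.apply_curvatureForm_skew hy a b c d
  have h3 : ∀ a b c d, S a b c d + S b c a d + S c a b d = 0 := fun a b c d ↦ by
    have := congrArg (fun x ↦ g y x d) (h.curvatureForm_bianchi hy a b c)
    simpa using this
  -- the pair symmetry of a curvature-like tensor, for the pairs `(u, w)` and `(w, v)`
  change S u w w v = S v w w u
  linarith [h3 u w w v, h3 v w w u, h3 u v w w, h3 u w v w, h2 u v w w, h1 w w u v, h1 w w v u,
    h1 u w w v, h1 v w w u, h2 u w w v, h2 v w w u, h1 v u w w, h2 u w v w, h1 u w v w,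
    h2 v w u w, h1 v w u w, h2 w w u v, h1 u v w w]

end IsMetricOn

/-! ### Naturality under local isometries -/

section Transformation

variable {g₁ g₂ : E → E →L[ℝ] E →L[ℝ] ℝ} {Ω₁ Ω₂ U : Set E} {ψ : E → E}

/-- `ψ`, defined on the open set `U`, is a local isometry from the metric `g₁` to `g₂`. Its
differential is required to be surjective; it is injective by `isometry`. -/
structure IsLocalIsometryOn (g₁ g₂ : E → E →L[ℝ] E →L[ℝ] ℝ) (Ω₁ Ω₂ : Set E) (ψ : E → E)
    (U : Set E) : Prop where
  metric₁ : IsMetricOn g₁ Ω₁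
  metric₂ : IsMetricOn g₂ Ω₂
  isOpen : IsOpen U
  subset : U ⊆ Ω₁
  mapsTo : MapsTo ψ U Ω₂
  contDiffOn : ContDiffOn ℝ ∞ ψ U
  surjective : ∀ y ∈ U, Function.Surjective (fderiv ℝ ψ y)
  isometry : ∀ y ∈ U, ∀ a b, g₁ y a b = g₂ (ψ y) (fderiv ℝ ψ y a) (fderiv ℝ ψ y b)

namespace IsLocalIsometryOn

variable (h : IsLocalIsometryOn g₁ g₂ Ω₁ Ω₂ ψ U) {y : E} (hy : y ∈ U)
include h hy

theorem contDiffAt : ContDiffAt ℝ ∞ ψ y := h.contDiffOn.contDiffAt (h.isOpen.mem_nhds hy)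

theorem hasFDerivAt : HasFDerivAt ψ (fderiv ℝ ψ y) y :=
  ((h.contDiffAt hy).differentiableAt (by simp)).hasFDerivAt

theorem hasFDerivAt_fderiv : HasFDerivAt (fderiv ℝ ψ) (fderiv ℝ (fderiv ℝ ψ) y) y :=
  (((h.contDiffAt hy).fderiv_right (m := ∞) (by simp)).differentiableAt (by simp)).hasFDerivAt

theorem fderiv_fderiv_symm (a b : E) :
    fderiv ℝ (fderiv ℝ ψ) y a b = fderiv ℝ (fderiv ℝ ψ) y b a :=
  (h.contDiffAt hy).isSymmSndFDerivAt minSmoothness_two_le_infty a b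

theorem fderiv_metric (c a b : E) : fderiv ℝ g₁ y c a b =
    fderiv ℝ g₂ (ψ y) (fderiv ℝ ψ y c) (fderiv ℝ ψ y a) (fderiv ℝ ψ y b) +
      g₂ (ψ y) (fderiv ℝ (fderiv ℝ ψ) y c a) (fderiv ℝ ψ y b) +
      g₂ (ψ y) (fderiv ℝ ψ y a) (fderiv ℝ (fderiv ℝ ψ) y c b) := by
  have h1 := ((h.metric₁.hasFDerivAt (h.subset hy)).clm_apply (hasFDerivAt_const a y)).clm_apply
    (hasFDerivAt_const b y)
  have hT := h.hasFDerivAt_fderiv hy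
  have h2 := (((h.metric₂.hasFDerivAt (h.mapsTo hy)).comp y (h.hasFDerivAt hy)).clm_apply
    (hT.clm_apply (hasFDerivAt_const a y))).clm_apply (hT.clm_apply (hasFDerivAt_const b y))
  have h3 : (fun z ↦ g₁ z a b) =ᶠ[𝓝 y]
      fun z ↦ (g₂ ∘ ψ) z (fderiv ℝ ψ z a) (fderiv ℝ ψ z b) := by
    filter_upwards [h.isOpen.mem_nhds hy] with z hz using h.isometry z hz a b
  have := DFunLike.congr_fun (h1.unique (h2.congr_of_eventuallyEq h3)) c
  simp at this
  rw [this]; ring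

variable [FiniteDimensional ℝ E]

/-- The transformation law of the Christoffel symbols. Both sides have the same inner products with
all vectors, by `apply_christoffelForm` and the derivative of the isometry equation. -/
theorem fderiv_christoffelForm (a b : E) : fderiv ℝ ψ y (christoffelForm g₁ y a b) =
    christoffelForm g₂ (ψ y) (fderiv ℝ ψ y a) (fderiv ℝ ψ y b) +
      fderiv ℝ (fderiv ℝ ψ) y a b := by
  refine h.metric₂.eq_of_apply_eq (h.mapsTo hy) fun c' ↦ ?_
  obtain ⟨c, rfl⟩ := h.surjective y hy c'
  have hs := h.metric₂.symm (ψ y) (h.mapsTo hy)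
  rw [← h.isometry y hy, h.metric₁.apply_christoffelForm (h.subset hy), map_add, add_apply,
    h.metric₂.apply_christoffelForm (h.mapsTo hy), h.fderiv_metric hy, h.fderiv_metric hy,
    h.fderiv_metric hy, h.fderiv_fderiv_symm hy b a, h.fderiv_fderiv_symm hy c a,
    h.fderiv_fderiv_symm hy c b, hs (fderiv ℝ ψ y b), hs (fderiv ℝ ψ y a)]
  ring

/-- The curvature tensor is natural under local isometries: differentiate the transformation law of
the Christoffel symbols and antisymmetrize, using that the third derivative of `ψ` is symmetric. -/
theorem fderiv_curvatureForm (a b c : E) :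
    fderiv ℝ ψ y (curvatureForm (christoffelForm g₁) y a b c) =
      curvatureForm (christoffelForm g₂) (ψ y) (fderiv ℝ ψ y a) (fderiv ℝ ψ y b)
        (fderiv ℝ ψ y c) := by
  set Γ₁ := christoffelForm g₁
  set Γ₂ := christoffelForm g₂
  have hT := h.hasFDerivAt_fderiv hy
  have hΓ₁ := h.metric₁.hasFDerivAt_christoffelForm (h.subset hy)
  have hΓ₂ := h.metric₂.hasFDerivAt_christoffelForm (h.mapsTo hy)
  have hT2 : HasFDerivAt (fderiv ℝ (fderiv ℝ ψ)) (fderiv ℝ (fderiv ℝ (fderiv ℝ ψ)) y) y :=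
    ((((h.contDiffAt hy).fderiv_right (m := ∞) (by simp)).fderiv_right (m := ∞)
      (by simp)).differentiableAt (by simp)).hasFDerivAt
  have hsym : ∀ a b c, fderiv ℝ (fderiv ℝ (fderiv ℝ ψ)) y a b c =
      fderiv ℝ (fderiv ℝ (fderiv ℝ ψ)) y b a c := fun a b c ↦ by
    have : IsSymmSndFDerivAt ℝ (fderiv ℝ ψ) y :=
      ((h.contDiffAt hy).fderiv_right (m := ∞) (by simp)).isSymmSndFDerivAt
        minSmoothness_two_le_infty
    rw [this a b]
  have key : ∀ a b c, fderiv ℝ ψ y (fderiv ℝ Γ₁ y a b c) =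
      fderiv ℝ Γ₂ (ψ y) (fderiv ℝ ψ y a) (fderiv ℝ ψ y b) (fderiv ℝ ψ y c)
      + Γ₂ (ψ y) (fderiv ℝ (fderiv ℝ ψ) y a b) (fderiv ℝ ψ y c)
      + Γ₂ (ψ y) (fderiv ℝ ψ y b) (fderiv ℝ (fderiv ℝ ψ) y a c)
      + fderiv ℝ (fderiv ℝ (fderiv ℝ ψ)) y a b c
      - fderiv ℝ (fderiv ℝ ψ) y a (Γ₁ y b c) := by
    intro a b c
    have h1 := hT.clm_apply ((hΓ₁.clm_apply (hasFDerivAt_const b y)).clm_apply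
      (hasFDerivAt_const c y))
    have h2 := (((hΓ₂.comp y (h.hasFDerivAt hy)).clm_apply
      (hT.clm_apply (hasFDerivAt_const b y))).clm_apply
        (hT.clm_apply (hasFDerivAt_const c y))).add
      ((hT2.clm_apply (hasFDerivAt_const b y)).clm_apply (hasFDerivAt_const c y))
    have h3 : (fun z ↦ fderiv ℝ ψ z (Γ₁ z b c)) =ᶠ[𝓝 y]
        (fun z ↦ (Γ₂ ∘ ψ) z (fderiv ℝ ψ z b) (fderiv ℝ ψ z c)) +
          fun z ↦ fderiv ℝ (fderiv ℝ ψ) z b c := by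
      filter_upwards [h.isOpen.mem_nhds hy] with z hz using h.fderiv_christoffelForm hz b c
    have := DFunLike.congr_fun (h1.unique (h2.congr_of_eventuallyEq h3)) a
    simp at this
    rw [eq_sub_iff_add_eq, this]; abel
  simp only [curvatureForm, map_add, map_sub]
  rw [key, key, h.fderiv_christoffelForm hy a, h.fderiv_christoffelForm hy b (Γ₁ y a c),
    h.fderiv_christoffelForm hy b c, h.fderiv_christoffelForm hy a c, hsym a b c,
    h.fderiv_fderiv_symm hy a b]
  simp only [map_add]
  abel

end IsLocalIsometryOn

end Transformation

end CoordinateGeometry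

/-! ### The metric and the curvature tensor in the charts of a manifold -/

section Charts

-- the instances on iterated spaces of continuous linear maps are nested deeply
set_option maxSynthPendingDepth 3

variable {E : Type*} [NormedAddCommGroup E] [NormedSpace ℝ E]
  {M : Type*} [TopologicalSpace M] [ChartedSpace E M] [IsManifold 𝓘(ℝ, E) ∞ M]

/-- The coordinates, in the chart at `p`, of tangent vectors at `z`. -/
noncomputable def tangentCoord (p z : M) : TangentSpace 𝓘(ℝ, E) z →L[ℝ] E :=
  (trivializationAt E (TangentSpace 𝓘(ℝ, E) : M → Type _) p).continuousLinearMapAt ℝ z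

/-- The change of coordinates from the chart at `p` to the chart at `q`. -/
noncomputable def transition (p q : M) : E → E :=
  extChartAt 𝓘(ℝ, E) q ∘ (extChartAt 𝓘(ℝ, E) p).symm

theorem trivializationAt_snd {p z : M} (hz : z ∈ (chartAt E p).source)
    (v : TangentSpace 𝓘(ℝ, E) z) :
    (trivializationAt E (TangentSpace 𝓘(ℝ, E) : M → Type _) p ⟨z, v⟩).2 = tangentCoord p z v :=
  (Trivialization.continuousLinearMapAt_apply_of_mem ℝ _ hz v).symm

theorem tangentCoord_eq {p z : M} (hz : z ∈ (chartAt E p).source) (v : TangentSpace 𝓘(ℝ, E) z) :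
    tangentCoord p z v = tangentCoordChange 𝓘(ℝ, E) z p z v := by
  rw [tangentCoord, TangentBundle.continuousLinearMapAt_trivializationAt_eq_core hz]
  rfl

theorem tangentCoord_self (z : M) (v : TangentSpace 𝓘(ℝ, E) z) :
    tangentCoord z z v = v := by
  rw [tangentCoord_eq (mem_chart_source E z)]
  exact tangentCoordChange_self (mem_extChartAt_source z)

theorem fderiv_transition (p q z : M) :
    fderiv ℝ (transition (E := E) p q) (extChartAt 𝓘(ℝ, E) p z) =
      tangentCoordChange 𝓘(ℝ, E) p q z := by
  rw [tangentCoordChange_def]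
  simp [transition]

theorem tangentCoord_change {p q z : M} (hp : z ∈ (chartAt E p).source)
    (hq : z ∈ (chartAt E q).source) (v : TangentSpace 𝓘(ℝ, E) z) :
    tangentCoord q z v = fderiv ℝ (transition (E := E) p q) (extChartAt 𝓘(ℝ, E) p z)
      (tangentCoord p z v) := by
  rw [fderiv_transition, tangentCoord_eq hp, tangentCoord_eq hq]
  exact (tangentCoordChange_comp ⟨⟨mem_extChartAt_source z, by simpa using hp⟩,
    by simpa using hq⟩).symm

theorem symmL_tangentCoord {p z : M} (hz : z ∈ (chartAt E p).source)
    (v : TangentSpace 𝓘(ℝ, E) z) :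
    (trivializationAt E (TangentSpace 𝓘(ℝ, E) : M → Type _) p).symmL ℝ z (tangentCoord p z v) = v :=
  Trivialization.symmL_continuousLinearMapAt _ hz v

theorem tangentCoord_symmL {p z : M} (hz : z ∈ (chartAt E p).source) (a : E) :
    tangentCoord p z
      ((trivializationAt E (TangentSpace 𝓘(ℝ, E) : M → Type _) p).symmL ℝ z a) = a :=
  Trivialization.continuousLinearMapAt_symmL _ hz a

theorem tangentCoord_injective {p z : M} (hz : z ∈ (chartAt E p).source) :
    Function.Injective (tangentCoord (E := E) p z) :=
  Function.LeftInverse.injective (symmL_tangentCoord hz)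

omit [IsManifold 𝓘(ℝ, E) ∞ M] in
theorem mem_chart_source_of_target {p : M} {y : E} (hy : y ∈ (extChartAt 𝓘(ℝ, E) p).target) :
    (extChartAt 𝓘(ℝ, E) p).symm y ∈ (chartAt E p).source := by
  rw [← extChartAt_source 𝓘(ℝ, E)]
  exact (extChartAt 𝓘(ℝ, E) p).map_target hy

omit [IsManifold 𝓘(ℝ, E) ∞ M] in
theorem mem_transition_domain {p q z : M} (hp : z ∈ (chartAt E p).source)
    (hq : z ∈ (chartAt E q).source) : extChartAt 𝓘(ℝ, E) p z ∈ (extChartAt 𝓘(ℝ, E) p).target ∩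
      (extChartAt 𝓘(ℝ, E) p).symm ⁻¹' (chartAt E q).source := by
  have hp' : z ∈ (extChartAt 𝓘(ℝ, E) p).source := by simpa using hp
  exact ⟨(extChartAt 𝓘(ℝ, E) p).map_source hp', by
    rw [mem_preimage, (extChartAt 𝓘(ℝ, E) p).left_inv hp']; exact hq⟩

variable [RiemannianBundle (fun x : M ↦ TangentSpace 𝓘(ℝ, E) x)]

theorem metricInChart_apply {p z : M} (hz : z ∈ (chartAt E p).source) (a b : E) :
    metricInChart p (extChartAt 𝓘(ℝ, E) p z) a b =
      ⟪((trivializationAt E (TangentSpace 𝓘(ℝ, E) : M → Type _) p).symmL ℝ z a :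
        TangentSpace 𝓘(ℝ, E) z),
        (trivializationAt E (TangentSpace 𝓘(ℝ, E) : M → Type _) p).symmL ℝ z b⟫_ℝ := by
  have h : (extChartAt 𝓘(ℝ, E) p).symm (extChartAt 𝓘(ℝ, E) p z) = z :=
    (extChartAt 𝓘(ℝ, E) p).left_inv (by simpa using hz)
  exact congrArg (fun w : M ↦
    (⟪((trivializationAt E (TangentSpace 𝓘(ℝ, E) : M → Type _) p).symmL ℝ w a :
      TangentSpace 𝓘(ℝ, E) w),
        (trivializationAt E (TangentSpace 𝓘(ℝ, E) : M → Type _) p).symmL ℝ w b⟫_ℝ : ℝ)) h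

theorem inner_eq_metricInChart {p z : M} (hz : z ∈ (chartAt E p).source)
    (u v : TangentSpace 𝓘(ℝ, E) z) :
    ⟪u, v⟫_ℝ = metricInChart p (extChartAt 𝓘(ℝ, E) p z) (tangentCoord p z u)
      (tangentCoord p z v) := by
  rw [metricInChart_apply hz, symmL_tangentCoord hz, symmL_tangentCoord hz]

variable [FiniteDimensional ℝ E]
  [IsContMDiffRiemannianBundle 𝓘(ℝ, E) ∞ E (fun x : M ↦ TangentSpace 𝓘(ℝ, E) x)]

theorem isMetricOn_metricInChart (p : M) :
    IsMetricOn (metricInChart (E := E) p) (extChartAt 𝓘(ℝ, E) p).target where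
  isOpen := isOpen_extChartAt_target p
  contDiffOn := by
    rw [contDiffOn_clm_apply]
    intro a
    rw [contDiffOn_clm_apply]
    intro b
    rw [← contMDiffOn_iff_contDiffOn]
    set e := trivializationAt E (TangentSpace 𝓘(ℝ, E) : M → Type _) p
    have hsec : ∀ a : E, ContMDiffOn 𝓘(ℝ, E) 𝓘(ℝ, E).tangent ∞
        (fun y ↦ (⟨(extChartAt 𝓘(ℝ, E) p).symm y,
          e.symmL ℝ ((extChartAt 𝓘(ℝ, E) p).symm y) a⟩ : TangentBundle 𝓘(ℝ, E) M))
        (extChartAt 𝓘(ℝ, E) p).target := by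
      intro a
      rw [e.contMDiffOn_iff (fun y hy ↦ by
        rw [e.mem_source]; exact mem_chart_source_of_target hy)]
      refine ⟨contMDiffOn_extChartAt_symm p, contMDiffOn_const (c := a) |>.congr fun y hy ↦ ?_⟩
      have := mem_chart_source_of_target hy
      exact (trivializationAt_snd this _).trans (tangentCoord_symmL this a)
    exact ContMDiffOn.inner_bundle (F := E) (E := fun x : M ↦ TangentSpace 𝓘(ℝ, E) x)
      (hsec a) (hsec b)
  symm y hy a b := by
    have hz := mem_chart_source_of_target hy
    rw [← (extChartAt 𝓘(ℝ, E) p).right_inv hy, metricInChart_apply hz, metricInChart_apply hz]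
    exact real_inner_comm _ _
  pos y hy a ha := by
    have hz := mem_chart_source_of_target hy
    rw [← (extChartAt 𝓘(ℝ, E) p).right_inv hy, metricInChart_apply hz]
    refine real_inner_self_pos.2 fun h0 ↦ ha ?_
    rw [← tangentCoord_symmL hz a]
    exact (congrArg _ h0).trans (map_zero _)

theorem isLocalIsometryOn_transition (p q : M) :
    IsLocalIsometryOn (metricInChart (E := E) p) (metricInChart q) (extChartAt 𝓘(ℝ, E) p).target
      (extChartAt 𝓘(ℝ, E) q).target (transition p q)
      ((extChartAt 𝓘(ℝ, E) p).target ∩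
        (extChartAt 𝓘(ℝ, E) p).symm ⁻¹' (chartAt E q).source) := by
  have key : ∀ y ∈ (extChartAt 𝓘(ℝ, E) p).target ∩
      (extChartAt 𝓘(ℝ, E) p).symm ⁻¹' (chartAt E q).source, ∃ z ∈ (chartAt E p).source,
      z ∈ (chartAt E q).source ∧ extChartAt 𝓘(ℝ, E) p z = y ∧
        transition p q y = extChartAt 𝓘(ℝ, E) q z := fun y hy ↦
    ⟨(extChartAt 𝓘(ℝ, E) p).symm y, mem_chart_source_of_target hy.1, hy.2,
      (extChartAt 𝓘(ℝ, E) p).right_inv hy.1, rfl⟩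
  refine ⟨isMetricOn_metricInChart p, isMetricOn_metricInChart q, ?_, inter_subset_left, ?_, ?_,
    ?_, ?_⟩
  · exact (continuousOn_extChartAt_symm p).isOpen_inter_preimage (isOpen_extChartAt_target p)
      (chartAt E q).open_source
  · intro y hy
    obtain ⟨z, hp, hq, rfl, h⟩ := key y hy
    rw [h]
    exact (extChartAt 𝓘(ℝ, E) q).map_source (by simpa using hq)
  · rw [← contMDiffOn_iff_contDiffOn]
    exact (contMDiffOn_extChartAt (x := q)).comp
      ((contMDiffOn_extChartAt_symm p).mono inter_subset_left) fun y hy ↦ hy.2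
  · intro y hy b
    obtain ⟨z, hp, hq, rfl, h⟩ := key y hy
    exact ⟨tangentCoord p z ((trivializationAt E (TangentSpace 𝓘(ℝ, E) : M → Type _) q).symmL ℝ z b),
      by rw [← tangentCoord_change hp hq, tangentCoord_symmL hq]⟩
  · intro y hy a b
    obtain ⟨z, hp, hq, rfl, h⟩ := key y hy
    rw [h]
    set e := trivializationAt E (TangentSpace 𝓘(ℝ, E) : M → Type _) p
    have h1 := inner_eq_metricInChart hp (e.symmL ℝ z a) (e.symmL ℝ z b)
    have h2 := inner_eq_metricInChart hq (e.symmL ℝ z a) (e.symmL ℝ z b)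
    rw [h1, tangentCoord_change hp hq, tangentCoord_change hp hq, tangentCoord_symmL hp,
      tangentCoord_symmL hp] at h2
    exact h2

theorem curvatureInChart_eq {p : M} {y : E} (hy : y ∈ (extChartAt 𝓘(ℝ, E) p).target) (a b c : E) :
    curvatureInChart p y a b c = curvatureForm (christoffelForm (metricInChart p)) y a b c := by
  have key : ∀ a b, fderiv ℝ (fun z ↦ christoffel p z b c) y a =
      fderiv ℝ (christoffelForm (metricInChart p)) y a b c := by
    intro a b
    have h := (((isMetricOn_metricInChart p).hasFDerivAt_christoffelForm hy).clm_apply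
      (hasFDerivAt_const b y)).clm_apply (hasFDerivAt_const c y)
    refine (congrArg (fun L : E →L[ℝ] E ↦ L a) h.fderiv).trans ?_
    simp
  rw [curvatureInChart, curvatureForm, key, key]
  rfl

/-- The curvature tensor, although defined with the chart at `z`, can be computed in any chart. -/
theorem tangentCoord_curvature {p z : M} (hz : z ∈ (chartAt E p).source)
    (u v w : TangentSpace 𝓘(ℝ, E) z) :
    tangentCoord p z (curvature z u v w) =
      curvatureForm (christoffelForm (metricInChart p)) (extChartAt 𝓘(ℝ, E) p z)
        (tangentCoord p z u) (tangentCoord p z v) (tangentCoord p z w) := by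
  have hzz := mem_chart_source E z
  have h := (isLocalIsometryOn_transition (E := E) z p).fderiv_curvatureForm
    (mem_transition_domain hzz hz) (tangentCoord z z u) (tangentCoord z z v) (tangentCoord z z w)
  rw [← tangentCoord_change hzz hz, ← tangentCoord_change hzz hz, ← tangentCoord_change hzz hz] at h
  have h2 : transition (E := E) z p (extChartAt 𝓘(ℝ, E) z z) = extChartAt 𝓘(ℝ, E) p z := by
    simp [transition]
  rw [h2] at h
  have h3 : tangentCoord z z (curvature z u v w) =
      curvatureForm (christoffelForm (metricInChart z)) (extChartAt 𝓘(ℝ, E) z z)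
        (tangentCoord z z u) (tangentCoord z z v) (tangentCoord z z w) := by
    have h4 := curvatureInChart_eq (mem_extChartAt_target (I := 𝓘(ℝ, E)) z) u v w
    rw [tangentCoord_self, tangentCoord_self, tangentCoord_self, tangentCoord_self]
    exact h4
  rw [← h, ← h3]
  exact tangentCoord_change hzz hz _

theorem inner_curvature_jacobi (z : M) (u w v : TangentSpace 𝓘(ℝ, E) z) :
    ⟪curvature z u w w, v⟫_ℝ = ⟪u, curvature z v w w⟫_ℝ := by
  have hz := mem_chart_source E z
  rw [real_inner_comm (curvature z v w w), inner_eq_metricInChart hz, inner_eq_metricInChart hz,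
    tangentCoord_curvature hz, tangentCoord_curvature hz]
  exact (isMetricOn_metricInChart z).apply_curvatureForm_jacobi (mem_extChartAt_target z) _ _ _

theorem inner_curvature_self (z : M) (u v w : TangentSpace 𝓘(ℝ, E) z) :
    ⟪curvature z u v w, w⟫_ℝ = 0 := by
  have hz := mem_chart_source E z
  rw [inner_eq_metricInChart hz, tangentCoord_curvature hz]
  exact (isMetricOn_metricInChart z).apply_curvatureForm_self (mem_extChartAt_target z) _ _ _

theorem inner_curvature_swap (z : M) (u v : TangentSpace 𝓘(ℝ, E) z) :
    ⟪curvature z u v v, u⟫_ℝ = ⟪curvature z v u u, v⟫_ℝ := by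
  have hz := mem_chart_source E z
  rw [inner_eq_metricInChart hz, inner_eq_metricInChart hz, tangentCoord_curvature hz,
    tangentCoord_curvature hz, (isMetricOn_metricInChart z).apply_curvatureForm_skew
      (mem_extChartAt_target z), curvatureForm_swap]
  simp

end Charts

/-! ### Vector fields along curves -/

section FieldsAlongCurves

-- the instances on iterated spaces of continuous linear maps are nested deeply
set_option maxSynthPendingDepth 3

variable {E : Type*} [NormedAddCommGroup E] [NormedSpace ℝ E]
  {M : Type*} [TopologicalSpace M] [ChartedSpace E M] [IsManifold 𝓘(ℝ, E) ∞ M]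
  {γ : ℝ → M} {s : Set ℝ} {t : ℝ} {p : M}

/-- Smoothness at the time `t` of a vector field along a curve. -/
def IsSmoothAlongAt (γ : ℝ → M) (s : Set ℝ) (V : ∀ t, TangentSpace 𝓘(ℝ, E) (γ t)) (t : ℝ) : Prop :=
  ContMDiffWithinAt 𝓘(ℝ, ℝ) 𝓘(ℝ, E).tangent ∞
    (fun t ↦ (⟨γ t, V t⟩ : TangentBundle 𝓘(ℝ, E) M)) s t

/-- The coordinates of a curve in the chart at `p`. -/
noncomputable def curveCoord (p : M) (γ : ℝ → M) (t : ℝ) : E := extChartAt 𝓘(ℝ, E) p (γ t)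

/-- The coordinates of a vector field along a curve in the chart at `p`. -/
noncomputable def fieldCoord (p : M) (γ : ℝ → M) (V : ∀ t, TangentSpace 𝓘(ℝ, E) (γ t)) (t : ℝ) :
    E :=
  tangentCoord p (γ t) (V t)

omit [NormedSpace ℝ E] [IsManifold 𝓘(ℝ, E) ∞ M] in
theorem eventually_mem_source (hγ : ContinuousWithinAt γ s t) (hp : γ t ∈ (chartAt E p).source) :
    ∀ᶠ τ in 𝓝[s] t, γ τ ∈ (chartAt E p).source :=
  hγ.eventually ((chartAt E p).open_source.mem_nhds hp)

theorem contDiffWithinAt_curveCoord (hγ : ContMDiffWithinAt 𝓘(ℝ, ℝ) 𝓘(ℝ, E) ∞ γ s t)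
    (hp : γ t ∈ (chartAt E p).source) : ContDiffWithinAt ℝ ∞ (curveCoord (E := E) p γ) s t :=
  ((contMDiffAt_extChartAt' hp).comp_contMDiffWithinAt t hγ).contDiffWithinAt

theorem snd_eventuallyEq (hγ : ContinuousWithinAt γ s t) (hp : γ t ∈ (chartAt E p).source)
    (V : ∀ t, TangentSpace 𝓘(ℝ, E) (γ t)) :
    (fun τ ↦ (trivializationAt E (TangentSpace 𝓘(ℝ, E) : M → Type _) p ⟨γ τ, V τ⟩).2) =ᶠ[𝓝[s] t]
      fieldCoord p γ V := by
  filter_upwards [eventually_mem_source hγ hp] with τ hτ using trivializationAt_snd hτ _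

/-- Smoothness of a vector field along a smooth curve can be tested in any chart. -/
theorem isSmoothAlongAt_iff (hγ : ContMDiffWithinAt 𝓘(ℝ, ℝ) 𝓘(ℝ, E) ∞ γ s t)
    (hp : γ t ∈ (chartAt E p).source) {V : ∀ t, TangentSpace 𝓘(ℝ, E) (γ t)} :
    IsSmoothAlongAt γ s V t ↔ ContDiffWithinAt ℝ ∞ (fieldCoord p γ V) s t := by
  set e := trivializationAt E (TangentSpace 𝓘(ℝ, E) : M → Type _) p
  rw [IsSmoothAlongAt, e.contMDiffWithinAt_iff (by rw [e.mem_source]; exact hp), and_iff_right hγ,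
    contMDiffWithinAt_iff_contDiffWithinAt]
  have h := snd_eventuallyEq hγ.continuousWithinAt hp V
  exact ⟨fun H ↦ H.congr_of_eventuallyEq h.symm (trivializationAt_snd hp _).symm,
    fun H ↦ H.congr_of_eventuallyEq h (trivializationAt_snd hp _)⟩

theorem fieldCoord_change {q : M} (hγ : ContinuousWithinAt γ s t)
    (hp : γ t ∈ (chartAt E p).source) (hq : γ t ∈ (chartAt E q).source)
    (V : ∀ t, TangentSpace 𝓘(ℝ, E) (γ t)) :
    fieldCoord q γ V =ᶠ[𝓝[s] t] fun τ ↦ fderiv ℝ (transition (E := E) p q) (curveCoord p γ τ)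
      (fieldCoord p γ V τ) := by
  filter_upwards [eventually_mem_source hγ hp, eventually_mem_source hγ hq] with τ h1 h2
    using tangentCoord_change h1 h2 _

omit [IsManifold 𝓘(ℝ, E) ∞ M] in
theorem curveCoord_change {q : M} (hγ : ContinuousWithinAt γ s t)
    (hp : γ t ∈ (chartAt E p).source) :
    curveCoord (E := E) q γ =ᶠ[𝓝[s] t] fun τ ↦ transition p q (curveCoord p γ τ) := by
  filter_upwards [eventually_mem_source hγ hp] with τ h1
  simp only [transition, curveCoord, Function.comp_apply]
  rw [(extChartAt 𝓘(ℝ, E) p).left_inv (by simpa using h1)]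

theorem IsSmoothAlongAt.hasDerivWithinAt (hγ : ContMDiffWithinAt 𝓘(ℝ, ℝ) 𝓘(ℝ, E) ∞ γ s t)
    (hp : γ t ∈ (chartAt E p).source) {V : ∀ t, TangentSpace 𝓘(ℝ, E) (γ t)}
    (hV : IsSmoothAlongAt γ s V t) :
    HasDerivWithinAt (fieldCoord p γ V) (derivWithin (fieldCoord p γ V) s t) s t :=
  (((isSmoothAlongAt_iff hγ hp).1 hV).differentiableWithinAt (by simp)).hasDerivWithinAt

theorem hasDerivWithinAt_curveCoord (hγ : ContMDiffWithinAt 𝓘(ℝ, ℝ) 𝓘(ℝ, E) ∞ γ s t)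
    (hp : γ t ∈ (chartAt E p).source) :
    HasDerivWithinAt (curveCoord (E := E) p γ) (derivWithin (curveCoord p γ) s t) s t :=
  ((contDiffWithinAt_curveCoord hγ hp).differentiableWithinAt (by simp)).hasDerivWithinAt

variable [RiemannianBundle (fun x : M ↦ TangentSpace 𝓘(ℝ, E) x)]

theorem covDerivInChart_eq (hγ : ContinuousWithinAt γ s t) (hp : γ t ∈ (chartAt E p).source)
    (V : ∀ t, TangentSpace 𝓘(ℝ, E) (γ t)) :
    covDerivInChart p γ s V t = derivWithin (fieldCoord p γ V) s t +
      christoffelForm (metricInChart p) (curveCoord p γ t) (derivWithin (curveCoord p γ) s t)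
        (fieldCoord p γ V t) := by
  rw [covDerivInChart, (snd_eventuallyEq hγ hp V).derivWithin_eq (trivializationAt_snd hp _)]
  simp only [trivializationAt_snd hp]
  rfl

variable [FiniteDimensional ℝ E]
  [IsContMDiffRiemannianBundle 𝓘(ℝ, E) ∞ E (fun x : M ↦ TangentSpace 𝓘(ℝ, E) x)]

/-- The coordinates of the velocity are the derivatives of the coordinates. -/
theorem fieldCoord_velocity (hγ : ContMDiffWithinAt 𝓘(ℝ, ℝ) 𝓘(ℝ, E) ∞ γ s t)
    (hs : UniqueDiffWithinAt ℝ s t) (hp : γ t ∈ (chartAt E p).source) :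
    fieldCoord p γ (velocity (E := E) γ s) t = derivWithin (curveCoord (E := E) p γ) s t := by
  have h0 := mem_chart_source E (γ t)
  have h1' : fderivWithin ℝ (writtenInExtChartAt 𝓘(ℝ, ℝ) 𝓘(ℝ, E) t γ)
      ((extChartAt 𝓘(ℝ, ℝ) t).symm ⁻¹' s ∩ range 𝓘(ℝ, ℝ)) (extChartAt 𝓘(ℝ, ℝ) t t) =
      fderivWithin ℝ (curveCoord (E := E) (γ t) γ) s t := by
    simp only [mfld_simps]
    rfl
  have h1 : velocity (E := E) γ s t = derivWithin (curveCoord (E := E) (γ t) γ) s t :=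
    (congrArg (fun L : ℝ →L[ℝ] E ↦ L 1)
      ((hγ.mdifferentiableWithinAt (by simp)).mfderivWithin.trans h1')).trans
      fderivWithin_derivWithin
  have h2 : HasDerivWithinAt (curveCoord (E := E) p γ)
      (fderiv ℝ (transition (E := E) (γ t) p) (curveCoord (γ t) γ t)
        (derivWithin (curveCoord (γ t) γ) s t)) s t := by
    refine HasDerivWithinAt.congr_of_eventuallyEq ?_
      (curveCoord_change (q := p) hγ.continuousWithinAt h0)
      (by simp [transition, curveCoord])
    exact ((isLocalIsometryOn_transition (γ t) p).hasFDerivAt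
      (mem_transition_domain h0 hp)).comp_hasDerivWithinAt t (hasDerivWithinAt_curveCoord hγ h0)
  rw [h2.derivWithin hs, ← h1]
  have h3 := tangentCoord_change h0 hp (velocity (E := E) γ s t)
  rw [tangentCoord_self] at h3
  exact h3

theorem isSmoothAlongAt_velocity (hγ : ContMDiffOn 𝓘(ℝ, ℝ) 𝓘(ℝ, E) ∞ γ s)
    (hs : UniqueDiffOn ℝ s) (ht : t ∈ s) : IsSmoothAlongAt γ s (velocity (E := E) γ s) t := by
  have hp := mem_chart_source E (γ t)
  rw [isSmoothAlongAt_iff (hγ t ht) hp]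
  have h1 : ContDiffWithinAt ℝ ∞ (derivWithin (curveCoord (E := E) (γ t) γ) s) s t :=
    ((contDiffWithinAt_curveCoord (hγ t ht) hp).fderivWithin_right hs (m := ∞) (by simp) ht).clm_apply
      contDiffWithinAt_const
  refine h1.congr_of_eventuallyEq ?_ (fieldCoord_velocity (hγ t ht) (hs t ht) hp)
  filter_upwards [eventually_mem_source (hγ t ht).continuousWithinAt hp, self_mem_nhdsWithin]
    with τ h2 hτ using fieldCoord_velocity (hγ τ hτ) (hs τ hτ) h2

/-- In the transformation law of `v' + Γ(c', v)`, the second derivative of the change of chart that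
comes from `v'` cancels the one that comes from `Γ`. -/
theorem covDerivInChart_change {q : M} (hγ : ContMDiffWithinAt 𝓘(ℝ, ℝ) 𝓘(ℝ, E) ∞ γ s t)
    (hs : UniqueDiffWithinAt ℝ s t) (hp : γ t ∈ (chartAt E p).source)
    (hq : γ t ∈ (chartAt E q).source) {V : ∀ t, TangentSpace 𝓘(ℝ, E) (γ t)}
    (hV : IsSmoothAlongAt γ s V t) :
    covDerivInChart q γ s V t = fderiv ℝ (transition (E := E) p q) (curveCoord p γ t)
      (covDerivInChart p γ s V t) := by
  have hiso := isLocalIsometryOn_transition (E := E) p q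
  have hmem : curveCoord p γ t ∈ _ := mem_transition_domain hp hq
  have hc := hasDerivWithinAt_curveCoord hγ hp
  have hv := hV.hasDerivWithinAt hγ hp
  have hγc := hγ.continuousWithinAt
  have h1 : curveCoord (E := E) q γ t = transition p q (curveCoord p γ t) := by
    simp only [transition, curveCoord, Function.comp_apply]
    rw [(extChartAt 𝓘(ℝ, E) p).left_inv (by simpa using hp)]
  have h2 : fieldCoord q γ V t =
    fderiv ℝ (transition (E := E) p q) (curveCoord p γ t) (fieldCoord p γ V t) :=
    tangentCoord_change hp hq _
  have hc' := ((hiso.hasFDerivAt hmem).comp_hasDerivWithinAt t hc).congr_of_eventuallyEq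
    (curveCoord_change hγc hp) h1
  have hv' := (((hiso.hasFDerivAt_fderiv hmem).comp_hasDerivWithinAt t hc).clm_apply
    hv).congr_of_eventuallyEq (fieldCoord_change hγc hp hq V) h2
  rw [covDerivInChart_eq hγc hp, covDerivInChart_eq hγc hq, hc'.derivWithin hs,
    hv'.derivWithin hs, map_add, hiso.fderiv_christoffelForm hmem, h1, h2]
  simp only [Function.comp_apply]
  abel

/-- The covariant derivative, although defined with the chart at `γ t`, can be computed in any
chart. -/
theorem tangentCoord_covDeriv (hγ : ContMDiffWithinAt 𝓘(ℝ, ℝ) 𝓘(ℝ, E) ∞ γ s t)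
    (hs : UniqueDiffWithinAt ℝ s t) (hp : γ t ∈ (chartAt E p).source)
    {V : ∀ t, TangentSpace 𝓘(ℝ, E) (γ t)} (hV : IsSmoothAlongAt γ s V t) :
    tangentCoord p (γ t) (covDeriv γ s V t) = covDerivInChart p γ s V t := by
  have h0 := mem_chart_source E (γ t)
  rw [covDerivInChart_change hγ hs h0 hp hV, tangentCoord_change h0 hp, tangentCoord_self]
  rfl

/-- The Levi-Civita connection is compatible with the metric, along curves. -/
theorem hasDerivWithinAt_inner (hγ : ContMDiffWithinAt 𝓘(ℝ, ℝ) 𝓘(ℝ, E) ∞ γ s t)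
    (hs : UniqueDiffWithinAt ℝ s t) (ht : t ∈ s) {V W : ∀ t, TangentSpace 𝓘(ℝ, E) (γ t)}
    (hV : IsSmoothAlongAt γ s V t) (hW : IsSmoothAlongAt γ s W t) :
    HasDerivWithinAt (fun τ ↦ ⟪V τ, W τ⟫_ℝ)
      (⟪covDeriv γ s V t, W t⟫_ℝ + ⟪V t, covDeriv γ s W t⟫_ℝ) s t := by
  have hp := mem_chart_source E (γ t)
  have hm := isMetricOn_metricInChart (E := E) (γ t)
  have hy : curveCoord (γ t) γ t ∈ (extChartAt 𝓘(ℝ, E) (γ t)).target := mem_extChartAt_target _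
  have hc := hasDerivWithinAt_curveCoord hγ hp
  have hg := (((hm.hasFDerivAt hy).comp_hasDerivWithinAt t hc).clm_apply
    (hV.hasDerivWithinAt hγ hp)).clm_apply (hW.hasDerivWithinAt hγ hp)
  have heq : (fun τ ↦ ⟪V τ, W τ⟫_ℝ) =ᶠ[𝓝[s] t] fun τ ↦
      metricInChart (γ t) (curveCoord (γ t) γ τ) (fieldCoord (γ t) γ V τ)
        (fieldCoord (γ t) γ W τ) := by
    filter_upwards [eventually_mem_source hγ.continuousWithinAt hp] with τ hτ
      using inner_eq_metricInChart hτ _ _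
  refine (hg.congr_of_eventuallyEq_of_mem heq ht).congr_deriv ?_
  have e1 : ⟪covDeriv γ s V t, W t⟫_ℝ = metricInChart (γ t) (curveCoord (γ t) γ t)
      (covDerivInChart (γ t) γ s V t) (fieldCoord (γ t) γ W t) := by
    rw [inner_eq_metricInChart hp, tangentCoord_covDeriv hγ hs hp hV]; rfl
  have e2 : ⟪V t, covDeriv γ s W t⟫_ℝ = metricInChart (γ t) (curveCoord (γ t) γ t)
      (fieldCoord (γ t) γ V t) (covDerivInChart (γ t) γ s W t) := by
    rw [inner_eq_metricInChart hp, tangentCoord_covDeriv hγ hs hp hW]; rfl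
  rw [e1, e2, covDerivInChart_eq hγ.continuousWithinAt hp,
    covDerivInChart_eq hγ.continuousWithinAt hp]
  simp only [map_add, add_apply, Function.comp_apply, hm.fderiv_eq hy]
  ring

omit [FiniteDimensional ℝ E]
  [IsContMDiffRiemannianBundle 𝓘(ℝ, E) ∞ E (fun x : M ↦ TangentSpace 𝓘(ℝ, E) x)] in
theorem covDeriv_congr (hγ : ContinuousWithinAt γ s t) (ht : t ∈ s)
    {V W : ∀ t, TangentSpace 𝓘(ℝ, E) (γ t)} (h : ∀ᶠ τ in 𝓝[s] t, V τ = W τ) :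
    covDeriv γ s V t = covDeriv γ s W t := by
  have hp := mem_chart_source E (γ t)
  have h1 : fieldCoord (γ t) γ V =ᶠ[𝓝[s] t] fieldCoord (γ t) γ W := by
    filter_upwards [h] with τ hτ
    rw [fieldCoord, fieldCoord, hτ]
  have h2 := h1.eq_of_nhdsWithin ht
  refine (covDerivInChart_eq hγ hp V).trans (Eq.trans ?_ (covDerivInChart_eq hγ hp W).symm)
  rw [h1.derivWithin_eq h2, h2]

omit [RiemannianBundle (fun x : M ↦ TangentSpace 𝓘(ℝ, E) x)] [FiniteDimensional ℝ E]
  [IsContMDiffRiemannianBundle 𝓘(ℝ, E) ∞ E (fun x : M ↦ TangentSpace 𝓘(ℝ, E) x)] in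
theorem IsSmoothAlongAt.congr (hV' : ContMDiffWithinAt 𝓘(ℝ, ℝ) 𝓘(ℝ, E) ∞ γ s t) (ht : t ∈ s)
    {V W : ∀ t, TangentSpace 𝓘(ℝ, E) (γ t)} (hW : IsSmoothAlongAt γ s W t)
    (h : ∀ᶠ τ in 𝓝[s] t, V τ = W τ) : IsSmoothAlongAt γ s V t := by
  have hp := mem_chart_source E (γ t)
  rw [isSmoothAlongAt_iff hV' hp] at hW ⊢
  have h1 : fieldCoord (γ t) γ V =ᶠ[𝓝[s] t] fieldCoord (γ t) γ W := by
    filter_upwards [h] with τ hτ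
    rw [fieldCoord, fieldCoord, hτ]
  exact hW.congr_of_eventuallyEq h1 (h1.eq_of_nhdsWithin ht)

omit [FiniteDimensional ℝ E]
  [IsContMDiffRiemannianBundle 𝓘(ℝ, E) ∞ E (fun x : M ↦ TangentSpace 𝓘(ℝ, E) x)] in
/-- The covariant derivative may be computed on a smaller interval. -/
theorem covDeriv_mono {s' : Set ℝ} (hγ : ContMDiffWithinAt 𝓘(ℝ, ℝ) 𝓘(ℝ, E) ∞ γ s t)
    (hss : s' ⊆ s) (hs' : UniqueDiffWithinAt ℝ s' t) {V : ∀ t, TangentSpace 𝓘(ℝ, E) (γ t)}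
    (hV : IsSmoothAlongAt γ s V t) : covDeriv γ s' V t = covDeriv γ s V t := by
  have hp := mem_chart_source E (γ t)
  refine (covDerivInChart_eq (hγ.continuousWithinAt.mono hss) hp V).trans
    (Eq.trans ?_ (covDerivInChart_eq hγ.continuousWithinAt hp V).symm)
  rw [((hV.hasDerivWithinAt hγ hp).mono hss).derivWithin hs',
    ((hasDerivWithinAt_curveCoord hγ hp).mono hss).derivWithin hs']

omit [RiemannianBundle (fun x : M ↦ TangentSpace 𝓘(ℝ, E) x)] [FiniteDimensional ℝ E]
  [IsContMDiffRiemannianBundle 𝓘(ℝ, E) ∞ E (fun x : M ↦ TangentSpace 𝓘(ℝ, E) x)] in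
theorem isSmoothAlongAt_sum (hγ : ContMDiffWithinAt 𝓘(ℝ, ℝ) 𝓘(ℝ, E) ∞ γ s t)
    {ι : Type*} [Fintype ι] {c : ι → ℝ → ℝ} {V : ι → ∀ t, TangentSpace 𝓘(ℝ, E) (γ t)}
    (hc : ∀ i, ContDiffWithinAt ℝ ∞ (c i) s t) (hV : ∀ i, IsSmoothAlongAt γ s (V i) t) :
    IsSmoothAlongAt γ s (fun τ ↦ ∑ i, c i τ • V i τ) t := by
  have hp := mem_chart_source E (γ t)
  rw [isSmoothAlongAt_iff hγ hp]
  have h1 : ContDiffWithinAt ℝ ∞ (fun τ ↦ ∑ i, c i τ • fieldCoord (γ t) γ (V i) τ) s t :=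
    ContDiffWithinAt.sum fun i _ ↦ (hc i).smul ((isSmoothAlongAt_iff hγ hp).1 (hV i))
  have h2 : fieldCoord (γ t) γ (fun τ ↦ ∑ i, c i τ • V i τ) =
      fun τ ↦ ∑ i, c i τ • fieldCoord (γ t) γ (V i) τ := by
    funext τ
    simp only [fieldCoord]
    rw [map_sum]
    simp only [map_smul]
  rw [h2]
  exact h1

/-- The curvature tensor is smooth: in a chart it is a polynomial in the Christoffel symbols and
their derivatives. -/
theorem isSmoothAlongAt_curvature (hγ : ContMDiffWithinAt 𝓘(ℝ, ℝ) 𝓘(ℝ, E) ∞ γ s t)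
    {U V W : ∀ t, TangentSpace 𝓘(ℝ, E) (γ t)} (hU : IsSmoothAlongAt γ s U t)
    (hV : IsSmoothAlongAt γ s V t) (hW : IsSmoothAlongAt γ s W t) :
    IsSmoothAlongAt γ s (fun τ ↦ curvature (γ τ) (U τ) (V τ) (W τ)) t := by
  have hp := mem_chart_source E (γ t)
  have hm := isMetricOn_metricInChart (E := E) (γ t)
  have hy : curveCoord (γ t) γ t ∈ (extChartAt 𝓘(ℝ, E) (γ t)).target := mem_extChartAt_target _
  rw [isSmoothAlongAt_iff hγ hp] at hU hV hW ⊢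
  have hc := contDiffWithinAt_curveCoord hγ hp
  have hΓ' : ContDiffAt ℝ ∞ (christoffelForm (metricInChart (E := E) (γ t)))
      (curveCoord (γ t) γ t) := hm.contDiffOn_christoffelForm.contDiffAt (hm.isOpen.mem_nhds hy)
  have hdΓ := (hΓ'.fderiv_right (m := ∞) (by simp)).comp_contDiffWithinAt t hc
  have hΓ := hΓ'.comp_contDiffWithinAt t hc
  have h1 : ContDiffWithinAt ℝ ∞ (fun τ ↦ curvatureForm
      (christoffelForm (metricInChart (E := E) (γ t))) (curveCoord (γ t) γ τ)
      (fieldCoord (γ t) γ U τ) (fieldCoord (γ t) γ V τ) (fieldCoord (γ t) γ W τ)) s t :=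
    (((((hdΓ.clm_apply hU).clm_apply hV).clm_apply hW).sub
      (((hdΓ.clm_apply hV).clm_apply hU).clm_apply hW)).add
      ((hΓ.clm_apply hU).clm_apply ((hΓ.clm_apply hV).clm_apply hW))).sub
      ((hΓ.clm_apply hV).clm_apply ((hΓ.clm_apply hU).clm_apply hW))
  refine h1.congr_of_eventuallyEq ?_ (tangentCoord_curvature hp _ _ _)
  filter_upwards [eventually_mem_source hγ.continuousWithinAt hp] with τ hτ
    using tangentCoord_curvature hτ _ _ _

end FieldsAlongCurves

/-! ### Parallel fields -/

section ParallelTransport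

-- the instances on iterated spaces of continuous linear maps are nested deeply
set_option maxSynthPendingDepth 3

variable {E : Type*} [NormedAddCommGroup E] [NormedSpace ℝ E] [FiniteDimensional ℝ E]
  {M : Type*} [TopologicalSpace M] [ChartedSpace E M] [IsManifold 𝓘(ℝ, E) ∞ M]
  [RiemannianBundle (fun x : M ↦ TangentSpace 𝓘(ℝ, E) x)]
  [IsContMDiffRiemannianBundle 𝓘(ℝ, E) ∞ E (fun x : M ↦ TangentSpace 𝓘(ℝ, E) x)]
  {γ : ℝ → M} {l : ℝ}

/-- `V` is smooth with vanishing covariant derivative at the time `t`. -/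
def IsParallelAt (γ : ℝ → M) (s : Set ℝ) (V : ∀ t, TangentSpace 𝓘(ℝ, E) (γ t)) (t : ℝ) : Prop :=
  IsSmoothAlongAt γ s V t ∧ covDeriv γ s V t = 0

omit [FiniteDimensional ℝ E]
  [IsContMDiffRiemannianBundle 𝓘(ℝ, E) ∞ E (fun x : M ↦ TangentSpace 𝓘(ℝ, E) x)] in
theorem IsParallelAt.congr {s : Set ℝ} {t : ℝ} (hγ : ContMDiffOn 𝓘(ℝ, ℝ) 𝓘(ℝ, E) ∞ γ s)
    (ht : t ∈ s) {V W : ∀ t, TangentSpace 𝓘(ℝ, E) (γ t)} (hW : IsParallelAt γ s W t)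
    (h : ∀ᶠ τ in 𝓝[s] t, V τ = W τ) : IsParallelAt γ s V t :=
  ⟨hW.1.congr (hγ t ht) ht h, (covDeriv_congr (hγ t ht).continuousWithinAt ht h).trans hW.2⟩

theorem IsParallelAt.inner_eq {s J : Set ℝ} (hγ : ContMDiffOn 𝓘(ℝ, ℝ) 𝓘(ℝ, E) ∞ γ s)
    (hs : UniqueDiffOn ℝ s) (hJs : J ⊆ s) (hJ : Convex ℝ J)
    {V W : ∀ t, TangentSpace 𝓘(ℝ, E) (γ t)} (hV : ∀ t ∈ J, IsParallelAt γ s V t)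
    (hW : ∀ t ∈ J, IsParallelAt γ s W t) {a b : ℝ} (ha : a ∈ J) (hb : b ∈ J) :
    ⟪V a, W a⟫_ℝ = ⟪V b, W b⟫_ℝ := by
  have h : ∀ t ∈ J, HasDerivWithinAt (fun τ ↦ ⟪V τ, W τ⟫_ℝ) 0 J t := fun t ht ↦ by
    have := (hasDerivWithinAt_inner (hγ t (hJs ht)) (hs t (hJs ht)) (hJs ht) (hV t ht).1
      (hW t ht).1).mono hJs
    rwa [(hV t ht).2, (hW t ht).2, inner_zero_left, inner_zero_right, add_zero] at this
  have := hJ.norm_image_sub_le_of_norm_hasDerivWithin_le (C := 0) h (by simp) hb ha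
  rw [zero_mul, norm_le_zero_iff, sub_eq_zero] at this
  exact this

/-- A parallel field is determined by one of its values. -/
theorem IsParallelAt.unique {s J : Set ℝ} (hγ : ContMDiffOn 𝓘(ℝ, ℝ) 𝓘(ℝ, E) ∞ γ s)
    (hs : UniqueDiffOn ℝ s) (hJs : J ⊆ s) (hJ : Convex ℝ J)
    {V W : ∀ t, TangentSpace 𝓘(ℝ, E) (γ t)} (hV : ∀ t ∈ J, IsParallelAt γ s V t)
    (hW : ∀ t ∈ J, IsParallelAt γ s W t) {a b : ℝ} (ha : a ∈ J) (hb : b ∈ J) (h : V a = W a) :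
    V b = W b := by
  have h1 := inner_eq hγ hs hJs hJ hV hV ha hb
  have h2 := inner_eq hγ hs hJs hJ hV hW ha hb
  have h3 := inner_eq hγ hs hJs hJ hW hW ha hb
  rw [← sub_eq_zero, ← norm_eq_zero, ← sq_eq_zero_iff, @norm_sub_sq_real,
    ← real_inner_self_eq_norm_sq, ← real_inner_self_eq_norm_sq, ← h1, ← h2, ← h3, h]
  ring

/-- Near `t₀`, parallel fields with a prescribed value at any nearby time `s` exist on an interval
that does not depend on `s`: in the chart at `γ t₀` they solve the linear equation
`v' = -Γ(c', v)`. -/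
theorem exists_parallel_near (hl : 0 < l) (hγ : ContMDiffOn 𝓘(ℝ, ℝ) 𝓘(ℝ, E) ∞ γ (Icc 0 l))
    {t₀ : ℝ} (ht₀ : t₀ ∈ Icc 0 l) : ∃ ε > 0, ∀ s ∈ Icc 0 l ∩ Ioo (t₀ - ε) (t₀ + ε),
      ∀ w : TangentSpace 𝓘(ℝ, E) (γ s), ∃ V : ∀ t, TangentSpace 𝓘(ℝ, E) (γ t), V s = w ∧
        ∀ t ∈ Icc 0 l ∩ Ioo (t₀ - ε) (t₀ + ε), IsParallelAt γ (Icc 0 l) V t := by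
  have hI := uniqueDiffOn_Icc hl
  set p := γ t₀
  have hm := isMetricOn_metricInChart (E := E) p
  obtain ⟨ε, hε, hsub⟩ := Metric.mem_nhdsWithin_iff.1
    (eventually_mem_source (hγ t₀ ht₀).continuousWithinAt (mem_chart_source E p))
  have hsrc : ∀ t ∈ Icc 0 l, |t - t₀| < ε → γ t ∈ (chartAt E p).source := fun t ht h ↦
    hsub ⟨by rwa [Metric.mem_ball, Real.dist_eq], ht⟩
  refine ⟨ε / 2, half_pos hε, fun s hs w ↦ ?_⟩
  set a := max 0 (t₀ - ε / 2) with ha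
  set b := min l (t₀ + ε / 2) with hb
  have hab : a < b := by
    rw [ha, hb, max_lt_iff, lt_min_iff, lt_min_iff]
    exact ⟨⟨hl, by linarith [ht₀.1]⟩, by linarith [ht₀.2], by linarith⟩
  have hJ : ∀ t, t ∈ Icc a b ↔ t ∈ Icc 0 l ∧ t ∈ Icc (t₀ - ε / 2) (t₀ + ε / 2) := fun t ↦ by
    simp only [mem_Icc, ha, hb, max_le_iff, le_min_iff]
    tauto
  have hJI : Icc a b ⊆ Icc 0 l := fun t ht ↦ ((hJ t).1 ht).1
  have hJsrc : ∀ t ∈ Icc a b, γ t ∈ (chartAt E p).source := fun t ht ↦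
    hsrc t (hJI ht) (by
      have := ((hJ t).1 ht).2
      rw [abs_lt]
      constructor <;> linarith [this.1, this.2])
  have hoJ : ∀ t ∈ Icc 0 l ∩ Ioo (t₀ - ε / 2) (t₀ + ε / 2), t ∈ Icc a b := fun t ht ↦
    (hJ t).2 ⟨ht.1, Ioo_subset_Icc_self ht.2⟩
  have hnhds : ∀ t ∈ Icc 0 l ∩ Ioo (t₀ - ε / 2) (t₀ + ε / 2), Icc a b ∈ 𝓝[Icc 0 l] t := by
    intro t ht
    filter_upwards [self_mem_nhdsWithin, mem_nhdsWithin_of_mem_nhds (Ioo_mem_nhds ht.2.1 ht.2.2)]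
      with τ h1 h2 using hoJ τ ⟨h1, h2⟩
  let A : ℝ → E →L[ℝ] E := fun τ ↦ -christoffelForm (metricInChart (E := E) p) (curveCoord p γ τ)
    (derivWithin (curveCoord p γ) (Icc 0 l) τ)
  have hA : ContDiffOn ℝ ∞ A (Icc a b) := by
    intro t ht
    have hc := contDiffWithinAt_curveCoord (hγ t (hJI ht)) (hJsrc t ht)
    have hc' : ContDiffWithinAt ℝ ∞ (derivWithin (curveCoord (E := E) p γ) (Icc 0 l)) (Icc 0 l) t :=
      (hc.fderivWithin_right hI (m := ∞) (by simp) (hJI ht)).clm_apply contDiffWithinAt_const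
    have hy : curveCoord p γ t ∈ (extChartAt 𝓘(ℝ, E) p).target :=
      (extChartAt 𝓘(ℝ, E) p).map_source (by simpa using hJsrc t ht)
    have hΓ := (hm.contDiffOn_christoffelForm.contDiffAt
      (hm.isOpen.mem_nhds hy)).comp_contDiffWithinAt t hc
    exact ((hΓ.clm_apply hc').neg).mono hJI
  have hsJ := hoJ s hs
  obtain ⟨v, hv0, hv⟩ := exists_linearODE hA.continuousOn hsJ (tangentCoord p (γ s) w)
  have hvs := contDiffOn_of_linearODE (uniqueDiffOn_Icc hab) hA hv
  let V : ∀ t, TangentSpace 𝓘(ℝ, E) (γ t) := fun t ↦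
    (trivializationAt E (TangentSpace 𝓘(ℝ, E) : M → Type _) p).symmL ℝ (γ t) (v t)
  have hVv : ∀ t ∈ Icc a b, fieldCoord p γ V t = v t := fun t ht ↦ tangentCoord_symmL (hJsrc t ht) _
  refine ⟨V, ?_, fun t ht ↦ ?_⟩
  · change (trivializationAt E (TangentSpace 𝓘(ℝ, E) : M → Type _) p).symmL ℝ (γ s) (v s) = w
    rw [hv0]
    exact symmL_tangentCoord (hJsrc s hsJ) w
  have htJ := hoJ t ht
  have heq : fieldCoord p γ V =ᶠ[𝓝[Icc 0 l] t] v := by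
    filter_upwards [hnhds t ht] with τ hτ using hVv τ hτ
  have hsm : IsSmoothAlongAt γ (Icc 0 l) V t := by
    rw [isSmoothAlongAt_iff (hγ t ht.1) (hJsrc t htJ)]
    exact ((hvs t htJ).mono_of_mem_nhdsWithin (hnhds t ht)).congr_of_eventuallyEq heq (hVv t htJ)
  refine ⟨hsm, tangentCoord_injective (hJsrc t htJ) ?_⟩
  rw [tangentCoord_covDeriv (hγ t ht.1) (hI t ht.1) (hJsrc t htJ) hsm,
    covDerivInChart_eq (hγ t ht.1).continuousWithinAt (hJsrc t htJ), map_zero,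
    heq.derivWithin_eq (hVv t htJ), hVv t htJ,
    ((hv t htJ).mono_of_mem_nhdsWithin (hnhds t ht)).derivWithin (hI t ht.1)]
  exact neg_add_cancel _

/-- Parallel transport exists along the whole of a smooth curve. -/
theorem exists_parallel (hl : 0 < l) (hγ : ContMDiffOn 𝓘(ℝ, ℝ) 𝓘(ℝ, E) ∞ γ (Icc 0 l))
    (w : TangentSpace 𝓘(ℝ, E) (γ 0)) : ∃ V : ∀ t, TangentSpace 𝓘(ℝ, E) (γ t), V 0 = w ∧
      ∀ t ∈ Icc 0 l, IsParallelAt γ (Icc 0 l) V t := by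
  have hI := uniqueDiffOn_Icc hl
  let S : Set ℝ := {τ | τ ≤ l + 1 ∧ ∃ V : ∀ t, TangentSpace 𝓘(ℝ, E) (γ t), V 0 = w ∧
      ∀ t ∈ Icc 0 l, t < τ → IsParallelAt γ (Icc 0 l) V t}
  have hSb : BddAbove S := ⟨l + 1, fun τ hτ ↦ hτ.1⟩
  have h0 : ∃ τ ∈ S, 0 < τ := by
    obtain ⟨ε, hε, h⟩ := exists_parallel_near hl hγ (left_mem_Icc.2 hl.le)
    obtain ⟨V, hV, hV'⟩ := h 0 ⟨left_mem_Icc.2 hl.le, by constructor <;> linarith⟩ w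
    refine ⟨min ε (l + 1), ⟨min_le_right _ _, V, hV, fun t ht htε ↦ hV' t ⟨ht, ?_⟩⟩,
      lt_min hε (by linarith)⟩
    exact ⟨by linarith [ht.1], by linarith [min_le_left ε (l + 1)]⟩
  obtain ⟨τ₀, hτ₀, hτ₀0⟩ := h0
  set σ := sSup S
  have hσ0 : 0 < σ := hτ₀0.trans_le (le_csSup hSb hτ₀)
  -- if the supremum of the times up to which the parallel field exists exceeds `l`, it is defined
  -- on the whole interval
  by_cases hσl : l < σ
  · obtain ⟨τ, ⟨-, V, hV, hV'⟩, hτ⟩ := exists_lt_of_lt_csSup ⟨τ₀, hτ₀⟩ hσl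
    exact ⟨V, hV, fun t ht ↦ hV' t ht (ht.2.trans_lt hτ)⟩
  push Not at hσl
  exfalso
  obtain ⟨ε, hε, hloc⟩ := exists_parallel_near hl hγ ⟨hσ0.le, hσl⟩
  obtain ⟨τ, ⟨hτl, V₁, hV₁, hV₁'⟩, hτ⟩ := exists_lt_of_lt_csSup ⟨τ₀, hτ₀⟩
    (show max 0 (σ - ε) < σ from max_lt hσ0 (by linarith))
  have hτσ : τ ≤ σ := le_csSup hSb ⟨hτl, V₁, hV₁, hV₁'⟩
  obtain ⟨s, hs1, hs2⟩ := exists_between hτ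
  obtain ⟨hs0, hsε⟩ := max_lt_iff.1 hs1
  have hsI : s ∈ Icc 0 l := ⟨hs0.le, by linarith⟩
  obtain ⟨V₂, hV₂, hV₂'⟩ := hloc s ⟨hsI, hsε, by linarith⟩ (V₁ s)
  have hagree : ∀ t ∈ Icc 0 l ∩ Ioo (σ - ε) τ, V₁ t = V₂ t := fun t ht ↦
    IsParallelAt.unique hγ hI inter_subset_left ((convex_Icc 0 l).inter (convex_Ioo (σ - ε) τ))
      (fun r hr ↦ hV₁' r hr.1 hr.2.2)
      (fun r hr ↦ hV₂' r ⟨hr.1, hr.2.1, hr.2.2.trans_le (by linarith)⟩)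
      ⟨hsI, hsε, hs2⟩ ht hV₂.symm
  let V : ∀ t, TangentSpace 𝓘(ℝ, E) (γ t) := fun t ↦ if t < τ then V₁ t else V₂ t
  have hmem : min (σ + ε) (l + 1) ∈ S := by
    refine ⟨min_le_right _ _, V, (if_pos (hs0.trans hs2)).trans hV₁, fun t ht htσ ↦ ?_⟩
    have htσ' := htσ.trans_le (min_le_left _ _)
    by_cases htτ : t < τ
    · refine (hV₁' t ht htτ).congr hγ ht ?_
      filter_upwards [mem_nhdsWithin_of_mem_nhds (Iio_mem_nhds htτ)] with r hr using if_pos hr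
    · push Not at htτ
      refine (hV₂' t ⟨ht, by linarith [max_lt_iff.1 hτ], htσ'⟩).congr hγ ht ?_
      filter_upwards [mem_nhdsWithin_of_mem_nhds
        (Ioi_mem_nhds ((max_lt_iff.1 hτ).2.trans_le htτ)), self_mem_nhdsWithin] with r hr hrI
      by_cases hrτ : r < τ
      · exact (if_pos hrτ).trans (hagree r ⟨hrI, hr, hrτ⟩)
      · exact if_neg hrτ
  have := le_csSup hSb hmem
  rcases min_le_iff.1 this with h | h <;> linarith

end ParallelTransport

/-! ### Parallel transport of normal vectors along a geodesic -/

section NormalTransport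

-- the instances on iterated spaces of continuous linear maps are nested deeply
set_option maxSynthPendingDepth 3

variable {E : Type*} [NormedAddCommGroup E] [NormedSpace ℝ E] [FiniteDimensional ℝ E]
  {M : Type*} [TopologicalSpace M] [ChartedSpace E M] [IsManifold 𝓘(ℝ, E) ∞ M]
  [RiemannianBundle (fun x : M ↦ TangentSpace 𝓘(ℝ, E) x)]
  [IsContMDiffRiemannianBundle 𝓘(ℝ, E) ∞ E (fun x : M ↦ TangentSpace 𝓘(ℝ, E) x)]
  {γ : ℝ → M} {l : ℝ}

omit [FiniteDimensional ℝ E]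
  [IsContMDiffRiemannianBundle 𝓘(ℝ, E) ∞ E (fun x : M ↦ TangentSpace 𝓘(ℝ, E) x)] in
theorem covDeriv_sum {s : Set ℝ} {t : ℝ} (hγ : ContMDiffWithinAt 𝓘(ℝ, ℝ) 𝓘(ℝ, E) ∞ γ s t)
    (hs : UniqueDiffWithinAt ℝ s t) {ι : Type*} [Fintype ι] {c : ι → ℝ → ℝ} {c' : ι → ℝ}
    {V : ι → ∀ t, TangentSpace 𝓘(ℝ, E) (γ t)} (hc : ∀ i, HasDerivWithinAt (c i) (c' i) s t)
    (hV : ∀ i, IsSmoothAlongAt γ s (V i) t) :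
    covDeriv γ s (fun τ ↦ ∑ i, c i τ • V i τ) t =
      ∑ i, (c' i • V i t + c i t • covDeriv γ s (V i) t) := by
  have hp := mem_chart_source E (γ t)
  have h1 : HasDerivWithinAt (fun τ ↦ ∑ i, c i τ • fieldCoord (γ t) γ (V i) τ)
      (∑ i, (c i t • derivWithin (fieldCoord (γ t) γ (V i)) s t
        + c' i • fieldCoord (γ t) γ (V i) t)) s t :=
    HasDerivWithinAt.fun_sum fun i _ ↦ (hc i).smul ((hV i).hasDerivWithinAt hγ hp)
  have h2 : fieldCoord (γ t) γ (fun τ ↦ ∑ i, c i τ • V i τ) =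
      fun τ ↦ ∑ i, c i τ • fieldCoord (γ t) γ (V i) τ := by
    funext τ
    simp only [fieldCoord]
    rw [map_sum]
    simp only [map_smul]
  refine tangentCoord_injective hp ?_
  rw [tangentCoord_self]
  refine (covDerivInChart_eq hγ.continuousWithinAt hp _).trans ?_
  rw [h2, h1.derivWithin hs, map_sum, map_sum, ← Finset.sum_add_distrib]
  refine Finset.sum_congr rfl fun i _ ↦ ?_
  rw [map_add, map_smul, map_smul, map_smul]
  have h3 : tangentCoord (γ t) (γ t) (covDeriv γ s (V i) t) = covDerivInChart (γ t) γ s (V i) t :=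
    tangentCoord_self _ _
  rw [h3, covDerivInChart_eq hγ.continuousWithinAt hp, fieldCoord, smul_add]
  abel

theorem isSmoothAlongAt_covDeriv {s : Set ℝ} {t : ℝ} (hγ : ContMDiffOn 𝓘(ℝ, ℝ) 𝓘(ℝ, E) ∞ γ s)
    (hs : UniqueDiffOn ℝ s) {V : ∀ t, TangentSpace 𝓘(ℝ, E) (γ t)}
    (hV : IsSmoothAlong γ s V) (ht : t ∈ s) : IsSmoothAlongAt γ s (covDeriv γ s V) t := by
  have hp := mem_chart_source E (γ t)
  have hm := isMetricOn_metricInChart (E := E) (γ t)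
  have hy : curveCoord (γ t) γ t ∈ (extChartAt 𝓘(ℝ, E) (γ t)).target := mem_extChartAt_target _
  rw [isSmoothAlongAt_iff (hγ t ht) hp]
  have hv := (isSmoothAlongAt_iff (hγ t ht) hp).1 (hV t ht)
  have hc := contDiffWithinAt_curveCoord (hγ t ht) hp
  have hΓ := (hm.contDiffOn_christoffelForm.contDiffAt
    (hm.isOpen.mem_nhds hy)).comp_contDiffWithinAt t hc
  have hd : ∀ {f : ℝ → E}, ContDiffWithinAt ℝ ∞ f s t →
      ContDiffWithinAt ℝ ∞ (derivWithin f s) s t := fun hf ↦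
    (hf.fderivWithin_right hs (m := ∞) (by simp) ht).clm_apply contDiffWithinAt_const
  have key : ∀ τ ∈ s, γ τ ∈ (chartAt E (γ t)).source → fieldCoord (γ t) γ (covDeriv γ s V) τ =
      derivWithin (fieldCoord (γ t) γ V) s τ + christoffelForm (metricInChart (γ t))
        (curveCoord (γ t) γ τ) (derivWithin (curveCoord (γ t) γ) s τ) (fieldCoord (γ t) γ V τ) :=
    fun τ hτ h ↦ (tangentCoord_covDeriv (hγ τ hτ) (hs τ hτ) h (hV τ hτ)).trans
      (covDerivInChart_eq (hγ τ hτ).continuousWithinAt h V)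
  refine ((hd hv).add ((hΓ.clm_apply (hd hc)).clm_apply hv)).congr_of_eventuallyEq ?_ (key t ht hp)
  filter_upwards [eventually_mem_source (hγ t ht).continuousWithinAt hp, self_mem_nhdsWithin]
    with τ h1 h2 using key τ h2 h1

omit [FiniteDimensional ℝ E] in
theorem contDiffWithinAt_inner {s : Set ℝ} {t : ℝ} {V W : ∀ t, TangentSpace 𝓘(ℝ, E) (γ t)}
    (hV : IsSmoothAlongAt γ s V t) (hW : IsSmoothAlongAt γ s W t) :
    ContDiffWithinAt ℝ ∞ (fun τ ↦ ⟪V τ, W τ⟫_ℝ) s t :=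
  contMDiffWithinAt_iff_contDiffWithinAt.1
    (ContMDiffWithinAt.inner_bundle (F := E) (E := fun x : M ↦ TangentSpace 𝓘(ℝ, E) x) hV hW)

instance finiteDimensional_tangentSpace (x : M) : FiniteDimensional ℝ (TangentSpace 𝓘(ℝ, E) x) :=
  inferInstanceAs (FiniteDimensional ℝ E)

theorem IsNormalGeodesic.isParallelAt_velocity (hl : 0 < l)
    (hγ : IsNormalGeodesic (E := E) γ (Icc 0 l)) {t : ℝ} (ht : t ∈ Icc 0 l) :
    IsParallelAt γ (Icc 0 l) (velocity (E := E) γ (Icc 0 l)) t :=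
  ⟨isSmoothAlongAt_velocity hγ.smooth (uniqueDiffOn_Icc hl) ht, hγ.geodesic t ht⟩

/-- `P` is the parallel transport of normal vectors along the unit speed geodesic `γ`: `P t` maps
`γ'(0)^⊥` isometrically onto `γ'(t)^⊥`, and `t ↦ P t x` is parallel. -/
structure IsNormalTransport (γ : ℝ → M) (l : ℝ)
    (P : ∀ t, normalSpace (E := E) γ (Icc 0 l) 0 →ₗ[ℝ] TangentSpace 𝓘(ℝ, E) (γ t)) : Prop where
  map_zero_time : ∀ x, P 0 x = x
  inner_map : ∀ t ∈ Icc 0 l, ∀ x y, ⟪P t x, P t y⟫_ℝ = ⟪x, y⟫_ℝ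
  normal : ∀ t ∈ Icc 0 l, ∀ x, ⟪P t x, velocity γ (Icc 0 l) t⟫_ℝ = 0
  surjective : ∀ t ∈ Icc 0 l, ∀ w : TangentSpace 𝓘(ℝ, E) (γ t),
    ⟪w, velocity γ (Icc 0 l) t⟫_ℝ = 0 → ∃ x, P t x = w
  parallel : ∀ t ∈ Icc 0 l, ∀ x, IsParallelAt γ (Icc 0 l) (fun τ ↦ P τ x) t

omit [FiniteDimensional ℝ E]
  [IsContMDiffRiemannianBundle 𝓘(ℝ, E) ∞ E (fun x : M ↦ TangentSpace 𝓘(ℝ, E) x)] in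
theorem IsNormalGeodesic.finrank_normalSpace {t : ℝ} {n : ℕ} (hn : Module.finrank ℝ E = n + 1)
    (hγ : IsNormalGeodesic (E := E) γ (Icc 0 l)) (ht : t ∈ Icc 0 l) :
    Module.finrank ℝ (normalSpace (E := E) γ (Icc 0 l) t) = n := by
  have : Fact (Module.finrank ℝ (TangentSpace 𝓘(ℝ, E) (γ t)) = n + 1) := ⟨hn⟩
  refine Submodule.finrank_orthogonal_span_singleton fun h ↦ ?_
  have := hγ.unit_speed t ht
  rw [h, norm_zero] at this
  exact zero_ne_one this

theorem IsNormalGeodesic.exists_isNormalTransport (hl : 0 < l)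
    (hγ : IsNormalGeodesic (E := E) γ (Icc 0 l)) :
    ∃ P : ∀ t, normalSpace (E := E) γ (Icc 0 l) 0 →ₗ[ℝ] TangentSpace 𝓘(ℝ, E) (γ t),
      IsNormalTransport γ l P := by
  have hI := uniqueDiffOn_Icc hl
  have h0 : (0 : ℝ) ∈ Icc 0 l := left_mem_Icc.2 hl.le
  let b := stdOrthonormalBasis ℝ (normalSpace (E := E) γ (Icc 0 l) 0)
  choose F hF0 hF using fun i ↦ exists_parallel hl hγ.smooth
    (b i : TangentSpace 𝓘(ℝ, E) (γ 0))
  let P : ∀ t, normalSpace (E := E) γ (Icc 0 l) 0 →ₗ[ℝ] TangentSpace 𝓘(ℝ, E) (γ t) :=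
    fun t ↦ ∑ i, ((innerₗ _ (b i)).smulRight (F i t))
  have hPx : ∀ t x, P t x = ∑ i, ⟪b i, x⟫_ℝ • F i t := fun t x ↦ by
    simp [P, LinearMap.sum_apply]
  have hP0 : ∀ x, P 0 x = x := fun x ↦ by
    rw [hPx]
    conv_rhs => rw [← b.sum_repr' x]
    rw [Submodule.coe_sum]
    exact Finset.sum_congr rfl fun i _ ↦ by rw [hF0]; rfl
  have hpar : ∀ t ∈ Icc 0 l, ∀ x, IsParallelAt γ (Icc 0 l) (fun τ ↦ P τ x) t := by
    intro t ht x
    have h1 : (fun τ ↦ P τ x) = fun τ ↦ ∑ i, (fun _ : ℝ ↦ ⟪b i, x⟫_ℝ) τ • F i τ :=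
      funext fun τ ↦ hPx τ x
    rw [h1]
    refine ⟨isSmoothAlongAt_sum (hγ.smooth t ht) (fun i ↦ contDiffWithinAt_const)
      fun i ↦ (hF i t ht).1, ?_⟩
    rw [covDeriv_sum (hγ.smooth t ht) (hI t ht) (fun i ↦ hasDerivWithinAt_const _ _ _)
      fun i ↦ (hF i t ht).1]
    exact Finset.sum_eq_zero fun i _ ↦ by rw [(hF i t ht).2, zero_smul, smul_zero, add_zero]
  have hin : ∀ t ∈ Icc 0 l, ∀ x y, ⟪P t x, P t y⟫_ℝ = ⟪x, y⟫_ℝ := by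
    intro t ht x y
    have := IsParallelAt.inner_eq hγ.smooth hI subset_rfl (convex_Icc 0 l)
      (fun t ht ↦ hpar t ht x) (fun t ht ↦ hpar t ht y) ht h0
    simp only [hP0] at this
    exact this
  have hno : ∀ t ∈ Icc 0 l, ∀ x, ⟪P t x, velocity γ (Icc 0 l) t⟫_ℝ = 0 := by
    intro t ht x
    have := IsParallelAt.inner_eq hγ.smooth hI subset_rfl (convex_Icc 0 l)
      (fun t ht ↦ hpar t ht x) (fun t ht ↦ hγ.isParallelAt_velocity hl ht) ht h0
    simp only [hP0] at this
    rw [this]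
    exact Submodule.mem_orthogonal_singleton_iff_inner_left.1 x.2
  refine ⟨P, hP0, hin, hno, fun t ht w hw ↦ ?_, hpar⟩
  -- `P t` is an isometry between spaces of the same dimension
  have hpos : Module.finrank ℝ E ≠ 0 := fun h ↦ by
    have : Subsingleton E := Module.finrank_zero_iff.1 h
    have : Subsingleton (TangentSpace 𝓘(ℝ, E) (γ 0)) := inferInstanceAs (Subsingleton E)
    have := hγ.unit_speed 0 h0
    rw [Subsingleton.elim (velocity γ (Icc 0 l) 0 : TangentSpace 𝓘(ℝ, E) (γ 0)) 0,
      norm_zero] at this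
    exact zero_ne_one this
  obtain ⟨n, hn⟩ := Nat.exists_eq_succ_of_ne_zero hpos
  let Q : normalSpace (E := E) γ (Icc 0 l) 0 →ₗ[ℝ] normalSpace (E := E) γ (Icc 0 l) t :=
    (P t).codRestrict _ fun x ↦ Submodule.mem_orthogonal_singleton_iff_inner_left.2 (hno t ht x)
  have hQ : Function.Injective Q := by
    rw [← LinearMap.ker_eq_bot, LinearMap.ker_eq_bot']
    intro x hx
    rw [← inner_self_eq_zero (𝕜 := ℝ), ← hin t ht]
    have : P t x = 0 := congrArg Subtype.val hx
    rw [this, inner_zero_left]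
  have hsurj := (LinearMap.injective_iff_surjective_of_finrank_eq_finrank
    ((hγ.finrank_normalSpace hn h0).trans (hγ.finrank_normalSpace hn ht).symm)).1 hQ
  obtain ⟨x, hx⟩ := hsurj ⟨w, Submodule.mem_orthogonal_singleton_iff_inner_left.2 hw⟩
  exact ⟨x, congrArg Subtype.val hx⟩

end NormalTransport

/-! ### Jacobi fields in a parallel frame -/

section JacobiOperator

-- the instances on iterated spaces of continuous linear maps are nested deeply
set_option maxSynthPendingDepth 3

variable {E : Type*} [NormedAddCommGroup E] [NormedSpace ℝ E] [FiniteDimensional ℝ E]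
  {M : Type*} [TopologicalSpace M] [ChartedSpace E M] [IsManifold 𝓘(ℝ, E) ∞ M]
  [RiemannianBundle (fun x : M ↦ TangentSpace 𝓘(ℝ, E) x)]
  [IsContMDiffRiemannianBundle 𝓘(ℝ, E) ∞ E (fun x : M ↦ TangentSpace 𝓘(ℝ, E) x)]
  {γ : ℝ → M} {l : ℝ}

/-- The Jacobi operator `u ↦ R(u, w) w` of a tangent vector `w`. Its linearity is read off from its
symmetry. -/
noncomputable def jacobiOperator (z : M) (w : TangentSpace 𝓘(ℝ, E) z) :
    TangentSpace 𝓘(ℝ, E) z →ₗ[ℝ] TangentSpace 𝓘(ℝ, E) z where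
  toFun u := curvature z u w w
  map_add' u v := ext_inner_right ℝ fun x ↦ by
    rw [inner_add_left, inner_curvature_jacobi, inner_curvature_jacobi, inner_curvature_jacobi,
      inner_add_left]
  map_smul' c u := ext_inner_right ℝ fun x ↦ by
    rw [RingHom.id_apply, real_inner_smul_left, inner_curvature_jacobi, inner_curvature_jacobi,
      real_inner_smul_left]

variable {P : ∀ t, normalSpace (E := E) γ (Icc 0 l) 0 →ₗ[ℝ] TangentSpace 𝓘(ℝ, E) (γ t)}

/-- The Jacobi operators of the velocities along `γ`, transported to `γ'(0)^⊥` by `P`. The adjoint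
of `P t` is the orthogonal projection to `γ'(t)^⊥` followed by the inverse of `P t`. -/
noncomputable def transportedJacobiOperator (γ : ℝ → M) (l : ℝ)
    (P : ∀ t, normalSpace (E := E) γ (Icc 0 l) 0 →ₗ[ℝ] TangentSpace 𝓘(ℝ, E) (γ t)) (t : ℝ) :
    normalSpace (E := E) γ (Icc 0 l) 0 →L[ℝ] normalSpace (E := E) γ (Icc 0 l) 0 :=
  LinearMap.toContinuousLinearMap
    (LinearMap.adjoint (P t) ∘ₗ jacobiOperator (γ t) (velocity γ (Icc 0 l) t) ∘ₗ P t)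

theorem transportedJacobiOperator_apply (t : ℝ) (x : normalSpace (E := E) γ (Icc 0 l) 0) :
    transportedJacobiOperator γ l P t x = LinearMap.adjoint (P t)
      (curvature (γ t) (P t x) (velocity γ (Icc 0 l) t) (velocity γ (Icc 0 l) t)) := rfl

theorem transportedJacobiOperator_symm (t : ℝ) (x y : normalSpace (E := E) γ (Icc 0 l) 0) :
    ⟪transportedJacobiOperator γ l P t x, y⟫_ℝ = ⟪x, transportedJacobiOperator γ l P t y⟫_ℝ := by
  rw [transportedJacobiOperator_apply, transportedJacobiOperator_apply,
    LinearMap.adjoint_inner_left, LinearMap.adjoint_inner_right, inner_curvature_jacobi]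

namespace IsNormalTransport

variable {t : ℝ}

omit [IsContMDiffRiemannianBundle 𝓘(ℝ, E) ∞ E (fun x : M ↦ TangentSpace 𝓘(ℝ, E) x)] in
theorem adjoint_apply (hP : IsNormalTransport γ l P) (ht : t ∈ Icc 0 l)
    (x : normalSpace (E := E) γ (Icc 0 l) 0) : LinearMap.adjoint (P t) (P t x) = x :=
  ext_inner_right ℝ fun y ↦ by rw [LinearMap.adjoint_inner_left, hP.inner_map t ht]

omit [IsContMDiffRiemannianBundle 𝓘(ℝ, E) ∞ E (fun x : M ↦ TangentSpace 𝓘(ℝ, E) x)] in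
theorem apply_adjoint_of_normal (hP : IsNormalTransport γ l P) (ht : t ∈ Icc 0 l)
    {X : TangentSpace 𝓘(ℝ, E) (γ t)} (hX : ⟪X, velocity γ (Icc 0 l) t⟫_ℝ = 0) :
    P t (LinearMap.adjoint (P t) X) = X := by
  obtain ⟨x, rfl⟩ := hP.surjective t ht X hX
  rw [hP.adjoint_apply ht]

omit [IsContMDiffRiemannianBundle 𝓘(ℝ, E) ∞ E (fun x : M ↦ TangentSpace 𝓘(ℝ, E) x)] in
theorem adjoint_velocity (hP : IsNormalTransport γ l P) (ht : t ∈ Icc 0 l) :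
    LinearMap.adjoint (P t) (velocity γ (Icc 0 l) t) = 0 :=
  ext_inner_right ℝ fun y ↦ by
    rw [LinearMap.adjoint_inner_left, real_inner_comm, hP.normal t ht, inner_zero_left]

omit [IsContMDiffRiemannianBundle 𝓘(ℝ, E) ∞ E (fun x : M ↦ TangentSpace 𝓘(ℝ, E) x)] in
theorem apply_adjoint (hP : IsNormalTransport γ l P)
    (hγ : IsNormalGeodesic (E := E) γ (Icc 0 l)) (ht : t ∈ Icc 0 l)
    (X : TangentSpace 𝓘(ℝ, E) (γ t)) :
    P t (LinearMap.adjoint (P t) X) =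
      X - ⟪X, velocity γ (Icc 0 l) t⟫_ℝ • velocity γ (Icc 0 l) t := by
  have h : ⟪X - ⟪X, velocity γ (Icc 0 l) t⟫_ℝ • velocity γ (Icc 0 l) t,
      velocity γ (Icc 0 l) t⟫_ℝ = 0 := by
    rw [inner_sub_left, real_inner_smul_left, real_inner_self_eq_norm_sq, hγ.unit_speed t ht]
    ring
  rw [← hP.apply_adjoint_of_normal ht h, map_sub, map_smul, hP.adjoint_velocity ht,
    smul_zero, sub_zero]

omit [FiniteDimensional ℝ E]
  [IsContMDiffRiemannianBundle 𝓘(ℝ, E) ∞ E (fun x : M ↦ TangentSpace 𝓘(ℝ, E) x)] in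
theorem norm_apply (hP : IsNormalTransport γ l P) (ht : t ∈ Icc 0 l)
    (x : normalSpace (E := E) γ (Icc 0 l) 0) : ‖P t x‖ = ‖x‖ := by
  rw [← sq_eq_sq₀ (norm_nonneg _) (norm_nonneg _), ← real_inner_self_eq_norm_sq,
    ← real_inner_self_eq_norm_sq, hP.inner_map t ht]

omit [IsContMDiffRiemannianBundle 𝓘(ℝ, E) ∞ E (fun x : M ↦ TangentSpace 𝓘(ℝ, E) x)] in
theorem norm_sq_eq (hP : IsNormalTransport γ l P)
    (hγ : IsNormalGeodesic (E := E) γ (Icc 0 l)) (ht : t ∈ Icc 0 l)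
    (X : TangentSpace 𝓘(ℝ, E) (γ t)) :
    ‖X‖ ^ 2 = ‖LinearMap.adjoint (P t) X‖ ^ 2 + ⟪velocity γ (Icc 0 l) t, X⟫_ℝ ^ 2 := by
  rw [← hP.norm_apply ht, hP.apply_adjoint hγ ht, @norm_sub_sq_real, norm_smul,
    real_inner_smul_right, hγ.unit_speed t ht, real_inner_comm X, mul_one, Real.norm_eq_abs, sq_abs]
  ring

omit [IsContMDiffRiemannianBundle 𝓘(ℝ, E) ∞ E (fun x : M ↦ TangentSpace 𝓘(ℝ, E) x)] in
theorem norm_normalPart (hP : IsNormalTransport γ l P)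
    (hγ : IsNormalGeodesic (E := E) γ (Icc 0 l)) (ht : t ∈ Icc 0 l)
    (V : ∀ t, TangentSpace 𝓘(ℝ, E) (γ t)) :
    ‖normalPart γ (Icc 0 l) V t‖ = ‖LinearMap.adjoint (P t) (V t)‖ := by
  rw [normalPart, ← hP.apply_adjoint hγ ht, hP.norm_apply ht]

omit [IsContMDiffRiemannianBundle 𝓘(ℝ, E) ∞ E (fun x : M ↦ TangentSpace 𝓘(ℝ, E) x)] in
theorem adjoint_zero (hP : IsNormalTransport γ l P) (hl : 0 < l)
    (hγ : IsNormalGeodesic (E := E) γ (Icc 0 l)) (V : ∀ t, TangentSpace 𝓘(ℝ, E) (γ t)) :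
    (LinearMap.adjoint (P 0) (V 0) : TangentSpace 𝓘(ℝ, E) (γ 0)) = normalPart γ (Icc 0 l) V 0 := by
  rw [normalPart, ← hP.apply_adjoint hγ (left_mem_Icc.2 hl.le), hP.map_zero_time]

theorem apply_transportedJacobiOperator_adjoint (hP : IsNormalTransport γ l P) (ht : t ∈ Icc 0 l)
    (X : TangentSpace 𝓘(ℝ, E) (γ t)) :
    P t (transportedJacobiOperator γ l P t (LinearMap.adjoint (P t) X)) =
      curvature (γ t) X (velocity γ (Icc 0 l) t) (velocity γ (Icc 0 l) t) := by
  rw [← hP.apply_adjoint_of_normal ht (inner_curvature_self (γ t) X _ _)]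
  congr 1
  refine ext_inner_right ℝ fun y ↦ ?_
  rw [transportedJacobiOperator_symm, LinearMap.adjoint_inner_left, LinearMap.adjoint_inner_left,
    transportedJacobiOperator_apply,
    hP.apply_adjoint_of_normal ht (inner_curvature_self (γ t) _ _ _),
    inner_curvature_jacobi]

theorem sectionalCurvature_eq (hP : IsNormalTransport γ l P)
    (hγ : IsNormalGeodesic (E := E) γ (Icc 0 l)) (ht : t ∈ Icc 0 l)
    (X : TangentSpace 𝓘(ℝ, E) (γ t)) :
    sectionalCurvature (γ t) (velocity γ (Icc 0 l) t) X =
      ⟪transportedJacobiOperator γ l P t (LinearMap.adjoint (P t) X), LinearMap.adjoint (P t) X⟫_ℝ /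
        ‖LinearMap.adjoint (P t) X‖ ^ 2 := by
  rw [sectionalCurvature, inner_curvature_swap, ← hP.apply_transportedJacobiOperator_adjoint ht,
    hγ.unit_speed t ht, hP.norm_sq_eq hγ ht, LinearMap.adjoint_inner_right]
  ring_nf

omit [IsManifold 𝓘(ℝ, E) ∞ M]
  [IsContMDiffRiemannianBundle 𝓘(ℝ, E) ∞ E (fun x : M ↦ TangentSpace 𝓘(ℝ, E) x)] in
theorem adjoint_field_eq_sum (V : ∀ t, TangentSpace 𝓘(ℝ, E) (γ t)) (t : ℝ) :
    LinearMap.adjoint (P t) (V t) =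
      ∑ i, ⟪P t (stdOrthonormalBasis ℝ (normalSpace (E := E) γ (Icc 0 l) 0) i), V t⟫_ℝ •
        stdOrthonormalBasis ℝ (normalSpace (E := E) γ (Icc 0 l) 0) i := by
  rw [← (stdOrthonormalBasis ℝ (normalSpace (E := E) γ (Icc 0 l) 0)).sum_repr'
    (LinearMap.adjoint (P t) (V t))]
  simp only [LinearMap.adjoint_inner_right]

theorem hasDerivWithinAt_adjoint (hP : IsNormalTransport γ l P) (hl : 0 < l)
    (hγ : IsNormalGeodesic (E := E) γ (Icc 0 l)) (ht : t ∈ Icc 0 l)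
    {V : ∀ t, TangentSpace 𝓘(ℝ, E) (γ t)} (hV : IsSmoothAlongAt γ (Icc 0 l) V t) :
    HasDerivWithinAt (fun τ ↦ LinearMap.adjoint (P τ) (V τ))
      (LinearMap.adjoint (P t) (covDeriv γ (Icc 0 l) V t)) (Icc 0 l) t := by
  simp only [adjoint_field_eq_sum]
  refine HasDerivWithinAt.fun_sum fun i _ ↦ ?_
  have hp := hP.parallel t ht (stdOrthonormalBasis ℝ (normalSpace (E := E) γ (Icc 0 l) 0) i)
  have := hasDerivWithinAt_inner (hγ.smooth t ht) (uniqueDiffOn_Icc hl t ht) ht hp.1 hV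
  rw [hp.2, inner_zero_left, zero_add] at this
  exact this.smul_const _

theorem contDiffWithinAt_adjoint (hP : IsNormalTransport γ l P) (ht : t ∈ Icc 0 l)
    {V : ∀ t, TangentSpace 𝓘(ℝ, E) (γ t)} (hV : IsSmoothAlongAt γ (Icc 0 l) V t) :
    ContDiffWithinAt ℝ ∞ (fun τ ↦ LinearMap.adjoint (P τ) (V τ)) (Icc 0 l) t := by
  simp only [adjoint_field_eq_sum]
  exact ContDiffWithinAt.sum fun i _ ↦
    (contDiffWithinAt_inner (hP.parallel t ht _).1 hV).smul contDiffWithinAt_const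

theorem contDiffOn_transportedJacobiOperator (hP : IsNormalTransport γ l P) (hl : 0 < l)
    (hγ : IsNormalGeodesic (E := E) γ (Icc 0 l)) :
    ContDiffOn ℝ ∞ (transportedJacobiOperator γ l P) (Icc 0 l) := by
  rw [contDiffOn_clm_apply]
  intro x t ht
  have hv := (hγ.isParallelAt_velocity hl ht).1
  exact hP.contDiffWithinAt_adjoint ht
    (isSmoothAlongAt_curvature (hγ.smooth t ht) (hP.parallel t ht x).1 hv hv)

/-- The normal part of a Jacobi field, transported to `γ'(0)^⊥`, solves `v'' = -R v`. -/
theorem hasDerivWithinAt_adjoint_covDeriv (hP : IsNormalTransport γ l P) (hl : 0 < l)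
    (hγ : IsNormalGeodesic (E := E) γ (Icc 0 l)) (ht : t ∈ Icc 0 l)
    {V : ∀ t, TangentSpace 𝓘(ℝ, E) (γ t)} (hV : IsJacobiField γ (Icc 0 l) V) :
    HasDerivWithinAt (fun τ ↦ LinearMap.adjoint (P τ) (covDeriv γ (Icc 0 l) V τ))
      (-transportedJacobiOperator γ l P t (LinearMap.adjoint (P t) (V t))) (Icc 0 l) t := by
  have h := hP.hasDerivWithinAt_adjoint hl hγ ht
    (isSmoothAlongAt_covDeriv hγ.smooth (uniqueDiffOn_Icc hl) hV.1 ht)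
  rwa [eq_neg_of_add_eq_zero_left (hV.2 t ht), map_neg,
    ← hP.apply_transportedJacobiOperator_adjoint ht, hP.adjoint_apply ht] at h

/-- The tangential component of a Jacobi field is an affine function of time. -/
theorem _root_.RauchComparison.IsJacobiField.inner_velocity (hl : 0 < l)
    (hγ : IsNormalGeodesic (E := E) γ (Icc 0 l)) (ht : t ∈ Icc 0 l)
    {V : ∀ t, TangentSpace 𝓘(ℝ, E) (γ t)} (hV : IsJacobiField γ (Icc 0 l) V) :
    ⟪velocity γ (Icc 0 l) t, V t⟫_ℝ = ⟪velocity γ (Icc 0 l) 0, V 0⟫_ℝ +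
      t * ⟪velocity γ (Icc 0 l) 0, covDeriv γ (Icc 0 l) V 0⟫_ℝ := by
  have hI := uniqueDiffOn_Icc hl
  have h0 : (0 : ℝ) ∈ Icc 0 l := left_mem_Icc.2 hl.le
  have hd : ∀ {W : ∀ t, TangentSpace 𝓘(ℝ, E) (γ t)}, ∀ t ∈ Icc 0 l,
      IsSmoothAlongAt γ (Icc 0 l) W t →
      HasDerivWithinAt (fun τ ↦ ⟪velocity γ (Icc 0 l) τ, W τ⟫_ℝ)
        ⟪velocity γ (Icc 0 l) t, covDeriv γ (Icc 0 l) W t⟫_ℝ (Icc 0 l) t := by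
    intro W t ht hW
    have hv := hγ.isParallelAt_velocity hl ht
    have := hasDerivWithinAt_inner (hγ.smooth t ht) (hI t ht) ht hv.1 hW
    rwa [hv.2, inner_zero_left, zero_add] at this
  have hconst : ∀ {f : ℝ → ℝ}, (∀ t ∈ Icc 0 l, HasDerivWithinAt f 0 (Icc 0 l) t) →
      ∀ t ∈ Icc 0 l, f t = f 0 := by
    intro f hf t ht
    have := (convex_Icc 0 l).norm_image_sub_le_of_norm_hasDerivWithin_le (C := 0) hf (by simp) h0 ht
    rwa [zero_mul, norm_le_zero_iff, sub_eq_zero] at this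
  have h1 := hconst (f := fun τ ↦ ⟪velocity γ (Icc 0 l) τ, covDeriv γ (Icc 0 l) V τ⟫_ℝ)
    fun t ht ↦ by
      have := hd t ht (isSmoothAlongAt_covDeriv hγ.smooth hI hV.1 ht)
      rwa [eq_neg_of_add_eq_zero_left (hV.2 t ht), inner_neg_right, real_inner_comm,
        inner_curvature_self, neg_zero] at this
  have h2 := hconst (f := fun τ ↦ ⟪velocity γ (Icc 0 l) τ, V τ⟫_ℝ -
      τ * ⟪velocity γ (Icc 0 l) 0, covDeriv γ (Icc 0 l) V 0⟫_ℝ) fun t ht ↦ by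
    have := (hd t ht (hV.1 t ht)).sub ((hasDerivWithinAt_id t _).mul_const
      ⟪velocity γ (Icc 0 l) 0, covDeriv γ (Icc 0 l) V 0⟫_ℝ)
    rwa [h1 t ht, one_mul, sub_self] at this
  have := h2 t ht
  simp only [zero_mul, sub_zero] at this
  linarith

omit [IsContMDiffRiemannianBundle 𝓘(ℝ, E) ∞ E (fun x : M ↦ TangentSpace 𝓘(ℝ, E) x)] in
theorem isSmoothAlongAt_apply (hP : IsNormalTransport γ l P)
    (hγ : IsNormalGeodesic (E := E) γ (Icc 0 l)) (ht : t ∈ Icc 0 l)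
    {u : ℝ → normalSpace (E := E) γ (Icc 0 l) 0} (hu : ContDiffWithinAt ℝ ∞ u (Icc 0 l) t) :
    IsSmoothAlongAt γ (Icc 0 l) (fun τ ↦ P τ (u τ)) t := by
  let b := stdOrthonormalBasis ℝ (normalSpace (E := E) γ (Icc 0 l) 0)
  have h : (fun τ ↦ P τ (u τ)) = fun τ ↦ ∑ i, ⟪b i, u τ⟫_ℝ • P τ (b i) := funext fun τ ↦ by
    conv_lhs => rw [← b.sum_repr' (u τ)]
    rw [map_sum]
    simp only [map_smul]
  rw [h]
  exact isSmoothAlongAt_sum (hγ.smooth t ht) (fun i ↦ contDiffWithinAt_const.inner ℝ hu)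
    fun i ↦ (hP.parallel t ht _).1

omit [IsContMDiffRiemannianBundle 𝓘(ℝ, E) ∞ E (fun x : M ↦ TangentSpace 𝓘(ℝ, E) x)] in
theorem covDeriv_apply (hP : IsNormalTransport γ l P) (hl : 0 < l)
    (hγ : IsNormalGeodesic (E := E) γ (Icc 0 l)) (ht : t ∈ Icc 0 l)
    {u : ℝ → normalSpace (E := E) γ (Icc 0 l) 0} {u' : normalSpace (E := E) γ (Icc 0 l) 0}
    (hu : HasDerivWithinAt u u' (Icc 0 l) t) :
    covDeriv γ (Icc 0 l) (fun τ ↦ P τ (u τ)) t = P t u' := by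
  let b := stdOrthonormalBasis ℝ (normalSpace (E := E) γ (Icc 0 l) 0)
  have h : (fun τ ↦ P τ (u τ)) = fun τ ↦ ∑ i, (fun τ ↦ ⟪b i, u τ⟫_ℝ) τ • P τ (b i) :=
    funext fun τ ↦ by
      conv_lhs => rw [← b.sum_repr' (u τ)]
      rw [map_sum]
      simp only [map_smul]
  rw [h, covDeriv_sum (c' := fun i ↦ ⟪b i, u'⟫_ℝ) (hγ.smooth t ht) (uniqueDiffOn_Icc hl t ht)
    (fun i ↦ by simpa using (hasDerivWithinAt_const t (Icc 0 l) (b i)).inner ℝ hu)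
    fun i ↦ (hP.parallel t ht _).1]
  conv_rhs => rw [← b.sum_repr' u', map_sum]
  refine Finset.sum_congr rfl fun i _ ↦ ?_
  rw [(hP.parallel t ht (b i)).2, smul_zero, add_zero, map_smul]

/-- Solutions of `u'' = -R u` give normal Jacobi fields. -/
theorem isJacobiField_apply (hP : IsNormalTransport γ l P) (hl : 0 < l)
    (hγ : IsNormalGeodesic (E := E) γ (Icc 0 l))
    {u u' : ℝ → normalSpace (E := E) γ (Icc 0 l) 0} (hu_smooth : ContDiffOn ℝ ∞ u (Icc 0 l))
    (hu : ∀ t ∈ Icc 0 l, HasDerivWithinAt u (u' t) (Icc 0 l) t)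
    (hu' : ∀ t ∈ Icc 0 l,
      HasDerivWithinAt u' (-transportedJacobiOperator γ l P t (u t)) (Icc 0 l) t) :
    IsJacobiField γ (Icc 0 l) (fun τ ↦ P τ (u τ)) := by
  refine ⟨fun t ht ↦ hP.isSmoothAlongAt_apply hγ ht (hu_smooth t ht), fun t ht ↦ ?_⟩
  have h : covDeriv γ (Icc 0 l) (covDeriv γ (Icc 0 l) (fun τ ↦ P τ (u τ))) t =
      covDeriv γ (Icc 0 l) (fun τ ↦ P τ (u' τ)) t := by
    refine covDeriv_congr (hγ.smooth t ht).continuousWithinAt ht ?_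
    filter_upwards [self_mem_nhdsWithin] with τ hτ using hP.covDeriv_apply hl hγ hτ (hu τ hτ)
  rw [h, hP.covDeriv_apply hl hγ ht (hu' t ht), ← hP.apply_transportedJacobiOperator_adjoint ht,
    hP.adjoint_apply ht, map_neg, neg_add_cancel]

omit [FiniteDimensional ℝ E]
  [IsContMDiffRiemannianBundle 𝓘(ℝ, E) ∞ E (fun x : M ↦ TangentSpace 𝓘(ℝ, E) x)] in
/-- A field that agrees on `[0, t₀]` with a transported vector is parallel there. -/
theorem isParallel_of_eq (hP : IsNormalTransport γ l P)
    (hγ : IsNormalGeodesic (E := E) γ (Icc 0 l)) {t₀ : ℝ} (ht₀ : t₀ ∈ Ioc 0 l)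
    (x : normalSpace (E := E) γ (Icc 0 l) 0) {U : ∀ t, TangentSpace 𝓘(ℝ, E) (γ t)}
    (hU : ∀ t ∈ Icc 0 t₀, U t = P t x) : IsParallel γ (Icc 0 t₀) U := by
  have hsub : Icc 0 t₀ ⊆ Icc 0 l := Icc_subset_Icc_right ht₀.2
  have hpar : ∀ t ∈ Icc 0 t₀, IsParallelAt γ (Icc 0 t₀) (fun τ ↦ P τ x) t := fun t ht ↦ by
    have := hP.parallel t (hsub ht) x
    exact ⟨this.1.mono hsub, (covDeriv_mono (hγ.smooth t (hsub ht)) hsub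
      (uniqueDiffOn_Icc ht₀.1 t ht) this.1).trans this.2⟩
  have h : ∀ t ∈ Icc 0 t₀, IsParallelAt γ (Icc 0 t₀) U t := fun t ht ↦
    (hpar t ht).congr (hγ.smooth.mono hsub) ht (by
      filter_upwards [self_mem_nhdsWithin] with τ hτ using hU τ hτ)
  exact ⟨fun t ht ↦ (h t ht).1, fun t ht ↦ (h t ht).2⟩

omit [IsContMDiffRiemannianBundle 𝓘(ℝ, E) ∞ E (fun x : M ↦ TangentSpace 𝓘(ℝ, E) x)] in
theorem isParallel_inv_smul_normalPart (hP : IsNormalTransport γ l P)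
    (hγ : IsNormalGeodesic (E := E) γ (Icc 0 l)) {t₀ : ℝ} (ht₀ : t₀ ∈ Ioc 0 l)
    {V : ∀ t, TangentSpace 𝓘(ℝ, E) (γ t)} {c : ℝ → ℝ} {x : normalSpace (E := E) γ (Icc 0 l) 0}
    (h : ∀ t ∈ Icc 0 t₀, c t ≠ 0 ∧ LinearMap.adjoint (P t) (V t) = c t • x) :
    IsParallel γ (Icc 0 t₀) (fun t ↦ (c t)⁻¹ • normalPart γ (Icc 0 l) V t) :=
  hP.isParallel_of_eq hγ ht₀ x fun t ht ↦ by
    rw [normalPart, ← hP.apply_adjoint hγ ⟨ht.1, ht.2.trans ht₀.2⟩, (h t ht).2, map_smul,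
      inv_smul_smul₀ (h t ht).1]

end IsNormalTransport

end JacobiOperator

/-! ### Comparison of the normal parts -/

section Comparison

theorem _root_.LinearMap.IsSymmetric.inner_apply_self_eq_sum {N : Type*} [NormedAddCommGroup N]
    [InnerProductSpace ℝ N] [FiniteDimensional ℝ N] {B : Module.End ℝ N} (hB : B.IsSymmetric)
    (x : N) : ⟪B x, x⟫_ℝ =
      ∑ i, hB.eigenvalues rfl i * ⟪x, hB.eigenvectorBasis rfl i⟫_ℝ ^ 2 := by
  rw [← (hB.eigenvectorBasis rfl).sum_inner_mul_inner]
  refine Finset.sum_congr rfl fun i _ ↦ ?_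
  rw [hB, hB.apply_eigenvectorBasis, inner_smul_right, real_inner_comm x]
  simp only [RCLike.ofReal_real_eq_id, id]
  ring

/-- If every eigenvalue of `B₀` is at most every eigenvalue of `B`, then so are the Rayleigh
quotients. -/
theorem inner_mul_norm_sq_le_of_eigenvalues_le {N N₀ : Type*} [NormedAddCommGroup N]
    [InnerProductSpace ℝ N] [FiniteDimensional ℝ N] [NormedAddCommGroup N₀]
    [InnerProductSpace ℝ N₀] [FiniteDimensional ℝ N₀] {B : Module.End ℝ N} {B₀ : Module.End ℝ N₀}
    (hB : B.IsSymmetric) (hB₀ : B₀.IsSymmetric)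
    (heig : ∀ μ μ₀ : ℝ, B.HasEigenvalue μ → B₀.HasEigenvalue μ₀ → μ₀ ≤ μ) (x : N) (e : N₀) :
    ⟪B₀ e, e⟫_ℝ * ‖x‖ ^ 2 ≤ ⟪B x, x⟫_ℝ * ‖e‖ ^ 2 := by
  rw [hB.inner_apply_self_eq_sum, hB₀.inner_apply_self_eq_sum,
    ← (hB.eigenvectorBasis rfl).sum_sq_inner_left x,
    ← (hB₀.eigenvectorBasis rfl).sum_sq_inner_left e,
    Finset.sum_mul_sum, Finset.sum_mul_sum, Finset.sum_comm]
  refine Finset.sum_le_sum fun i _ ↦ Finset.sum_le_sum fun j _ ↦ ?_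
  have h := heig _ _ (hB.hasEigenvalue_eigenvalues rfl i) (hB₀.hasEigenvalue_eigenvalues rfl j)
  have h' : 0 ≤ ⟪e, hB₀.eigenvectorBasis rfl j⟫_ℝ ^ 2 * ⟪x, hB.eigenvectorBasis rfl i⟫_ℝ ^ 2 := by
    positivity
  have := mul_le_mul_of_nonneg_right h h'
  simp only [RCLike.ofReal_real_eq_id, id] at this
  linarith

variable {N N₀ : Type*} [NormedAddCommGroup N] [InnerProductSpace ℝ N]
  [NormedAddCommGroup N₀] [InnerProductSpace ℝ N₀] {l : ℝ} {R : ℝ → N →L[ℝ] N}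
  {R₀ A : ℝ → N₀ →L[ℝ] N₀} {v v' : ℝ → N} {v₀ v₀' : ℝ → N₀}

/-- The comparison of the normal parts, including the degenerate cases in which one of them
vanishes identically. -/
theorem normal_comparison [Nontrivial N₀] (hR : ContinuousOn R (Icc 0 l))
    (hA : IsRiccatiSolution l R₀ A)
    (hv : ∀ t ∈ Icc 0 l, HasDerivWithinAt v (v' t) (Icc 0 l) t)
    (hv' : ∀ t ∈ Icc 0 l, HasDerivWithinAt v' (-R t (v t)) (Icc 0 l) t)
    (hv₀ : ∀ t ∈ Icc 0 l, HasDerivWithinAt v₀ (v₀' t) (Icc 0 l) t)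
    (hv₀' : ∀ t ∈ Icc 0 l, HasDerivWithinAt v₀' (-R₀ t (v₀ t)) (Icc 0 l) t)
    (hcurv : ∀ t ∈ Icc 0 l, ∀ e : N₀, ‖e‖ = 1 →
      ⟪R t (v t), v t⟫_ℝ ≤ ⟪R₀ t e, e⟫_ℝ * ‖v t‖ ^ 2)
    (hinit : ∀ e : N₀, ‖e‖ = 1 → ⟪A 0 e, e⟫_ℝ * ‖v 0‖ ^ 2 ≤ ⟪v' 0, v 0⟫_ℝ)
    (hinit₀ : v₀' 0 = A 0 (v₀ 0)) (hzero : v 0 = 0 → v' 0 = 0) (hle : ‖v₀ 0‖ ≤ ‖v 0‖) :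
    (∀ t ∈ Icc 0 l, ‖v₀ t‖ ≤ ‖v t‖) ∧
    ∀ t₀ ∈ Ioc 0 l, ‖v t₀‖ = ‖v₀ t₀‖ →
      (∀ t ∈ Icc 0 t₀, ‖v t‖ = ‖v₀ t‖) ∧
      (v 0 ≠ 0 → ∃ (ê : N) (e : N₀), ∀ t ∈ Icc 0 t₀, v t ≠ 0 ∧ v₀ t ≠ 0 ∧
        v t = ‖v t‖ • ê ∧ v₀ t = ‖v t‖ • e ∧
        ⟪R t (v t), v t⟫_ℝ = ⟪R₀ t (v₀ t), v₀ t⟫_ℝ) := by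
  have hv₀A : ∀ t ∈ Icc 0 l, HasDerivWithinAt v₀ (A t (v₀ t)) (Icc 0 l) t := fun t ht ↦ by
    rw [← hA.eq_apply hv₀ hv₀' hinit₀ t ht]
    exact hv₀ t ht
  have hv₀zero : v₀ 0 = 0 → ∀ t ∈ Icc 0 l, v₀ t = 0 := fun h0 t ht ↦
    linearODE_unique hA.continuousOn hv₀A (y := fun _ ↦ 0)
      (fun t _ ↦ by simpa using hasDerivWithinAt_const t (Icc 0 l) (0 : N₀))
      (left_mem_Icc.2 (ht.1.trans ht.2)) h0 ht
  by_cases hv0 : v 0 = 0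
  · have hv₀0 : v₀ 0 = 0 := by simpa [hv0] using hle
    have h1 := hv₀zero hv₀0
    have h2 := eq_zero_of_secondOrderODE hR hv hv' hv0 (hzero hv0)
    refine ⟨fun t ht ↦ by simp [h1 t ht], fun t₀ ht₀ _ ↦ ⟨fun t ht ↦ ?_, fun h ↦ (h hv0).elim⟩⟩
    have ht' : t ∈ Icc 0 l := ⟨ht.1, ht.2.trans ht₀.2⟩
    rw [h1 t ht', h2 t ht', norm_zero, norm_zero]
  have hcomp : RiccatiComparison l R v v' R₀ A := ⟨hA, hv, hv', hcurv, hinit, hv0⟩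
  have hne := hcomp.ne_zero
  by_cases hv₀0 : v₀ 0 = 0
  · have h1 := hv₀zero hv₀0
    refine ⟨fun t ht ↦ by simp [h1 t ht], fun t₀ ht₀ h ↦ ?_⟩
    rw [h1 t₀ (Ioc_subset_Icc_self ht₀), norm_zero, norm_eq_zero] at h
    exact (hne t₀ (Ioc_subset_Icc_self ht₀) h).elim
  obtain ⟨h1, h2⟩ := hcomp.norm_le hv₀A hv₀0 hle
  refine ⟨h1, fun t₀ ht₀ h ↦ ?_⟩
  obtain ⟨ê, e, he, h3⟩ := h2 t₀ ht₀ h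
  refine ⟨fun t ht ↦ ?_, fun _ ↦ ⟨ê, e, fun t ht ↦ ?_⟩⟩
  · conv_rhs => rw [(h3 t ht).2.1, norm_smul, he, mul_one, norm_norm]
  · have hvt := hne t ⟨ht.1, ht.2.trans ht₀.2⟩
    refine ⟨hvt, ?_, h3 t ht⟩
    rw [(h3 t ht).2.1]
    exact smul_ne_zero (norm_ne_zero_iff.2 hvt) (by rw [← norm_ne_zero_iff, he]; exact one_ne_zero)

end Comparison

/-! ### Geodesics without focal points -/

section Geodesics

variable {E : Type*} [NormedAddCommGroup E] [NormedSpace ℝ E] [FiniteDimensional ℝ E]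
  {M : Type*} [TopologicalSpace M] [ChartedSpace E M] [IsManifold 𝓘(ℝ, E) ∞ M]
  [RiemannianBundle (fun x : M ↦ TangentSpace 𝓘(ℝ, E) x)]
  [IsContMDiffRiemannianBundle 𝓘(ℝ, E) ∞ E (fun x : M ↦ TangentSpace 𝓘(ℝ, E) x)]
  {γ : ℝ → M} {l : ℝ}
  {P : ∀ t, normalSpace (E := E) γ (Icc 0 l) 0 →ₗ[ℝ] TangentSpace 𝓘(ℝ, E) (γ t)}

namespace IsNormalTransport

omit [FiniteDimensional ℝ E]
  [IsContMDiffRiemannianBundle 𝓘(ℝ, E) ∞ E (fun x : M ↦ TangentSpace 𝓘(ℝ, E) x)] in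
theorem linearIndependent (hP : IsNormalTransport γ l P)
    (hγ : IsNormalGeodesic (E := E) γ (Icc 0 l)) {t : ℝ} (ht : t ∈ Icc 0 l)
    {x : normalSpace (E := E) γ (Icc 0 l) 0} (hx : x ≠ 0) :
    LinearIndependent ℝ ![velocity γ (Icc 0 l) t, P t x] := by
  have hPx : P t x ≠ 0 := by rwa [← norm_ne_zero_iff, hP.norm_apply ht, norm_ne_zero_iff]
  rw [LinearIndependent.pair_iff]
  intro a b hab
  have ha : a = 0 := by
    have := congrArg (fun X ↦ ⟪X, velocity γ (Icc 0 l) t⟫_ℝ) hab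
    simp only [inner_add_left, real_inner_smul_left, hP.normal t ht, real_inner_self_eq_norm_sq,
      hγ.unit_speed t ht, inner_zero_left] at this
    linarith
  refine ⟨ha, ?_⟩
  rw [ha, zero_smul, zero_add] at hab
  exact (smul_eq_zero.1 hab).resolve_right hPx

/-- Without focal points, the Riccati equation of the transported Jacobi operators has a solution
on the whole interval. -/
theorem exists_isRiccatiSolution (hP : IsNormalTransport γ l P) (hl : 0 < l)
    (hγ : IsNormalGeodesic (E := E) γ (Icc 0 l))
    {B : Module.End ℝ (normalSpace (E := E) γ (Icc 0 l) 0)} (hB : B.IsSymmetric)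
    (hfocal : ∀ τ, ¬ IsFocalPoint γ l B τ) :
    ∃ A : ℝ → normalSpace (E := E) γ (Icc 0 l) 0 →L[ℝ] normalSpace (E := E) γ (Icc 0 l) 0,
      IsRiccatiSolution (N := normalSpace (E := E) γ (Icc 0 l) 0) l
        (transportedJacobiOperator γ l P) A ∧ ∀ x, A 0 x = B x := by
  have hR := hP.contDiffOn_transportedJacobiOperator hl hγ
  have h0 : (0 : ℝ) ∈ Icc 0 l := left_mem_Icc.2 hl.le
  obtain ⟨A, hA, hA0⟩ := RauchComparison.exists_isRiccatiSolution
    (N := normalSpace (E := E) γ (Icc 0 l) 0) hl hR.continuousOn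
    (fun t _ ↦ transportedJacobiOperator_symm t) (LinearMap.toContinuousLinearMap B) hB
    fun u u' hu hu' hu0 hu'0 t ht hut ↦ by
      refine hfocal t ⟨ht.1, ht.2, fun τ ↦ P τ (u τ), hP.isJacobiField_apply hl hγ
        (contDiffOn_of_secondOrderODE (uniqueDiffOn_Icc hl) hR hu hu') hu hu',
        ⟨u 0, hu0, hP.map_zero_time _, ?_⟩, ?_⟩
      · rw [hP.covDeriv_apply hl hγ h0 (hu 0 h0), hP.map_zero_time, hu'0]
        rfl
      · exact (congrArg (P t) hut).trans (map_zero _)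
  exact ⟨A, hA, fun x ↦ by rw [hA0]; rfl⟩

end IsNormalTransport

omit [FiniteDimensional ℝ E]
  [IsContMDiffRiemannianBundle 𝓘(ℝ, E) ∞ E (fun x : M ↦ TangentSpace 𝓘(ℝ, E) x)] in
theorem IsNormalGeodesic.nontrivial_normalSpace (hdim : 2 ≤ Module.finrank ℝ E)
    (hγ : IsNormalGeodesic (E := E) γ (Icc 0 l)) {t : ℝ} (ht : t ∈ Icc 0 l) :
    Nontrivial (normalSpace (E := E) γ (Icc 0 l) t) := by
  apply Module.nontrivial_of_finrank_pos (R := ℝ)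
  rw [hγ.finrank_normalSpace (n := Module.finrank ℝ E - 1) (by omega) ht]
  omega

end Geodesics
end RauchComparison

set_option maxHeartbeats 400000 in
theorem theoremB
    {E : Type*} [NormedAddCommGroup E] [NormedSpace ℝ E] [FiniteDimensional ℝ E]
    {M : Type*} [TopologicalSpace M] [ChartedSpace E M] [IsManifold 𝓘(ℝ, E) ∞ M]
    [RiemannianBundle (fun x : M ↦ TangentSpace 𝓘(ℝ, E) x)]
    [IsContMDiffRiemannianBundle 𝓘(ℝ, E) ∞ E (fun x : M ↦ TangentSpace 𝓘(ℝ, E) x)]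
    {E₀ : Type*} [NormedAddCommGroup E₀] [NormedSpace ℝ E₀] [FiniteDimensional ℝ E₀]
    {M₀ : Type*} [TopologicalSpace M₀] [ChartedSpace E₀ M₀] [IsManifold 𝓘(ℝ, E₀) ∞ M₀]
    [RiemannianBundle (fun x : M₀ ↦ TangentSpace 𝓘(ℝ, E₀) x)]
    [IsContMDiffRiemannianBundle 𝓘(ℝ, E₀) ∞ E₀ (fun x : M₀ ↦ TangentSpace 𝓘(ℝ, E₀) x)]
    -- a one-dimensional `M₀` has no sections, and no maximum eigenvalue of `B₀`
    (hdim : 2 ≤ Module.finrank ℝ E₀)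
    (l : ℝ) (hl : 0 < l)
    (γ : ℝ → M) (hγ : RauchComparison.IsNormalGeodesic (E := E) γ (Icc 0 l))
    (γ₀ : ℝ → M₀) (hγ₀ : RauchComparison.IsNormalGeodesic (E := E₀) γ₀ (Icc 0 l))
    -- `K(γ', X) ≤ K(γ₀', X₀)` for all sections containing the velocities
    (hK : ∀ t ∈ Icc (0 : ℝ) l, ∀ (X : TangentSpace 𝓘(ℝ, E) (γ t))
      (X₀ : TangentSpace 𝓘(ℝ, E₀) (γ₀ t)),
      LinearIndependent ℝ ![RauchComparison.velocity γ (Icc 0 l) t, X] →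
      LinearIndependent ℝ ![RauchComparison.velocity γ₀ (Icc 0 l) t, X₀] →
      RauchComparison.sectionalCurvature (γ t) (RauchComparison.velocity γ (Icc 0 l) t) X ≤
        RauchComparison.sectionalCurvature (γ₀ t) (RauchComparison.velocity γ₀ (Icc 0 l) t) X₀)
    (V : ∀ t, TangentSpace 𝓘(ℝ, E) (γ t)) (hV : RauchComparison.IsJacobiField γ (Icc 0 l) V)
    (V₀ : ∀ t, TangentSpace 𝓘(ℝ, E₀) (γ₀ t))
    (hV₀ : RauchComparison.IsJacobiField γ₀ (Icc 0 l) V₀)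
    (hnorm : ‖V₀ 0‖ ≤ ‖V 0‖) (hpos : 0 < ‖V₀ 0‖)
    (htan : ⟪RauchComparison.velocity γ (Icc 0 l) 0, V 0⟫_ℝ =
      ⟪RauchComparison.velocity γ₀ (Icc 0 l) 0, V₀ 0⟫_ℝ)
    (htan' : ⟪RauchComparison.velocity γ (Icc 0 l) 0,
        RauchComparison.covDeriv γ (Icc 0 l) V 0⟫_ℝ =
      ⟪RauchComparison.velocity γ₀ (Icc 0 l) 0,
        RauchComparison.covDeriv γ₀ (Icc 0 l) V₀ 0⟫_ℝ)
    (B : Module.End ℝ (RauchComparison.normalSpace (E := E) γ (Icc 0 l) 0))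
    (hB : B.IsSymmetric)
    (B₀ : Module.End ℝ (RauchComparison.normalSpace (E := E₀) γ₀ (Icc 0 l) 0))
    (hB₀ : B₀.IsSymmetric)
    -- the minimum eigenvalue of `B` is at least the maximum eigenvalue of `B₀`
    (heig : ∀ μ μ₀ : ℝ, B.HasEigenvalue μ → B₀.HasEigenvalue μ₀ → μ₀ ≤ μ)
    (hBV : RauchComparison.normalPart γ (Icc 0 l) (RauchComparison.covDeriv γ (Icc 0 l) V) 0 =
      B ⟨RauchComparison.normalPart γ (Icc 0 l) V 0,
        hγ.normalPart_mem V (left_mem_Icc.2 hl.le)⟩)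
    (hBV₀ : RauchComparison.normalPart γ₀ (Icc 0 l)
        (RauchComparison.covDeriv γ₀ (Icc 0 l) V₀) 0 =
      B₀ ⟨RauchComparison.normalPart γ₀ (Icc 0 l) V₀ 0,
        hγ₀.normalPart_mem V₀ (left_mem_Icc.2 hl.le)⟩)
    (hfocal : ∀ τ, ¬ RauchComparison.IsFocalPoint γ₀ l B₀ τ) :
    (∀ t ∈ Icc (0 : ℝ) l, ‖V₀ t‖ ≤ ‖V t‖) ∧
    ∀ t₀ ∈ Ioc (0 : ℝ) l, ‖V t₀‖ = ‖V₀ t₀‖ →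
      (∀ t ∈ Icc (0 : ℝ) t₀,
        ‖RauchComparison.normalPart γ (Icc 0 l) V t‖ =
          ‖RauchComparison.normalPart γ₀ (Icc 0 l) V₀ t‖ ∧
        ‖V t‖ = ‖V₀ t‖) ∧
      (RauchComparison.normalPart γ (Icc 0 l) V 0 ≠ 0 →
        (∀ t ∈ Icc (0 : ℝ) t₀,
          RauchComparison.normalPart γ (Icc 0 l) V t ≠ 0 ∧
          RauchComparison.normalPart γ₀ (Icc 0 l) V₀ t ≠ 0 ∧
          RauchComparison.sectionalCurvature (γ t)
              (RauchComparison.velocity γ (Icc 0 l) t) (V t) =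
            RauchComparison.sectionalCurvature (γ₀ t)
              (RauchComparison.velocity γ₀ (Icc 0 l) t) (V₀ t)) ∧
        RauchComparison.IsParallel γ (Icc 0 t₀) (fun t ↦
          ‖RauchComparison.normalPart γ (Icc 0 l) V t‖⁻¹ •
            RauchComparison.normalPart γ (Icc 0 l) V t) ∧
        RauchComparison.IsParallel γ₀ (Icc 0 t₀) (fun t ↦
          ‖RauchComparison.normalPart γ (Icc 0 l) V t‖⁻¹ •
            RauchComparison.normalPart γ₀ (Icc 0 l) V₀ t)) := by
  have h0 : (0 : ℝ) ∈ Icc 0 l := left_mem_Icc.2 hl.le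
  obtain ⟨P, hP⟩ := hγ.exists_isNormalTransport hl
  obtain ⟨P₀, hP₀⟩ := hγ₀.exists_isNormalTransport hl
  obtain ⟨A, hA, hA0⟩ := hP₀.exists_isRiccatiSolution hl hγ₀ hB₀ hfocal
  have := hγ₀.nontrivial_normalSpace hdim h0
  have hPV : LinearMap.adjoint (P 0) (V 0) = ⟨_, hγ.normalPart_mem V h0⟩ :=
    Subtype.ext (hP.adjoint_zero hl hγ V)
  have hPV' : LinearMap.adjoint (P 0) (RauchComparison.covDeriv γ (Icc 0 l) V 0) =
      B (LinearMap.adjoint (P 0) (V 0)) := by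
    rw [hPV]
    exact Subtype.ext ((hP.adjoint_zero hl hγ _).trans hBV)
  have hPV₀ : LinearMap.adjoint (P₀ 0) (V₀ 0) = ⟨_, hγ₀.normalPart_mem V₀ h0⟩ :=
    Subtype.ext (hP₀.adjoint_zero hl hγ₀ V₀)
  have hPV₀' : LinearMap.adjoint (P₀ 0) (RauchComparison.covDeriv γ₀ (Icc 0 l) V₀ 0) =
      B₀ (LinearMap.adjoint (P₀ 0) (V₀ 0)) := by
    rw [hPV₀]
    exact Subtype.ext ((hP₀.adjoint_zero hl hγ₀ _).trans hBV₀)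
  -- the tangential components agree, so that comparing the norms means comparing the normal parts
  have htang : ∀ t ∈ Icc (0 : ℝ) l, ⟪RauchComparison.velocity γ (Icc 0 l) t, V t⟫_ℝ =
      ⟪RauchComparison.velocity γ₀ (Icc 0 l) t, V₀ t⟫_ℝ := fun t ht ↦ by
    rw [hV.inner_velocity hl hγ ht, hV₀.inner_velocity hl hγ₀ ht, htan, htan']
  have hle_iff : ∀ t ∈ Icc (0 : ℝ) l, ‖V₀ t‖ ≤ ‖V t‖ ↔
      ‖LinearMap.adjoint (P₀ t) (V₀ t)‖ ≤ ‖LinearMap.adjoint (P t) (V t)‖ := fun t ht ↦ by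
    rw [← sq_le_sq₀ (norm_nonneg _) (norm_nonneg _), hP.norm_sq_eq hγ ht, hP₀.norm_sq_eq hγ₀ ht,
      htang t ht, add_le_add_iff_right, sq_le_sq₀ (norm_nonneg _) (norm_nonneg _)]
  have heq_iff : ∀ t ∈ Icc (0 : ℝ) l, ‖V t‖ = ‖V₀ t‖ ↔
      ‖LinearMap.adjoint (P t) (V t)‖ = ‖LinearMap.adjoint (P₀ t) (V₀ t)‖ := fun t ht ↦ by
    rw [← sq_eq_sq₀ (norm_nonneg _) (norm_nonneg _), hP.norm_sq_eq hγ ht, hP₀.norm_sq_eq hγ₀ ht,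
      htang t ht, add_left_inj, sq_eq_sq₀ (norm_nonneg _) (norm_nonneg _)]
  have hcurv : ∀ t ∈ Icc (0 : ℝ) l,
      ∀ e : RauchComparison.normalSpace (E := E₀) γ₀ (Icc 0 l) 0, ‖e‖ = 1 →
      ⟪RauchComparison.transportedJacobiOperator γ l P t (LinearMap.adjoint (P t) (V t)),
        LinearMap.adjoint (P t) (V t)⟫_ℝ ≤
      ⟪RauchComparison.transportedJacobiOperator γ₀ l P₀ t e, e⟫_ℝ *
        ‖LinearMap.adjoint (P t) (V t)‖ ^ 2 := by
    intro t ht e he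
    by_cases hv : LinearMap.adjoint (P t) (V t) = 0
    · simp [hv]
    have h := hK t ht (P t (LinearMap.adjoint (P t) (V t))) (P₀ t e)
      (hP.linearIndependent hγ ht hv)
      (hP₀.linearIndependent hγ₀ ht (by rw [← norm_ne_zero_iff, he]; exact one_ne_zero))
    rw [hP.sectionalCurvature_eq hγ ht, hP₀.sectionalCurvature_eq hγ₀ ht, hP.adjoint_apply ht,
      hP₀.adjoint_apply ht, he, one_pow, div_one, div_le_iff₀ (by positivity)] at h
    exact h
  obtain ⟨hle, heq⟩ := RauchComparison.normal_comparison
    (hP.contDiffOn_transportedJacobiOperator hl hγ).continuousOn hA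
    (fun t ht ↦ hP.hasDerivWithinAt_adjoint hl hγ ht (hV.1 t ht))
    (fun t ht ↦ hP.hasDerivWithinAt_adjoint_covDeriv hl hγ ht hV)
    (fun t ht ↦ hP₀.hasDerivWithinAt_adjoint hl hγ₀ ht (hV₀.1 t ht))
    (fun t ht ↦ hP₀.hasDerivWithinAt_adjoint_covDeriv hl hγ₀ ht hV₀)
    hcurv
    (fun e he ↦ by
      have := RauchComparison.inner_mul_norm_sq_le_of_eigenvalues_le hB hB₀ heig
        (LinearMap.adjoint (P 0) (V 0)) e
      rwa [he, one_pow, mul_one, ← hPV', ← hA0] at this)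
    (hPV₀'.trans (hA0 _).symm) (fun h ↦ by rw [hPV', h, map_zero])
    ((hle_iff 0 h0).1 hnorm)
  refine ⟨fun t ht ↦ (hle_iff t ht).2 (hle t ht), fun t₀ ht₀ h ↦ ?_⟩
  have hsub : ∀ t ∈ Icc 0 t₀, t ∈ Icc 0 l := fun t ht ↦ ⟨ht.1, ht.2.trans ht₀.2⟩
  obtain ⟨h1, h2⟩ := heq t₀ ht₀ ((heq_iff t₀ (Ioc_subset_Icc_self ht₀)).1 h)
  refine ⟨fun t ht ↦ ⟨?_, (heq_iff t (hsub t ht)).2 (h1 t ht)⟩, fun hne ↦ ?_⟩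
  · rw [hP.norm_normalPart hγ (hsub t ht), hP₀.norm_normalPart hγ₀ (hsub t ht), h1 t ht]
  obtain ⟨u, u₀, hu⟩ := h2 (by rwa [hPV, Ne, Submodule.mk_eq_zero])
  have hn : ∀ t ∈ Icc 0 t₀, ‖RauchComparison.normalPart γ (Icc 0 l) V t‖ =
      ‖LinearMap.adjoint (P t) (V t)‖ := fun t ht ↦ hP.norm_normalPart hγ (hsub t ht) V
  refine ⟨fun t ht ↦ ?_, hP.isParallel_inv_smul_normalPart hγ ht₀ (x := u) fun t ht ↦ ?_,
    hP₀.isParallel_inv_smul_normalPart hγ₀ ht₀ (x := u₀) fun t ht ↦ ?_⟩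
  · obtain ⟨hv, hv₀, -, -, hR⟩ := hu t ht
    refine ⟨?_, ?_, ?_⟩
    · rwa [← norm_ne_zero_iff, hn t ht, norm_ne_zero_iff]
    · rwa [← norm_ne_zero_iff, hP₀.norm_normalPart hγ₀ (hsub t ht), norm_ne_zero_iff]
    · rw [hP.sectionalCurvature_eq hγ (hsub t ht), hP₀.sectionalCurvature_eq hγ₀ (hsub t ht), hR,
        h1 t ht]
  · rw [hn t ht]
    exact ⟨norm_ne_zero_iff.2 (hu t ht).1, (hu t ht).2.2.1⟩
  · rw [hn t ht]
    exact ⟨norm_ne_zero_iff.2 (hu t ht).1, (hu t ht).2.2.2.1⟩
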